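/- **Setting.** Let $\delta,B,K,C,\bar c>0$ with $CK>1$. A law $\nu$ on $\mathbb R$ is called *standard subgaussian with moment at most $B$* if it has mean $0$, variance $1$ and $\nu(|x|>t)\le 2e^{-t^2/B^2}$ for all $t>0$. For $p\in[0,1]$ and such a $\nu$, let $M_n$ be the symmetric $n\times n$ random matrix with entries $\delta_{ij}\xi_{ij}$ for $i\le j$, where the $\delta_{ij}$ are Bernoulli($p$), the $\xi_{ij}$ have law $\nu$, and all these variables are independent. $\|\cdot\|$ is the Euclidean norm on $\mathbb R^n$ and $S^{n-1}$ its unit sphere. *Parameters.* $M=\frac{n}{(np)^{1/16}}$, $\alpha=(np)^{-1/16}$, $\ell_0=\left\lceil\frac{\log(1/(8p))}{\log\sqrt{pn}}\right\rceil$, $\rho=(CK)^{-\ell_0-6}$. *Incompressible vectors.* $\mathrm{Incomp}(M,\rho)$ is the set of $v\in S^{n-1}$ such that $\|v-y\|>\rho$ for every $y$ with at most $M$ non-zero coordinates. *LCD.* Call $\delta_0\in(0,1)$ admissible if for some $r\in(0,1)$ one has $\sup_{u}\mathbb P(|\delta\xi-u|\le\varepsilon)\le 1-\delta_0p$ for all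 $\varepsilon\le r$, all $p\in[0,1]$ and all independent $\delta\sim$ Bernoulli($p$), $\xi\sim\nu$ with $\nu$ standard subgaussian with moment at most $B$. For such $\delta_0$, and $x\in S^{m-1}$, $$D(x)=\inf\Big\{\theta>0:\ \mathrm{dist}(\theta x,\mathbb Z^m)<(\delta_0p)^{-1/2}\sqrt{\log_+(\sqrt{\delta_0p}\,\theta)}\Big\}.$$ *Regularized LCD.* For each $v\in\mathrm{Incomp}(M,\rho)$ fix, arbitrarily, a set $\sigma(v)$ of exactly $\lceil M\rho^2/2\rceil$ indices $k$ with $\frac{\rho}{\sqrt{2n}}\le|v_k|\le\frac1{\sqrt M}$, and a set $\tau'(v)$ of $\lfloor M\rfloor$ indices of coordinates of largest magnitude. Let $\tau=\tau'\setminus\sigma$, $\bar\sigma=[n]\setminus(\tau\cup\sigma)$, $m=\lceil\alpha n\rceil$, $k_0=\lfloor (n-|\tau|)/m\rfloor$. The blocks $I_1,\dots,I_{k_0}$ are formed in turn by drawing in increasing order from $\sigma$ and $\bar\sigma$: $I_k$ takes the next $\lceil M\rho^2/(2k_0)\rceil$ elements of $\sigma$ (or what is left of $\sigma$, if fewer)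 and is filled up to $m$ elements with the next elements of $\bar\sigma$. With $v_I$ the restriction of $v$ to $I$, put $$\hat D(v)=\max_{1\le k\le k_0}D\big(v_{I_k}/\|v_{I_k}\|\big),\qquad \hat S_D=\{v\in\mathrm{Incomp}(M,\rho): D\le\hat D(v)\le 2D\}.$$ **Proposition (Mid-range LCD).** Admissible constants $\delta_0$ exist. Moreover, for every admissible $\delta_0$ (with its radius $r$) there are constants $c,c'',\tilde c>0$, depending only on $\delta$, $B$ and the fixed constants $K,C,\bar c,\delta_0,r$, such that for every $n\ge1$, every $p\in[n^{-1+\delta},1]$, every $\lambda\in[-K\sqrt{pn},K\sqrt{pn}]$, every $D$ with $$\frac1{\bar c}\,\frac{n^{1/2}}{(pn)^{1/32}}\le D\le\exp\big((np)^{1/32}\big),$$ every choice of $\sigma,\tau'$ as above and every standard subgaussian $\nu$ with moment at most $B$, $$\mathbb P\Big(\exists v\in\hat S_D:\ \|(M_n-\lambda)v\|\le\tilde c\,\varepsilon_0\,(pn)^{7/16}\Big)\le\exp(-c''n),\qquad \varepsilon_0=c\,\frac{n^{1/2}}{(np)^{1/32}D}.$$ -/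

import Mathlib

open MeasureTheory ProbabilityTheory

noncomputable section

namespace SparseSpectrum

/-! ### The random matrix -/

/-- `ν` is a probability law on `ℝ` with mean zero, variance one and subgaussian moment at most
`B`, that is `ν {|x| > t} ≤ 2 exp (-t² / B²)` for all `t > 0`. -/
structure IsStandardSubgaussian (ν : Measure ℝ) (B : ℝ) : Prop where
  isProbabilityMeasure : IsProbabilityMeasure ν
  mean_eq_zero : ∫ x, x ∂ν = 0
  variance_eq_one : Var[id; ν] = 1
  tail_le : ∀ t : ℝ, 0 < t → ν.real {x | t < |x|} ≤ 2 * Real.exp (-t ^ 2 / B ^ 2)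

/-- Positions on or above the diagonal. -/
abbrev UpperIndex (n : ℕ) : Type := {e : Fin n × Fin n // e.1 ≤ e.2}

/-- `A` is a symmetric random matrix with `A i j = δ i j * ξ i j` for `i ≤ j`, where the `δ i j` are
Bernoulli variables with parameter `p`, the `ξ i j` have law `ν`, and all these variables are
independent. -/
structure IsSparseSymmetric {Ω : Type*} [MeasurableSpace Ω] (μ : Measure Ω) (ν : Measure ℝ)
    (p : unitInterval) {n : ℕ} (A : Ω → Matrix (Fin n) (Fin n) ℝ) : Prop where
  isSymm : ∀ ω, (A ω).IsSymm
  exists_factors : ∃ δ ξ : UpperIndex n → Ω → ℝ,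
    (∀ e, HasLaw (δ e) (bernoulliMeasure (1 : ℝ) 0 p) μ) ∧
    (∀ e, HasLaw (ξ e) ν μ) ∧
    iIndepFun (Sum.elim δ ξ) μ ∧
    ∀ ω e, A ω e.1.1 e.1.2 = δ e ω * ξ e ω

/-! ### Compressible and incompressible vectors -/

/-- Vectors with at most `M` non-zero coordinates. -/
def Sparse (n : ℕ) (M : ℝ) : Set (EuclideanSpace ℝ (Fin n)) :=
  {x | ((Finset.univ.filter fun i => x i ≠ 0).card : ℝ) ≤ M}

def Comp (n : ℕ) (M ρ : ℝ) : Set (EuclideanSpace ℝ (Fin n)) :=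
  {x | ‖x‖ = 1 ∧ ∃ y ∈ Sparse n M, ‖x - y‖ ≤ ρ}

def Incomp (n : ℕ) (M ρ : ℝ) : Set (EuclideanSpace ℝ (Fin n)) :=
  {x | ‖x‖ = 1 ∧ x ∉ Comp n M ρ}

/-! ### The least common denominator -/

/-- The Lévy concentration function of a law on `ℝ`. -/
def levy (κ : Measure ℝ) (ε : ℝ) : ℝ :=
  ⨆ u : ℝ, κ.real {x | |x - u| ≤ ε}

/-- The law of a product `δ ξ`, with `δ` Bernoulli of parameter `p` and `ξ` of law `ν`,
independent. -/
def sparseLaw (ν : Measure ℝ) (p : unitInterval) : Measure ℝ :=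
  ((bernoulliMeasure (1 : ℝ) 0 p).prod ν).map fun z => z.1 * z.2

/-- `δ₀`, with the radius `r`, is an admissible constant for the least common denominator: the
Lévy concentration of every sparse variable of the class is at most `1 - δ₀ p` up to radius `r`. -/
structure IsLCDConstant (B δ₀ r : ℝ) : Prop where
  mem_Ioo : δ₀ ∈ Set.Ioo (0 : ℝ) 1
  radius_mem_Ioo : r ∈ Set.Ioo (0 : ℝ) 1
  levy_le : ∀ ν : Measure ℝ, IsStandardSubgaussian ν B → ∀ p : unitInterval, ∀ ε ≤ r,
    levy (sparseLaw ν p) ε ≤ 1 - δ₀ * p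

/-- The integer lattice of `ℝ^ι`. -/
def integerLattice (ι : Type*) : Set (EuclideanSpace ℝ ι) :=
  {z | ∀ i, ∃ k : ℤ, z i = k}

/-- The least common denominator `D(x)`. -/
def lcd {ι : Type*} [Fintype ι] (δ₀ p : ℝ) (x : EuclideanSpace ℝ ι) : ℝ :=
  sInf {θ : ℝ | 0 < θ ∧ Metric.infDist (θ • x) (integerLattice ι) <
    (Real.sqrt (δ₀ * p))⁻¹ * Real.sqrt (Real.posLog (Real.sqrt (δ₀ * p) * θ))}

/-! ### The partition of the coordinates and the regularized LCD -/

/-- The restriction of `v` to the coordinates in `I`. -/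
def restrict {n : ℕ} (v : EuclideanSpace ℝ (Fin n)) (I : Finset (Fin n)) :
    EuclideanSpace ℝ I :=
  WithLp.toLp 2 fun i => v i

/-- The coordinates of `v` of spread magnitude. -/
def spreadSet {n : ℕ} (M ρ : ℝ) (v : EuclideanSpace ℝ (Fin n)) : Set (Fin n) :=
  {k | ρ / Real.sqrt (2 * n) ≤ |v k| ∧ |v k| ≤ 1 / Real.sqrt M}

/-- A choice, for every incompressible `v`, of exactly `⌈M ρ² / 2⌉` coordinates of spread
magnitude. -/
def IsSpreadChoice {n : ℕ} (M ρ : ℝ) (σ : EuclideanSpace ℝ (Fin n) → Finset (Fin n)) : Prop :=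
  ∀ v ∈ Incomp n M ρ, (∀ k ∈ σ v, k ∈ spreadSet M ρ v) ∧ (σ v).card = ⌈M * ρ ^ 2 / 2⌉₊

/-- A choice, for every incompressible `v`, of `⌊M⌋` coordinates of largest magnitude (ties are
broken arbitrarily). -/
def IsTopChoice {n : ℕ} (M ρ : ℝ) (τ' : EuclideanSpace ℝ (Fin n) → Finset (Fin n)) : Prop :=
  ∀ v ∈ Incomp n M ρ, (τ' v).card = ⌊M⌋₊ ∧ ∀ i ∈ τ' v, ∀ j ∉ τ' v, |v j| ≤ |v i|

/-- The elements of `S` in the positions `a, …, b - 1`, when `S` is listed in increasing order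
and positions are counted from `0`; positions beyond the end of the list are ignored. -/
def chunk {n : ℕ} (S : Finset (Fin n)) (a b : ℕ) : Finset (Fin n) :=
  S.filter fun i => a ≤ (S.filter (· < i)).card ∧ (S.filter (· < i)).card < b

/-- The number `k₀` of blocks of size `m` that fit into `[n] \ τ`, `τ = τ' \ σ`. -/
def blockCount {n : ℕ} (m : ℕ) (σ τ' : Finset (Fin n)) : ℕ :=
  (n - (τ' \ σ).card) / m

/-- The blocks of the partition of `[n] \ τ`, numbered from `0`. Block `j` takes the next
`a = ⌈M ρ² / (2 k₀)⌉` elements of `σ` (what is left of `σ`, if fewer), and is filled up to `m`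
elements with the next elements of the complement of `τ ∪ σ`. -/
def block {n : ℕ} (M ρ : ℝ) (m : ℕ) (σ τ' : Finset (Fin n)) (j : ℕ) : Finset (Fin n) :=
  let a : ℕ := ⌈M * ρ ^ 2 / (2 * (blockCount m σ τ' : ℝ))⌉₊
  let used : ℕ → ℕ := fun i => min (i * a) σ.card
  chunk σ (j * a) ((j + 1) * a) ∪
    chunk ((τ' \ σ) ∪ σ)ᶜ (j * m - used j) ((j + 1) * m - used (j + 1))

/-- The regularized LCD of `v` for the partition given by `σ`, `τ'`: the largest LCD of a
normalized restriction of `v` to one of the `k₀` blocks, of size `⌈α n⌉`. -/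
def regLCD {n : ℕ} (δ₀ p M ρ α : ℝ) (σ τ' : Finset (Fin n)) (v : EuclideanSpace ℝ (Fin n)) : ℝ :=
  ⨆ j : Fin (blockCount ⌈α * n⌉₊ σ τ'),
    lcd δ₀ p (‖restrict v (block M ρ ⌈α * n⌉₊ σ τ' j)‖⁻¹ •
      restrict v (block M ρ ⌈α * n⌉₊ σ τ' j))

/-! ### The parameters -/

def ell0 (n : ℕ) (p : ℝ) : ℤ :=
  ⌈Real.log (1 / (8 * p)) / Real.log (Real.sqrt (p * n))⌉

/-- `ρ = (C K)^(-ℓ₀ - 6)`. -/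
def rho (C K : ℝ) (n : ℕ) (p : ℝ) : ℝ :=
  (C * K) ^ (-ell0 n p - 6)

/-- `M = n / (n p)^(1/16)`. -/
def bigM (n : ℕ) (p : ℝ) : ℝ :=
  n / (n * p) ^ (1 / 16 : ℝ)

/-- `α = (n p)^(-1/16)`. -/
def alpha (n : ℕ) (p : ℝ) : ℝ :=
  (n * p) ^ (-(1 / 16) : ℝ)

/-- `Ŝ_D`: the incompressible vectors with regularized LCD in `[D, 2 D]`. -/
def levelSet (n : ℕ) (p C K δ₀ D : ℝ) (σ τ' : EuclideanSpace ℝ (Fin n) → Finset (Fin n)) :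
    Set (EuclideanSpace ℝ (Fin n)) :=
  {v | v ∈ Incomp n (bigM n p) (rho C K n p) ∧
    regLCD δ₀ p (bigM n p) (rho C K n p) (alpha n p) (σ v) (τ' v) v ∈ Set.Icc D (2 * D)}

end SparseSpectrum

end

namespace SparseSpectrum

/-! ### The laws of the entries -/

/-! Write `x = (np)^{1/32}`, `a = δ₀ p` and `E = D x / √n`. The lower bound on `D` says exactly that
`cbar * E ≥ 1`. Large and bounded dimensions are treated separately.

For large `n` a union bound over a net of the level set is played against a small ball estimate at
each point of the net. Every block of a vector of the level set has LCD at most `2D`, so it has the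
form `t (q + w)` with `q` integral, `w` small in `ℓ²`, and `t θ ≤ 1` for some `θ ≤ 3D`. At mesh `η =
1/(x⁸ D)` the vector is determined by a few outer data (scales, denominators, exceptional
coordinates), by the integers `q` and by bounded corrections, so the net has at most `(C E)^n`
points (`exists_cover`, `cover_factor_le`).

On the other side, some block `J` has LCD at least `D`. Keep only the rows `i ∉ J`, and resample in
them only the entries with column in `J`. In spite of the symmetry these sets of entries are
disjoint for different rows, so the row bounds multiply (`measure_rowForm_small_le`). A single row
is a Fourier estimate (`row_bound`): the mean of `exp(-S²/2)` is at most a Gaussian average of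
moduli of characteristic functions, and these decay because no `θ < D` is a denominator. Each row
contributes at most `κ²/E`, where `κ` becomes small with the threshold constant. As `|J| = O(n/x²)`,
the loss `E^|J|` is at most `e^n`, the powers of `E` cancel against the net, and a small `κ` absorbs
every remaining constant (`measure_level_le`).

Passing from `v` to a net point uses no operator norm bound. Coordinates are rounded up or down one
by one so that the cross terms are non-positive, and the error is then at most `η` times the
Hilbert-Schmidt norm (`exists_rounding`). That norm is of order `n √p`, the same as `√n` times an
operator norm of order `√(pn)`, and its tail follows from an exponential moment
(`measure_sum_sq_ge_le`).

For bounded `n`, `ε₀ ≤ cbar` bounds the threshold by `ctilde * cbar * n`, so quantitative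
invertibility of `M_n - λ` with positive probability suffices. Diagonal entries are exposed one at a
time: each leading minor is affine in its last diagonal entry, with the preceding minor as slope
(`pow_le_measure_le_det`). In finitely many dimensions a probability bounded away from one is of the
form `exp(-c n)`. -/

lemma sparseLaw_eq (ν : Measure ℝ) [IsProbabilityMeasure ν] (p : unitInterval) :
    sparseLaw ν p = ENNReal.ofReal p • ν + ENNReal.ofReal (1 - p) • Measure.dirac 0 := by
  have hm : Measurable fun z : ℝ × ℝ => z.1 * z.2 := by fun_prop
  have e1 : ENNReal.ofReal p = ((unitInterval.toNNReal p : NNReal) : ENNReal) := by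
    rw [ENNReal.ofReal, ENNReal.coe_inj]
    exact Subtype.ext (by simp [p.2.1])
  have e2 : ENNReal.ofReal (1 - p) =
      ((unitInterval.toNNReal (unitInterval.symm p) : NNReal) : ENNReal) := by
    rw [ENNReal.ofReal, ENNReal.coe_inj]
    exact Subtype.ext (by simp [p.2.2])
  ext s hs
  rw [sparseLaw, Measure.map_apply hm hs, Measure.prod_apply (hm hs), bernoulliMeasure_def, e1, e2]
  rw [lintegral_add_measure, lintegral_smul_measure, lintegral_smul_measure,
    lintegral_dirac' _ (measurable_measure_prodMk_left (hm hs)),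
    lintegral_dirac' _ (measurable_measure_prodMk_left (hm hs))]
  simp only [Set.preimage_preimage, one_mul, zero_mul, Set.preimage_id', Measure.coe_add,
    Measure.coe_smul, Pi.add_apply, Pi.smul_apply, Measure.dirac_apply' _ hs]
  congr 2
  by_cases h : (0 : ℝ) ∈ s <;> simp [h]

instance (ν : Measure ℝ) [IsProbabilityMeasure ν] (p : unitInterval) :
    IsProbabilityMeasure (sparseLaw ν p) := by
  unfold sparseLaw
  exact Measure.isProbabilityMeasure_map (by fun_prop)

lemma sparseLaw_real (ν : Measure ℝ) [IsProbabilityMeasure ν] (p : unitInterval) (s : Set ℝ) :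
    (sparseLaw ν p).real s = p * ν.real s + (1 - p) * (Measure.dirac (0 : ℝ)).real s := by
  have h1 : ENNReal.ofReal p * ν s ≠ ⊤ :=
    ENNReal.mul_ne_top ENNReal.ofReal_ne_top (measure_ne_top _ _)
  have h2 : ENNReal.ofReal (1 - p) * Measure.dirac (0 : ℝ) s ≠ ⊤ :=
    ENNReal.mul_ne_top ENNReal.ofReal_ne_top (measure_ne_top _ _)
  rw [sparseLaw_eq, measureReal_def, Measure.add_apply, Measure.smul_apply, Measure.smul_apply,
    smul_eq_mul, smul_eq_mul, ENNReal.toReal_add h1 h2, ENNReal.toReal_mul, ENNReal.toReal_mul,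
    ENNReal.toReal_ofReal p.2.1, ENNReal.toReal_ofReal (sub_nonneg.2 p.2.2)]
  rfl

/-- Layer cake. The exponent is half the tail rate, so heights `t > 1` are exceeded with mass at
most `2 t⁻²`, which integrates to 2; heights below 1 contribute at most 1. -/
lemma IsStandardSubgaussian.lintegral_exp_le {ν : Measure ℝ} {B : ℝ}
    (h : IsStandardSubgaussian ν B) (hB : 0 < B) :
    ∫⁻ x, ENNReal.ofReal (Real.exp (x ^ 2 / (2 * B ^ 2))) ∂ν ≤ 3 := by
  have := h.isProbabilityMeasure
  rw [lintegral_eq_lintegral_meas_lt ν (Filter.Eventually.of_forall fun x => (Real.exp_pos _).le)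
    (by fun_prop)]
  have key : ∀ t : ℝ, 1 < t → ν {a | t < Real.exp (a ^ 2 / (2 * B ^ 2))} ≤
      ENNReal.ofReal (2 * t ^ (-2 : ℝ)) := by
    intro t ht
    have ht0 : 0 < t := by linarith
    have hl : 0 < Real.log t := Real.log_pos ht
    have h2 : 0 < 2 * B ^ 2 * Real.log t := by positivity
    have hs : {a : ℝ | t < Real.exp (a ^ 2 / (2 * B ^ 2))} =
        {a | Real.sqrt (2 * B ^ 2 * Real.log t) < |a|} := by
      ext a
      simp only [Set.mem_ofPred_eq]
      rw [← Real.log_lt_iff_lt_exp ht0, lt_div_iff₀ (by positivity), ← Real.sqrt_sq_eq_abs,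
        Real.sqrt_lt_sqrt_iff h2.le, mul_comm]
    rw [hs, ← ofReal_measureReal]
    apply ENNReal.ofReal_le_ofReal
    refine (h.tail_le _ (Real.sqrt_pos.2 h2)).trans_eq ?_
    rw [Real.sq_sqrt h2.le, Real.rpow_def_of_pos ht0]
    congr 2
    field_simp
  have hsplit : Set.Ioi (0 : ℝ) = Set.Ioc 0 1 ∪ Set.Ioi 1 := by
    rw [Set.Ioc_union_Ioi_eq_Ioi zero_le_one]
  rw [hsplit]
  refine (lintegral_union_le _ _ _).trans ?_
  have h1 : ∫⁻ t in Set.Ioc (0 : ℝ) 1, ν {a | t < Real.exp (a ^ 2 / (2 * B ^ 2))} ≤ 1 := by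
    calc _ ≤ ∫⁻ t in Set.Ioc (0 : ℝ) 1, 1 := lintegral_mono fun t => prob_le_one
      _ = 1 := by simp
  have h2 : ∫⁻ t in Set.Ioi (1 : ℝ), ν {a | t < Real.exp (a ^ 2 / (2 * B ^ 2))} ≤ 2 := by
    calc _ ≤ ∫⁻ t in Set.Ioi (1 : ℝ), ENNReal.ofReal (2 * t ^ (-2 : ℝ)) :=
          setLIntegral_mono' measurableSet_Ioi fun t ht => key t ht
      _ = ENNReal.ofReal (∫ t in Set.Ioi (1 : ℝ), 2 * t ^ (-2 : ℝ)) := by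
          rw [ofReal_integral_eq_lintegral_ofReal]
          · exact (integrableOn_Ioi_rpow_of_lt (by norm_num) zero_lt_one).const_mul 2
          · filter_upwards [ae_restrict_mem measurableSet_Ioi] with t ht
            have : (0 : ℝ) < t := lt_trans zero_lt_one ht
            positivity
      _ = 2 := by
          rw [integral_const_mul, integral_Ioi_rpow_of_lt (by norm_num) zero_lt_one]
          norm_num
  calc _ ≤ (1 : ENNReal) + 2 := add_le_add h1 h2
    _ = 3 := by norm_num

lemma IsStandardSubgaussian.integrable_exp {ν : Measure ℝ} {B : ℝ}
    (h : IsStandardSubgaussian ν B) (hB : 0 < B) :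
    Integrable (fun x => Real.exp (x ^ 2 / (2 * B ^ 2))) ν := by
  refine ⟨by fun_prop, ?_⟩
  rw [hasFiniteIntegral_iff_ofReal (Filter.Eventually.of_forall fun x => (Real.exp_pos _).le)]
  exact (h.lintegral_exp_le hB).trans_lt (by norm_num)

lemma IsStandardSubgaussian.integral_exp_le {ν : Measure ℝ} {B : ℝ}
    (h : IsStandardSubgaussian ν B) (hB : 0 < B) :
    ∫ x, Real.exp (x ^ 2 / (2 * B ^ 2)) ∂ν ≤ 3 := by
  have h1 := h.lintegral_exp_le hB
  rw [← ofReal_integral_eq_lintegral_ofReal (h.integrable_exp hB)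
    (Filter.Eventually.of_forall fun x => (Real.exp_pos _).le)] at h1
  rw [show (3 : ENNReal) = ENNReal.ofReal 3 by norm_num] at h1
  exact (ENNReal.ofReal_le_ofReal_iff (by norm_num)).1 h1

lemma IsStandardSubgaussian.integrable_pow_four {ν : Measure ℝ} {B : ℝ}
    (h : IsStandardSubgaussian ν B) (hB : 0 < B) :
    Integrable (fun x => x ^ 4) ν := by
  have := h.isProbabilityMeasure
  refine Integrable.mono' ((h.integrable_exp hB).const_mul (8 * B ^ 4)) (by fun_prop) ?_
  refine Filter.Eventually.of_forall fun x => ?_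
  have := Real.quadratic_le_exp_of_nonneg (x := x ^ 2 / (2 * B ^ 2)) (by positivity)
  rw [Real.norm_eq_abs, abs_of_nonneg (by positivity)]
  have h3 : (x ^ 2 / (2 * B ^ 2)) ^ 2 / 2 ≤ Real.exp (x ^ 2 / (2 * B ^ 2)) := by
    have : 0 ≤ x ^ 2 / (2 * B ^ 2) := by positivity
    linarith
  calc x ^ 4 = 8 * B ^ 4 * ((x ^ 2 / (2 * B ^ 2)) ^ 2 / 2) := by field_simp; norm_num
    _ ≤ _ := by gcongr

lemma IsStandardSubgaussian.integral_pow_four_le {ν : Measure ℝ} {B : ℝ}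
    (h : IsStandardSubgaussian ν B) (hB : 0 < B) : ∫ x, x ^ 4 ∂ν ≤ 24 * B ^ 4 := by
  calc ∫ x, x ^ 4 ∂ν ≤ ∫ x, 8 * B ^ 4 * Real.exp (x ^ 2 / (2 * B ^ 2)) ∂ν := by
        refine integral_mono (h.integrable_pow_four hB) ((h.integrable_exp hB).const_mul _) ?_
        intro x
        have := Real.quadratic_le_exp_of_nonneg (x := x ^ 2 / (2 * B ^ 2)) (by positivity)
        have h3 : (x ^ 2 / (2 * B ^ 2)) ^ 2 / 2 ≤ Real.exp (x ^ 2 / (2 * B ^ 2)) := by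
          have : 0 ≤ x ^ 2 / (2 * B ^ 2) := by positivity
          linarith
        calc x ^ 4 = 8 * B ^ 4 * ((x ^ 2 / (2 * B ^ 2)) ^ 2 / 2) := by field_simp; norm_num
          _ ≤ _ := mul_le_mul_of_nonneg_left h3 (by positivity)
    _ = 8 * B ^ 4 * ∫ x, Real.exp (x ^ 2 / (2 * B ^ 2)) ∂ν := integral_const_mul _ _
    _ ≤ 8 * B ^ 4 * 3 := mul_le_mul_of_nonneg_left (h.integral_exp_le hB) (by positivity)
    _ = 24 * B ^ 4 := by ring

lemma IsStandardSubgaussian.integrable_pow {ν : Measure ℝ} {B : ℝ}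
    (h : IsStandardSubgaussian ν B) (hB : 0 < B) {k : ℕ} (hk : k ≤ 4) :
    Integrable (fun x => x ^ k) ν := by
  have := h.isProbabilityMeasure
  refine Integrable.mono' ((integrable_const (1 : ℝ)).add (h.integrable_pow_four hB))
    (by fun_prop) (Filter.Eventually.of_forall fun x => ?_)
  rw [norm_pow, Real.norm_eq_abs, Pi.add_apply, ← (show Even 4 by decide).pow_abs x]
  rcases le_total |x| 1 with h1 | h1
  · have := pow_le_one₀ (n := k) (abs_nonneg x) h1
    have : 0 ≤ |x| ^ 4 := by positivity
    linarith
  · have := pow_le_pow_right₀ h1 hk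
    linarith

lemma IsStandardSubgaussian.integral_sq {ν : Measure ℝ} {B : ℝ}
    (h : IsStandardSubgaussian ν B) : ∫ x, x ^ 2 ∂ν = 1 := by
  have := h.isProbabilityMeasure
  rw [← h.variance_eq_one, variance_eq_integral (by fun_prop)]
  simp [h.mean_eq_zero]

/-- The second moment about `u` is `1 + u²`, and the window contributes at most `1/4` of it, so the
rest comes from the complement. The fourth moment then forces the complement to have mass. The bound
is uniform in `u` because `(1 + u²)²` and the fourth moment about `u` grow at the same rate. -/
lemma levy_prob_bound {ν : Measure ℝ} {B : ℝ} (h : IsStandardSubgaussian ν B) (hB : 0 < B)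
    (u : ℝ) : ν.real {x | |x - u| ≤ 1 / 2} ≤ 1 - 1 / (32 * (1 + 24 * B ^ 4)) := by
  have := h.isProbabilityMeasure
  set A : Set ℝ := {x | |x - u| ≤ 1 / 2} with hA
  have hAm : MeasurableSet A := measurableSet_le (by fun_prop) (by fun_prop)
  set F : ℝ := 1 + 24 * B ^ 4 with hF
  have hF1 : 1 ≤ F := by rw [hF]; have : 0 < B ^ 4 := by positivity
                         linarith
  have i4 := h.integrable_pow hB (k := 4) le_rfl
  have i2 := h.integrable_pow hB (k := 2) (by norm_num)
  have i1 : Integrable (fun x => x) ν := by simpa using h.integrable_pow hB (k := 1) (by norm_num)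
  have i12 : Integrable (fun x => 2 * u * x) ν := i1.const_mul _
  have i3 : Integrable (fun x => x ^ 2 - 2 * u * x) ν := i2.sub i12
  have e2 : ∫ x, (x - u) ^ 2 ∂ν = 1 + u ^ 2 := by
    have : (fun x : ℝ => (x - u) ^ 2) = fun x => (x ^ 2 - 2 * u * x) + u ^ 2 := by ext x; ring
    rw [this, integral_add i3 (integrable_const _), integral_sub i2 i12, integral_const_mul, h.mean_eq_zero, h.integral_sq]
    simp
  -- Weight in `y ≤ s y² / 2 + 1 / (2s)` for `y = (x - u)²`, chosen so that the fourth moment term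
  -- uses at most half of `1 + u²`.
  set s : ℝ := (1 + u ^ 2) / (8 * (F + u ^ 4)) with hs
  have hs0 : 0 < s := by positivity
  have hpt : ∀ x : ℝ, (x - u) ^ 2 ≤ 1 / 4 + (s * 4 * (x ^ 4 + u ^ 4) +
      Aᶜ.indicator (fun _ => 1 / (2 * s)) x) := by
    intro x
    have h8 : (x - u) ^ 4 ≤ 8 * (x ^ 4 + u ^ 4) := by
      nlinarith [sq_nonneg (x + u), sq_nonneg (x - u), sq_nonneg (x ^ 2 - u ^ 2),
        sq_nonneg (x * u), sq_nonneg ((x + u) ^ 2), sq_nonneg (x ^ 2 + u ^ 2 + x * u),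
        mul_nonneg (sq_nonneg (x + u)) (sq_nonneg (x - u)), sq_nonneg ((x + u) ^ 2)]
    by_cases hx : x ∈ A
    · have : (x - u) ^ 2 ≤ 1 / 4 := by
        have h2 : |x - u| ≤ 1 / 2 := hx
        rw [← sq_abs]; nlinarith [abs_nonneg (x - u)]
      have : 0 ≤ s * 4 * (x ^ 4 + u ^ 4) := by positivity
      have h0 : Aᶜ.indicator (fun _ => 1 / (2 * s)) x = 0 := by simp [hx]
      rw [h0]; linarith
    · have h0 : Aᶜ.indicator (fun _ => 1 / (2 * s)) x = 1 / (2 * s) := by simp [hx]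
      rw [h0]
      have : (x - u) ^ 2 ≤ s / 2 * (x - u) ^ 4 + 1 / (2 * s) := by
        have : 0 ≤ s / 2 * ((x - u) ^ 2 - 1 / s) ^ 2 := by positivity
        have e : s / 2 * ((x - u) ^ 2 - 1 / s) ^ 2 =
          s / 2 * (x - u) ^ 4 + 1 / (2 * s) - (x - u) ^ 2 := by field_simp; ring
        linarith
      nlinarith
  have hi : Integrable (Aᶜ.indicator (fun _ => 1 / (2 * s))) ν :=
    (integrable_const _).indicator hAm.compl
  have hint : 1 + u ^ 2 ≤ 1 / 4 + (s * 4 * (24 * B ^ 4 + u ^ 4) + (1 - ν.real A) * (1 / (2 * s))) := by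
    have h1 : Integrable (fun x => s * 4 * (x ^ 4 + u ^ 4)) ν :=
      (i4.add (integrable_const _)).const_mul _
    have h0 : Integrable (fun x => (x - u) ^ 2) ν := by
      have : (fun x : ℝ => (x - u) ^ 2) = fun x => (x ^ 2 - 2 * u * x) + u ^ 2 := by ext x; ring
      rw [this]; exact i3.add (integrable_const _)
    have := integral_mono h0 ((integrable_const (1 / 4 : ℝ)).add (h1.add hi)) hpt
    rw [e2] at this
    simp only [Pi.add_apply] at this
    have h1i : Integrable (fun x => s * 4 * (x ^ 4 + u ^ 4) +
      Aᶜ.indicator (fun _ => 1 / (2 * s)) x) ν := h1.add hi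
    rw [integral_add (integrable_const _) h1i, integral_add h1 hi, integral_const_mul,
      integral_add i4 (integrable_const _), integral_indicator hAm.compl] at this
    simp only [integral_const, probReal_univ, smul_eq_mul, one_mul, measureReal_restrict_apply,
      MeasurableSet.univ, Set.univ_inter, probReal_compl_eq_one_sub hAm] at this
    have h44 := h.integral_pow_four_le hB
    have : s * 4 * (∫ x, x ^ 4 ∂ν + u ^ 4) ≤ s * 4 * (24 * B ^ 4 + u ^ 4) := by gcongr
    linarith
  have hP : s * 4 * (24 * B ^ 4 + u ^ 4) ≤ (1 + u ^ 2) / 2 := by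
    have : s * 4 * (F + u ^ 4) = (1 + u ^ 2) / 2 := by
      rw [hs]; have : F + u ^ 4 ≠ 0 := by positivity
      field_simp; norm_num
    have : s * 4 * (24 * B ^ 4 + u ^ 4) ≤ s * 4 * (F + u ^ 4) := by gcongr; linarith
    linarith
  have h3 : (1 + u ^ 2) / 4 ≤ (1 - ν.real A) * (1 / (2 * s)) := by nlinarith [sq_nonneg u]
  have h4 : (1 + u ^ 2) / 4 * (2 * s) ≤ 1 - ν.real A := by
    rw [mul_one_div, le_div_iff₀ (by positivity)] at h3; exact h3
  have h5 : 1 / (32 * F) ≤ (1 + u ^ 2) / 4 * (2 * s) := by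
    rw [hs, show (1 + u ^ 2) / 4 * (2 * ((1 + u ^ 2) / (8 * (F + u ^ 4)))) =
      (1 + u ^ 2) ^ 2 / (16 * (F + u ^ 4)) by field_simp; norm_num]
    rw [div_le_div_iff₀ (by positivity) (by positivity)]
    nlinarith [sq_nonneg u, mul_nonneg (sub_nonneg.2 hF1) (sq_nonneg (u ^ 2)),
      mul_nonneg (sub_nonneg.2 hF1) (sq_nonneg u)]
  linarith

lemma levy_sparseLaw_le {ν : Measure ℝ} {B : ℝ} (h : IsStandardSubgaussian ν B) (hB : 0 < B)
    (p : unitInterval) {ε : ℝ} (hε : ε ≤ 1 / 2) :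
    levy (sparseLaw ν p) ε ≤ 1 - 1 / (32 * (1 + 24 * B ^ 4)) * p := by
  have := h.isProbabilityMeasure
  refine ciSup_le fun u => ?_
  have hAm : ∀ ε : ℝ, MeasurableSet {x : ℝ | |x - u| ≤ ε} := fun ε =>
    measurableSet_le (by fun_prop) (by fun_prop)
  have h1 : (sparseLaw ν p).real {x | |x - u| ≤ ε} ≤ (sparseLaw ν p).real {x | |x - u| ≤ 1 / 2} :=
    measureReal_mono fun x hx => le_trans hx hε
  refine h1.trans ?_
  have hb := levy_prob_bound h hB u
  rw [sparseLaw_real]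
  have h2 : (Measure.dirac (0 : ℝ)).real {x | |x - u| ≤ 1 / 2} ≤ 1 := measureReal_le_one
  have h0 := p.2.1
  have h3 := sub_nonneg.2 p.2.2
  nlinarith

lemma exists_isLCDConstant {B : ℝ} (hB : 0 < B) : ∃ δ₀ r : ℝ, IsLCDConstant B δ₀ r := by
  have h4 : 0 < B ^ 4 := by positivity
  refine ⟨1 / (32 * (1 + 24 * B ^ 4)), 1 / 2, ⟨by positivity, ?_⟩, ⟨by norm_num, by norm_num⟩,
    fun ν hν p ε hε => levy_sparseLaw_le hν hB p hε⟩
  rw [div_lt_one (by positivity)]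
  linarith

end SparseSpectrum

namespace SparseSpectrum

/-! ### A Gaussian Esseen inequality -/

/-- The distance of a real number to the nearest integer. -/
noncomputable def distInt (y : ℝ) : ℝ := |y - round y|

lemma distInt_nonneg (y : ℝ) : 0 ≤ distInt y := abs_nonneg _

lemma distInt_le_half (y : ℝ) : distInt y ≤ 1 / 2 := abs_sub_round y

lemma distInt_neg (y : ℝ) : distInt (-y) = distInt y := by
  have h : ∀ y : ℝ, distInt (-y) ≤ distInt y := by
    intro y
    have := round_le (-y) (-round y)
    rw [distInt, distInt]
    refine this.trans_eq ?_
    rw [← abs_neg]; push_cast; ring_nf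
  refine le_antisymm (h y) ?_
  simpa using h (-y)

lemma distInt_le_add (x y : ℝ) : distInt x ≤ distInt y + |x - y| := by
  refine (round_le x (round y)).trans ?_
  rw [distInt, add_comm]
  refine (abs_add_le _ _).trans_eq' ?_
  congr 1; ring

/-- From `(A + B)² ≤ (3/2) A² + 3 B²`. It lets the LCD of `v` serve for a nearby `v'`, at a cost
quadratic in the displacement. -/
lemma distInt_sq_ge (x y : ℝ) : 2 / 3 * distInt y ^ 2 - 2 * (x - y) ^ 2 ≤ distInt x ^ 2 := by
  have h := distInt_le_add y x
  rw [abs_sub_comm] at h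
  rw [← sq_abs (x - y)]
  have h0 := distInt_nonneg x
  have h1 := abs_nonneg (x - y)
  have h2 := distInt_nonneg y
  have : distInt y ^ 2 ≤ (distInt x + |x - y|) ^ 2 := by gcongr
  nlinarith [sq_nonneg (distInt x - 2 * |x - y|)]

@[fun_prop]
lemma measurable_distInt : Measurable distInt := by
  unfold distInt
  have : Measurable fun y : ℝ => (round y : ℝ) := by
    simp only [round_eq]
    exact (measurable_from_top (f := fun k : ℤ => (k : ℝ))).comp
      (Int.measurable_floor.comp (by fun_prop))
  fun_prop

/-- The right side is `2 sin²` of `π` times the distance to the integers, and `sin s ≥ 2s/π` on `[0,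
π/2]`. -/
lemma eight_mul_distInt_sq_le (y : ℝ) : 8 * distInt y ^ 2 ≤ 1 - Real.cos (2 * Real.pi * y) := by
  have h1 : Real.cos (2 * Real.pi * y) = Real.cos (2 * (Real.pi * distInt y)) := by
    have : Real.cos (2 * (Real.pi * distInt y)) = Real.cos (2 * Real.pi * (y - round y)) := by
      rw [distInt, ← Real.cos_abs (2 * Real.pi * (y - round y)), abs_mul,
        abs_of_pos (by positivity : 0 < 2 * Real.pi)]
      ring_nf
    rw [this, ← Real.cos_sub_int_mul_two_pi (2 * Real.pi * y) (round y)]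
    ring_nf
  have h2 := Real.mul_le_sin (x := Real.pi * distInt y)
    (mul_nonneg Real.pi_pos.le (distInt_nonneg y)) (by
      have := distInt_le_half y
      nlinarith [Real.pi_pos])
  have h3 : 2 / Real.pi * (Real.pi * distInt y) = 2 * distInt y := by
    field_simp
  rw [h3] at h2
  rw [h1, Real.cos_two_mul, Real.cos_sq']
  nlinarith [distInt_nonneg y]

/-- Symmetrization: the squared modulus is the characteristic function of the difference of two
independent copies, hence real. -/
lemma norm_charFun_sq (κ : Measure ℝ) [IsProbabilityMeasure κ] (s : ℝ) :
    ‖charFun κ s‖ ^ 2 = ∫ z, Real.cos (s * (z.1 - z.2)) ∂(κ.prod κ) := by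
  have h1 : ((‖charFun κ s‖ ^ 2 : ℝ) : ℂ) =
      ∫ z, Complex.exp (((s * (z.1 - z.2) : ℝ) : ℂ) * Complex.I) ∂(κ.prod κ) := by
    have h2 : (starRingEnd ℂ) (charFun κ s) = ∫ y, Complex.exp (-(s * y) * Complex.I) ∂κ := by
      rw [charFun_apply_real, ← integral_conj]
      congr 1; ext y
      rw [← Complex.exp_conj]
      simp
    rw [Complex.ofReal_pow, ← Complex.mul_conj', h2, charFun_apply_real, ← integral_prod_mul]
    congr 1; ext z
    rw [← Complex.exp_add]
    congr 1; push_cast; ring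
  have hI : Integrable (fun z : ℝ × ℝ => Complex.exp (((s * (z.1 - z.2) : ℝ) : ℂ) * Complex.I))
      (κ.prod κ) := by
    refine Integrable.of_bound (by fun_prop) 1 (Filter.Eventually.of_forall fun z => ?_)
    rw [Complex.norm_exp_ofReal_mul_I]
  have h3 := congrArg Complex.re h1
  rw [Complex.ofReal_re] at h3
  rw [h3, ← RCLike.re_eq_complex_re, ← integral_re hI]
  congr 1; ext z
  rw [RCLike.re_eq_complex_re, Complex.exp_ofReal_mul_I_re]

lemma norm_charFun_le (κ : Measure ℝ) [IsProbabilityMeasure κ] (s : ℝ) :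
    ‖charFun κ s‖ ≤
      Real.exp (-4 * ∫ z, distInt (s * (z.1 - z.2) / (2 * Real.pi)) ^ 2 ∂(κ.prod κ)) := by
  have hc : Integrable (fun z : ℝ × ℝ => Real.cos (s * (z.1 - z.2))) (κ.prod κ) := by
    refine Integrable.of_bound (by fun_prop) 1 (Filter.Eventually.of_forall fun z => ?_)
    exact Real.abs_cos_le_one _
  have hd : Integrable (fun z : ℝ × ℝ => 8 * distInt (s * (z.1 - z.2) / (2 * Real.pi)) ^ 2)
      (κ.prod κ) := by
    refine Integrable.of_bound (Measurable.aestronglyMeasurable (by fun_prop)) 8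
      (Filter.Eventually.of_forall fun z => ?_)
    have h0 := distInt_nonneg (s * (z.1 - z.2) / (2 * Real.pi))
    have h1 := distInt_le_half (s * (z.1 - z.2) / (2 * Real.pi))
    rw [Real.norm_eq_abs, abs_of_nonneg (by positivity)]
    nlinarith
  have h1 : 8 * ∫ z, distInt (s * (z.1 - z.2) / (2 * Real.pi)) ^ 2 ∂(κ.prod κ) ≤
      1 - ‖charFun κ s‖ ^ 2 := by
    rw [norm_charFun_sq, ← integral_const_mul]
    have : (1 : ℝ) - ∫ z, Real.cos (s * (z.1 - z.2)) ∂(κ.prod κ) =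
        ∫ z, (1 - Real.cos (s * (z.1 - z.2))) ∂(κ.prod κ) := by
      rw [integral_sub (integrable_const _) hc]; simp
    rw [this]
    refine integral_mono hd ((integrable_const _).sub hc) fun z => ?_
    refine (eight_mul_distInt_sq_le _).trans_eq ?_
    congr 2; field_simp
  set q := ∫ z, distInt (s * (z.1 - z.2) / (2 * Real.pi)) ^ 2 ∂(κ.prod κ)
  refine (sq_le_sq₀ (norm_nonneg _) (Real.exp_pos _).le).1 ?_
  rw [← Real.exp_nat_mul]
  have := Real.add_one_le_exp ((2 : ℕ) * (-4 * q))
  push_cast at this ⊢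
  linarith

/-- Jensen's inequality for the exponential function, on a finite measure. -/
lemma exp_neg_integral_le {Z : Type*} [MeasurableSpace Z] (m : Measure Z) [IsFiniteMeasure m]
    {f : Z → ℝ} (hf : Measurable f) (hf0 : ∀ z, 0 ≤ f z) {C : ℝ} (hfC : ∀ z, f z ≤ C) {m₀ : ℝ}
    (h0 : 0 < m₀) (hm : m₀ ≤ m.real Set.univ) :
    Real.exp (-∫ z, f z ∂m) ≤ (m.real Set.univ)⁻¹ * ∫ z, Real.exp (-(m₀ * f z)) ∂m := by
  have hM : 0 < m.real Set.univ := h0.trans_le hm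
  have : NeZero m := ⟨by rintro rfl; simp at hM⟩
  have hfi : Integrable f m := by
    refine Integrable.of_bound hf.aestronglyMeasurable C (Filter.Eventually.of_forall fun z => ?_)
    rw [Real.norm_eq_abs, abs_of_nonneg (hf0 z)]; exact hfC z
  have hei : ∀ c : ℝ, 0 ≤ c → Integrable (fun z => Real.exp (-(c * f z))) m := by
    intro c hc
    refine Integrable.of_bound (Measurable.aestronglyMeasurable (by fun_prop)) 1
      (Filter.Eventually.of_forall fun z => ?_)
    rw [Real.norm_eq_abs, abs_of_pos (Real.exp_pos _), Real.exp_le_one_iff]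
    have := mul_nonneg hc (hf0 z)
    linarith
  have hJ := convexOn_exp.map_average_le (μ := m) (f := fun z => -(m.real Set.univ * f z))
    Real.continuous_exp.continuousOn isClosed_univ (by simp) ((hfi.const_mul _).neg)
    (hei _ hM.le)
  rw [average_eq, average_eq, integral_neg, integral_const_mul, smul_eq_mul, smul_eq_mul] at hJ
  rw [show (m.real Set.univ)⁻¹ * -(m.real Set.univ * ∫ z, f z ∂m) = -∫ z, f z ∂m by
    field_simp] at hJ
  refine hJ.trans ?_
  refine mul_le_mul_of_nonneg_left ?_ (by positivity)
  refine integral_mono (hei _ hM.le) (hei _ h0.le) fun z => ?_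
  simp only [Real.exp_le_exp, neg_le_neg_iff]
  exact mul_le_mul_of_nonneg_right hm (hf0 z)

/-- The product becomes one exponential of an integral over differences `z`. Restricting to `E`
loses only decay, and Jensen on `E` brings the integral outside, so the LCD can be applied for each
fixed difference. The factor `3a` is `4` times the lower bound `3a/4` for the mass of `E`. -/
lemma prod_norm_charFun_le {ι : Type*} [Fintype ι] (κ : Measure ℝ) [IsProbabilityMeasure κ]
    {E : Set (ℝ × ℝ)} {a : ℝ} (ha : 0 < a)
    (hmass : 3 / 4 * a ≤ (κ.prod κ).real E) (c : ι → ℝ) :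
    ∏ k, ‖charFun κ (c k)‖ ≤ ((κ.prod κ).real E)⁻¹ *
      ∫ z in E, Real.exp (-(3 * a * ∑ k, distInt (c k * (z.1 - z.2) / (2 * Real.pi)) ^ 2))
        ∂(κ.prod κ) := by
  have hb : ∀ s : ℝ, Integrable (fun z : ℝ × ℝ => distInt (s * (z.1 - z.2) / (2 * Real.pi)) ^ 2)
      (κ.prod κ) := by
    intro s
    refine Integrable.of_bound (Measurable.aestronglyMeasurable (by fun_prop)) 1
      (Filter.Eventually.of_forall fun z => ?_)
    have h0 := distInt_nonneg (s * (z.1 - z.2) / (2 * Real.pi))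
    have h1 := distInt_le_half (s * (z.1 - z.2) / (2 * Real.pi))
    rw [Real.norm_eq_abs, abs_of_nonneg (by positivity)]
    nlinarith
  set F : ℝ × ℝ → ℝ := fun z => 4 * ∑ k, distInt (c k * (z.1 - z.2) / (2 * Real.pi)) ^ 2 with hF
  have hFm : Measurable F := by fun_prop
  have hF0 : ∀ z, 0 ≤ F z := fun z =>
    mul_nonneg (by norm_num) (Finset.sum_nonneg fun k _ => sq_nonneg _)
  have hFi : Integrable F (κ.prod κ) := (integrable_finsetSum _ fun k _ => hb (c k)).const_mul 4
  have hFC : ∀ z, F z ≤ 4 * Fintype.card ι := by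
    intro z
    refine mul_le_mul_of_nonneg_left ?_ (by norm_num)
    refine (Finset.sum_le_card_nsmul _ _ 1 fun k _ => ?_).trans_eq (by simp)
    have h0 := distInt_nonneg (c k * (z.1 - z.2) / (2 * Real.pi))
    have h1 := distInt_le_half (c k * (z.1 - z.2) / (2 * Real.pi))
    nlinarith
  calc ∏ k, ‖charFun κ (c k)‖
      ≤ ∏ k, Real.exp (-4 * ∫ z, distInt (c k * (z.1 - z.2) / (2 * Real.pi)) ^ 2 ∂(κ.prod κ)) :=
        Finset.prod_le_prod (fun _ _ => norm_nonneg _) fun k _ => norm_charFun_le κ (c k)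
    _ = Real.exp (-∫ z, F z ∂(κ.prod κ)) := by
        rw [← Real.exp_sum, ← Finset.mul_sum, hF, integral_const_mul,
          integral_finsetSum _ fun k _ => hb (c k)]
        congr 1; ring
    _ ≤ Real.exp (-∫ z in E, F z ∂(κ.prod κ)) := by
        rw [Real.exp_le_exp, neg_le_neg_iff]
        exact setIntegral_le_integral hFi (Filter.Eventually.of_forall hF0)
    _ ≤ _ := by
        have h := exp_neg_integral_le ((κ.prod κ).restrict E) hFm hF0 hFC
          (m₀ := 3 / 4 * a) (by positivity) (by simpa using hmass)
        simp only [measureReal_restrict_apply_univ] at h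
        refine h.trans_eq ?_
        have hS : ∀ S : ℝ, -(3 / 4 * a * (4 * S)) = -(3 * a * S) := fun S => by ring
        simp only [hF, hS]

/-- `exp(-y²/2)` is the mean of `exp(i g y)` over a standard Gaussian `g`. Exchanging the means and
taking absolute values removes the shift `u` and factors the inner mean. -/
lemma integral_exp_neg_sq_le {ι : Type*} [Fintype ι] (κ : Measure ℝ) [IsProbabilityMeasure κ]
    (c : ι → ℝ) (u : ℝ) :
    ∫ w, Real.exp (-(∑ k, c k * w k + u) ^ 2 / 2) ∂(Measure.pi fun _ : ι => κ) ≤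
      ∫ g, ∏ k, ‖charFun κ (g * c k)‖ ∂(gaussianReal 0 1) := by
  set π := Measure.pi fun _ : ι => κ
  set γ := gaussianReal 0 1
  have h1 : ∀ x : ℝ, ((Real.exp (-x ^ 2 / 2) : ℝ) : ℂ) =
      ∫ g, Complex.exp ((x * g : ℝ) * Complex.I) ∂γ := by
    intro x
    have := charFun_gaussianReal (μ := 0) (v := 1) x
    rw [charFun_apply_real] at this
    push_cast
    rw [this]
    congr 1
    simp
    ring
  have h2 : ((∫ w, Real.exp (-(∑ k, c k * w k + u) ^ 2 / 2) ∂π : ℝ) : ℂ) =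
      ∫ g, ∫ w, Complex.exp (((∑ k, c k * w k + u) * g : ℝ) * Complex.I) ∂π ∂γ := by
    rw [← integral_complex_ofReal, integral_integral_swap]
    · congr 1; ext w; exact h1 _
    · refine Integrable.of_bound (Measurable.aestronglyMeasurable (by fun_prop)) 1
        (Filter.Eventually.of_forall fun z => ?_)
      exact (Complex.norm_exp_ofReal_mul_I _).le
  have h3 : ∀ g : ℝ, ‖∫ w, Complex.exp (((∑ k, c k * w k + u) * g : ℝ) * Complex.I) ∂π‖ =
      ∏ k, ‖charFun κ (g * c k)‖ := by
    intro g
    have : ∀ w : ι → ℝ, Complex.exp (((∑ k, c k * w k + u) * g : ℝ) * Complex.I) =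
        Complex.exp ((u * g : ℝ) * Complex.I) *
          ∏ k, Complex.exp ((g * c k : ℝ) * (w k : ℝ) * Complex.I) := by
      intro w
      rw [← Complex.exp_sum, ← Complex.exp_add, ← Finset.sum_mul]
      congr 1
      push_cast
      rw [add_mul, add_mul, add_comm, Finset.sum_mul]
      congr 3; ext k; ring
    simp_rw [this]
    rw [integral_const_mul, norm_mul, Complex.norm_exp_ofReal_mul_I, one_mul,
      integral_fintype_prod_eq_prod (fun k (x : ℝ) => Complex.exp ((g * c k : ℝ) * x * Complex.I)),
      norm_prod]
    simp_rw [charFun_apply_real]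
  have h4 : ‖((∫ w, Real.exp (-(∑ k, c k * w k + u) ^ 2 / 2) ∂π : ℝ) : ℂ)‖ =
      ∫ w, Real.exp (-(∑ k, c k * w k + u) ^ 2 / 2) ∂π := by
    rw [Complex.norm_real, Real.norm_eq_abs, abs_of_nonneg]
    exact integral_nonneg fun w => (Real.exp_pos _).le
  rw [← h4, h2]
  refine (norm_integral_le_integral_norm _).trans_eq ?_
  simp_rw [h3]

end SparseSpectrum

namespace SparseSpectrum

/-! ### Small ball estimate for a single row -/

/-- Turns the logarithmic lower bound in the definition of the LCD into a Cauchy weight, whose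
integral is finite and scales explicitly. -/
lemma exp_neg_two_posLog_le {w : ℝ} (hw : 0 ≤ w) :
    Real.exp (-(2 * Real.posLog w)) ≤ 2 * (1 + w ^ 2)⁻¹ := by
  rw [← div_eq_mul_inv, le_div_iff₀ (by positivity)]
  rcases le_total w 1 with h | h
  · have h1 : Real.exp (-(2 * Real.posLog w)) ≤ 1 := by
      rw [Real.exp_le_one_iff]; have := Real.posLog_nonneg (x := w); linarith
    have h2 : 1 + w ^ 2 ≤ 2 := by nlinarith
    calc _ ≤ 1 * 2 := mul_le_mul h1 h2 (by positivity) zero_le_one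
      _ = 2 := one_mul _
  · have h0 : 0 < w := by linarith
    rw [Real.posLog_eq_log (by rwa [abs_of_pos h0]), Real.exp_neg, two_mul, Real.exp_add,
      Real.exp_log h0, inv_mul_le_iff₀ (by positivity)]
    nlinarith

/-- The values `θ < D` are not close to being a common denominator of `x`. -/
def LCDAtLeast {ι : Type*} [Fintype ι] (a D : ℝ) (x : ι → ℝ) : Prop :=
  ∀ θ, 0 < θ → θ < D → Real.posLog (Real.sqrt a * θ) ≤ a * ∑ k, distInt (θ * x k) ^ 2

/-- For a fixed difference `z`, the Gaussian frequency `g` tests the denominator `θ = g z L / (2π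
t)`. If `|θ| < D` the LCD bounds the integrand by a Cauchy weight of width `1/A`, which gives the
main term. If `|θ| ≥ D` then `|g| ≥ T`, and the Gaussian density pays. -/
lemma gaussian_integral_distInt_le {ι : Type*} [Fintype ι] {a D r R b L t z : ℝ} {v v' : ι → ℝ}
    (ha : 0 < a) (hD : 0 < D) (hr : 0 < r) (hb : 0 < b) (hbL : b ≤ L) (hL : L ≤ 1) (ht : 0 < t)
    (hz : r < |z|) (hzR : |z| ≤ R) (hlcd : LCDAtLeast a D fun k => v k / L)
    (hY : 24 * a * R ^ 2 * ∑ k, (v' k - v k) ^ 2 ≤ (2 * Real.pi * t) ^ 2) :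
    ∫ g, Real.exp (-(3 * a * ∑ k, distInt (g * (v' k / t) * z / (2 * Real.pi)) ^ 2))
      ∂(gaussianReal 0 1) ≤
    40 * t / (Real.sqrt a * r * b) + 6 * Real.exp (-(2 * Real.pi * t * D / R) ^ 2 / 8) := by
  have hpi := Real.pi_pos
  have hL0 : 0 < L := hb.trans_le hbL
  have hz0 : 0 < |z| := hr.trans hz
  have hR0 : 0 < R := hz0.trans_le hzR
  have hsa : 0 < Real.sqrt a := Real.sqrt_pos.2 ha
  set T := 2 * Real.pi * t * D / R with hT
  set A := Real.sqrt a * r * b / (2 * Real.pi * t) with hA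
  have hA0 : 0 < A := by positivity
  have key : ∀ g : ℝ, Real.exp (-g ^ 2 / 2) *
      Real.exp (-(3 * a * ∑ k, distInt (g * (v' k / t) * z / (2 * Real.pi)) ^ 2)) ≤
      2 * (1 + (A * g) ^ 2)⁻¹ + Real.exp (-T ^ 2 / 8) * Real.exp (-(1 / 8) * g ^ 2) := by
    intro g
    set θ := g * z * L / (2 * Real.pi * t) with hθ
    have h1 : ∑ k, (2 / 3 * distInt (θ * (v k / L)) ^ 2 -
        2 * ((g * z / (2 * Real.pi * t)) ^ 2 * (v' k - v k) ^ 2)) ≤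
        ∑ k, distInt (g * (v' k / t) * z / (2 * Real.pi)) ^ 2 := by
      refine Finset.sum_le_sum fun k _ => ?_
      refine (distInt_sq_ge _ (θ * (v k / L))).trans' ?_
      rw [← mul_pow]
      refine le_of_eq ?_
      congr 3
      rw [hθ]; field_simp
    rw [Finset.sum_sub_distrib, ← Finset.mul_sum, ← Finset.mul_sum, ← Finset.mul_sum] at h1
    -- Replacing `v'` by `v` costs at most `g²/4` in the exponent, half of what the Gaussian density
    -- provides; `hY` is calibrated for this.
    have h2 : 6 * a * ((g * z / (2 * Real.pi * t)) ^ 2 * ∑ k, (v' k - v k) ^ 2) ≤ g ^ 2 / 4 := by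
      have hzz : z ^ 2 ≤ R ^ 2 := by rw [← sq_abs]; gcongr
      have hs : 0 ≤ ∑ k, (v' k - v k) ^ 2 := Finset.sum_nonneg fun k _ => sq_nonneg _
      rw [div_pow, mul_pow, div_mul_eq_mul_div, mul_div_assoc', div_le_iff₀ (by positivity)]
      calc 6 * a * (g ^ 2 * z ^ 2 * ∑ k, (v' k - v k) ^ 2)
          ≤ 6 * a * (g ^ 2 * R ^ 2 * ∑ k, (v' k - v k) ^ 2) := by gcongr
        _ = g ^ 2 / 4 * (24 * a * R ^ 2 * ∑ k, (v' k - v k) ^ 2) := by ring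
        _ ≤ _ := by gcongr
    have h3 : Real.exp (-g ^ 2 / 2) *
        Real.exp (-(3 * a * ∑ k, distInt (g * (v' k / t) * z / (2 * Real.pi)) ^ 2)) ≤
        Real.exp (-g ^ 2 / 4) * Real.exp (-(2 * (a * ∑ k, distInt (θ * (v k / L)) ^ 2))) := by
      rw [← Real.exp_add, ← Real.exp_add, Real.exp_le_exp]
      have := mul_le_mul_of_nonneg_left h1 (by positivity : 0 ≤ 3 * a)
      nlinarith
    refine h3.trans ?_
    have hge : Real.exp (-g ^ 2 / 4) ≤ 1 := by
      rw [Real.exp_le_one_iff]; nlinarith [sq_nonneg g]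
    have hde : Real.exp (-(2 * (a * ∑ k, distInt (θ * (v k / L)) ^ 2))) ≤ 1 := by
      rw [Real.exp_le_one_iff]
      have : 0 ≤ a * ∑ k, distInt (θ * (v k / L)) ^ 2 :=
        mul_nonneg ha.le (Finset.sum_nonneg fun k _ => sq_nonneg _)
      linarith
    have habs : |θ| = |g| * |z| * L / (2 * Real.pi * t) := by
      rw [hθ, abs_div, abs_mul, abs_mul, abs_of_pos hL0,
        abs_of_pos (by positivity : 0 < 2 * Real.pi * t)]
    by_cases hθD : |θ| < D
    · have h4 : Real.posLog (Real.sqrt a * |θ|) ≤ a * ∑ k, distInt (θ * (v k / L)) ^ 2 := by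
        rcases lt_trichotomy θ 0 with h | h | h
        · have := hlcd (-θ) (by linarith) (by rwa [abs_of_neg h] at hθD)
          rw [abs_of_neg h]
          refine this.trans_eq ?_
          congr 2; ext k
          rw [neg_mul, distInt_neg]
        · rw [h]; simp [Real.posLog_zero, distInt]
        · rw [abs_of_pos h] at hθD ⊢
          exact hlcd θ h hθD
      have h5 : Real.exp (-(2 * (a * ∑ k, distInt (θ * (v k / L)) ^ 2))) ≤
          2 * (1 + (A * g) ^ 2)⁻¹ := by
        calc _ ≤ Real.exp (-(2 * Real.posLog (Real.sqrt a * |θ|))) := by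
              rw [Real.exp_le_exp]; linarith
          _ ≤ 2 * (1 + (Real.sqrt a * |θ|) ^ 2)⁻¹ := exp_neg_two_posLog_le (by positivity)
          _ ≤ _ := by
              have h6 : A * |g| ≤ Real.sqrt a * |θ| := by
                rw [habs, hA, div_mul_eq_mul_div, mul_div_assoc']
                refine div_le_div_of_nonneg_right ?_ (by positivity)
                calc Real.sqrt a * r * b * |g| = Real.sqrt a * (|g| * r * b) := by ring
                  _ ≤ _ := by gcongr
              have h7 : (A * g) ^ 2 ≤ (Real.sqrt a * |θ|) ^ 2 := by
                rw [← sq_abs (A * g), abs_mul, abs_of_pos hA0]; gcongr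
              gcongr
      have h6 : 0 ≤ Real.exp (-T ^ 2 / 8) * Real.exp (-(1 / 8) * g ^ 2) := by positivity
      calc _ ≤ 1 * (2 * (1 + (A * g) ^ 2)⁻¹) :=
            mul_le_mul hge h5 (Real.exp_pos _).le zero_le_one
        _ ≤ _ := by linarith
    · have h4 : T ≤ |g| := by
        have h5 := not_lt.1 hθD
        rw [habs, le_div_iff₀ (by positivity)] at h5
        rw [hT, div_le_iff₀ hR0]
        calc 2 * Real.pi * t * D = D * (2 * Real.pi * t) := by ring
          _ ≤ |g| * |z| * L := h5
          _ ≤ |g| * R * 1 := by gcongr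
          _ = _ := mul_one _
      have hT0 : 0 ≤ T := by positivity
      have h5 : T ^ 2 ≤ g ^ 2 := by rw [← sq_abs g]; gcongr
      have h6 : 0 ≤ 2 * (1 + (A * g) ^ 2)⁻¹ := by positivity
      -- Half of the remaining `g²/4` yields the factor `exp(-T²/8)`; the other half keeps the bound
      -- integrable.
      have h7 : Real.exp (-g ^ 2 / 4) ≤ Real.exp (-T ^ 2 / 8) * Real.exp (-(1 / 8) * g ^ 2) := by
        rw [← Real.exp_add, Real.exp_le_exp]; linarith
      calc _ ≤ Real.exp (-g ^ 2 / 4) * 1 := by gcongr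
        _ ≤ _ := by linarith
  have hi1 : Integrable fun g : ℝ => 2 * (1 + (A * g) ^ 2)⁻¹ :=
    ((integrable_inv_one_add_sq.comp_mul_left' hA0.ne')).const_mul 2
  have hi2 : Integrable fun g : ℝ => Real.exp (-T ^ 2 / 8) * Real.exp (-(1 / 8) * g ^ 2) :=
    (integrable_exp_neg_mul_sq (by norm_num)).const_mul _
  have hs2 : 2 ≤ Real.sqrt (2 * Real.pi) := by
    apply Real.le_sqrt_of_sq_le
    nlinarith [Real.pi_gt_three]
  calc ∫ g, Real.exp (-(3 * a * ∑ k, distInt (g * (v' k / t) * z / (2 * Real.pi)) ^ 2))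
        ∂(gaussianReal 0 1)
      ≤ ∫ g : ℝ, (2 * (1 + (A * g) ^ 2)⁻¹ +
          Real.exp (-T ^ 2 / 8) * Real.exp (-(1 / 8) * g ^ 2)) / 2 := by
        rw [integral_gaussianReal_eq_integral_smul (by norm_num)]
        refine integral_mono_of_nonneg (Filter.Eventually.of_forall fun g => ?_)
          ((hi1.add hi2).div_const 2) (Filter.Eventually.of_forall fun g => ?_)
        · simp only [smul_eq_mul, Pi.zero_apply]
          exact mul_nonneg (gaussianPDFReal_nonneg _ _ _) (Real.exp_pos _).le
        · simp only [smul_eq_mul, gaussianPDFReal, sub_zero, NNReal.coe_one, mul_one]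
          set W := 2 * (1 + (A * g) ^ 2)⁻¹ + Real.exp (-T ^ 2 / 8) * Real.exp (-(1 / 8) * g ^ 2)
          rw [mul_assoc, div_eq_inv_mul W 2]
          exact mul_le_mul (inv_anti₀ (by norm_num) hs2) (key g) (by positivity) (by norm_num)
    _ = (2 * (A⁻¹ * Real.pi) + Real.exp (-T ^ 2 / 8) * Real.sqrt (Real.pi / (1 / 8))) / 2 := by
        rw [integral_div, integral_add hi1 hi2, integral_const_mul, integral_const_mul,
          integral_gaussian, Measure.integral_comp_mul_left (fun x => (1 + x ^ 2)⁻¹) A,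
          integral_univ_inv_one_add_sq, abs_of_pos (inv_pos.2 hA0), smul_eq_mul]
    _ ≤ _ := by
        have h8 : Real.sqrt (Real.pi / (1 / 8)) ≤ 6 := by
          rw [Real.sqrt_le_left (by norm_num)]
          nlinarith [Real.pi_lt_d2]
        have h9 : A⁻¹ * Real.pi ≤ 40 * t / (Real.sqrt a * r * b) := by
          rw [hA, inv_div, div_mul_eq_mul_div]
          refine div_le_div_of_nonneg_right ?_ (by positivity)
          have : Real.pi * Real.pi ≤ 20 := by nlinarith [Real.pi_lt_d2, Real.pi_gt_three]
          nlinarith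
        have h10 := mul_le_mul_of_nonneg_left h8 (Real.exp_pos (-T ^ 2 / 8)).le
        nlinarith [Real.exp_pos (-T ^ 2 / 8)]

/-- The bound for a fixed difference is uniform over `E`, so it survives the normalized average over
`E` produced by Jensen. -/
lemma row_bound {ι : Type*} [Fintype ι] (κ : Measure ℝ) [IsProbabilityMeasure κ]
    {a D r R b L t : ℝ} {v v' : ι → ℝ}
    (ha : 0 < a) (hD : 0 < D) (hr : 0 < r) (hb : 0 < b) (hbL : b ≤ L) (hL : L ≤ 1) (ht : 0 < t)
    (hmass : 3 / 4 * a ≤ (κ.prod κ).real {z | r < |z.1 - z.2| ∧ |z.1 - z.2| ≤ R})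
    (hlcd : LCDAtLeast a D fun k => v k / L)
    (hY : 24 * a * R ^ 2 * ∑ k, (v' k - v k) ^ 2 ≤ (2 * Real.pi * t) ^ 2) (u : ℝ) :
    ∫ w, Real.exp (-(∑ k, v' k / t * w k + u) ^ 2 / 2) ∂(Measure.pi fun _ : ι => κ) ≤
      40 * t / (Real.sqrt a * r * b) + 6 * Real.exp (-(2 * Real.pi * t * D / R) ^ 2 / 8) := by
  set E : Set (ℝ × ℝ) := {z | r < |z.1 - z.2| ∧ |z.1 - z.2| ≤ R} with hE
  have hEm : MeasurableSet E := by
    have h1 : MeasurableSet {z : ℝ × ℝ | r < |z.1 - z.2|} :=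
      measurableSet_lt (by fun_prop) (by fun_prop)
    have h2 : MeasurableSet {z : ℝ × ℝ | |z.1 - z.2| ≤ R} :=
      measurableSet_le (by fun_prop) (by fun_prop)
    exact h1.inter h2
  set Q := 40 * t / (Real.sqrt a * r * b) + 6 * Real.exp (-(2 * Real.pi * t * D / R) ^ 2 / 8)
  have hM : 0 < (κ.prod κ).real E := lt_of_lt_of_le (by positivity) hmass
  have hexp : ∀ s : ℝ, 0 ≤ s → Real.exp (-(3 * a * s)) ≤ 1 := by
    intro s hs
    rw [Real.exp_le_one_iff]
    have : 0 ≤ 3 * a * s := by positivity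
    linarith
  have hint : Integrable (fun x : ℝ × (ℝ × ℝ) => Real.exp (-(3 * a * ∑ k, distInt
      (x.1 * (v' k / t) * (x.2.1 - x.2.2) / (2 * Real.pi)) ^ 2)))
      ((gaussianReal 0 1).prod ((κ.prod κ).restrict E)) := by
    refine Integrable.of_bound (Measurable.aestronglyMeasurable (by fun_prop)) 1
      (Filter.Eventually.of_forall fun z => ?_)
    rw [Real.norm_eq_abs, abs_of_pos (Real.exp_pos _)]
    exact hexp _ (Finset.sum_nonneg fun k _ => sq_nonneg _)
  calc _ ≤ ∫ g, ∏ k, ‖charFun κ (g * (v' k / t))‖ ∂(gaussianReal 0 1) :=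
        integral_exp_neg_sq_le κ (fun k => v' k / t) u
    _ ≤ ∫ g, ((κ.prod κ).real E)⁻¹ * ∫ z in E, Real.exp (-(3 * a * ∑ k, distInt
        (g * (v' k / t) * (z.1 - z.2) / (2 * Real.pi)) ^ 2)) ∂(κ.prod κ) ∂(gaussianReal 0 1) := by
        refine integral_mono_of_nonneg (Filter.Eventually.of_forall fun g =>
          Finset.prod_nonneg fun k _ => norm_nonneg _) (hint.integral_prod_left.const_mul _)
          (Filter.Eventually.of_forall fun g => ?_)
        exact prod_norm_charFun_le κ ha hmass fun k => g * (v' k / t)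
    _ = ((κ.prod κ).real E)⁻¹ * ∫ z in E, ∫ g, Real.exp (-(3 * a * ∑ k, distInt
        (g * (v' k / t) * (z.1 - z.2) / (2 * Real.pi)) ^ 2)) ∂(gaussianReal 0 1) ∂(κ.prod κ) := by
        rw [integral_const_mul, integral_integral_swap hint]
    _ ≤ ((κ.prod κ).real E)⁻¹ * ∫ z in E, Q ∂(κ.prod κ) := by
        refine mul_le_mul_of_nonneg_left ?_ (by positivity)
        refine setIntegral_mono_on hint.integral_prod_right (integrable_const _) hEm fun z hz => ?_
        exact gaussian_integral_distInt_le ha hD hr hb hbL hL ht hz.1 hz.2 hlcd hY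
    _ = Q := by
        rw [setIntegral_const, smul_eq_mul]
        field_simp

end SparseSpectrum

namespace SparseSpectrum

/-! ### Tensorization -/

lemma sparseLaw_tail_le {ν : Measure ℝ} {B : ℝ} (h : IsStandardSubgaussian ν B)
    (p : unitInterval) {t : ℝ} (ht : 0 < t) :
    (sparseLaw ν p).real {x | t < |x|} ≤ p * (2 * Real.exp (-t ^ 2 / B ^ 2)) := by
  have := h.isProbabilityMeasure
  have h0 : (Measure.dirac (0 : ℝ)).real {x | t < |x|} = 0 := by
    have hm : MeasurableSet {x : ℝ | t < |x|} := measurableSet_lt (by fun_prop) (by fun_prop)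
    rw [measureReal_def, Measure.dirac_apply' _ hm]
    simp [ht.le]
  rw [sparseLaw_real, h0, mul_zero, add_zero]
  exact mul_le_mul_of_nonneg_left (h.tail_le t ht) p.2.1

lemma IsLCDConstant.measure_le {B δ₀ r : ℝ} (h : IsLCDConstant B δ₀ r) {ν : Measure ℝ}
    (hν : IsStandardSubgaussian ν B) (p : unitInterval) (u : ℝ) :
    (sparseLaw ν p).real {x | |x - u| ≤ r} ≤ 1 - δ₀ * p := by
  have := hν.isProbabilityMeasure
  refine (le_ciSup (f := fun u => (sparseLaw ν p).real {x | |x - u| ≤ r}) ?_ u).trans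
    (h.levy_le ν hν p r le_rfl)
  exact ⟨1, by rintro _ ⟨u, rfl⟩; exact measureReal_le_one⟩

/-- Conditioning on one copy, the difference is at most `r` with probability at most `1 - δ₀ p`.
Large entries are rare in proportion to `p`, because the Bernoulli factor must be one, so a radius
`R` independent of `p` loses only a quarter of `δ₀ p`. -/
lemma IsLCDConstant.exists_mass_le {B δ₀ r : ℝ} (h : IsLCDConstant B δ₀ r) (hB : 0 < B) :
    ∃ R : ℝ, 0 < R ∧ ∀ ν : Measure ℝ, IsStandardSubgaussian ν B → ∀ p : unitInterval,
      3 / 4 * (δ₀ * p) ≤ ((sparseLaw ν p).prod (sparseLaw ν p)).real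
        {z | r < |z.1 - z.2| ∧ |z.1 - z.2| ≤ R} := by
  have hδ := h.mem_Ioo.1
  have hl : 0 < Real.log (16 / δ₀) := by
    apply Real.log_pos
    rw [lt_div_iff₀ hδ]; linarith [h.mem_Ioo.2]
  -- At half this radius the tail factor `2 exp(-s²/B²)` equals `δ₀/8`; two copies together lose `δ₀
  -- p / 4`.
  refine ⟨2 * (B * Real.sqrt (Real.log (16 / δ₀))), by positivity, fun ν hν p => ?_⟩
  have := hν.isProbabilityMeasure
  set κ := sparseLaw ν p
  set s := B * Real.sqrt (Real.log (16 / δ₀)) with hs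
  have hs0 : 0 < s := by positivity
  set E : Set (ℝ × ℝ) := {z | r < |z.1 - z.2| ∧ |z.1 - z.2| ≤ 2 * s} with hE
  have h1m : MeasurableSet {z : ℝ × ℝ | |z.1 - z.2| ≤ r} :=
    measurableSet_le (by fun_prop) (by fun_prop)
  have h1 : (κ.prod κ).real {z | |z.1 - z.2| ≤ r} ≤ 1 - δ₀ * p := by
    have h01 : 0 ≤ 1 - δ₀ * p := measureReal_nonneg.trans (h.measure_le hν p 0)
    refine ENNReal.toReal_le_of_le_ofReal h01 ?_
    rw [Measure.prod_apply_symm h1m]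
    calc _ ≤ ∫⁻ _, ENNReal.ofReal (1 - δ₀ * p) ∂κ := by
          refine lintegral_mono fun y => ?_
          have := h.measure_le hν p y
          rw [← ofReal_measureReal]
          exact ENNReal.ofReal_le_ofReal this
      _ = _ := by simp
  have htail : κ.real {x | s < |x|} ≤ p * (δ₀ / 8) := by
    refine (sparseLaw_tail_le hν p hs0).trans_eq ?_
    rw [hs, mul_pow, Real.sq_sqrt hl.le, neg_div, mul_div_cancel_left₀ _ (by positivity),
      Real.exp_neg, Real.exp_log (by positivity)]
    congr 1; field_simp; norm_num
  have hsm : MeasurableSet {x : ℝ | s < |x|} := measurableSet_lt (by fun_prop) (by fun_prop)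
  have h2 : (κ.prod κ).real (Prod.fst ⁻¹' {x | s < |x|}) = κ.real {x | s < |x|} := by
    have := (measurePreserving_fst (μ := κ) (ν := κ)).measureReal_preimage hsm.nullMeasurableSet
    exact this
  have h3 : (κ.prod κ).real (Prod.snd ⁻¹' {x | s < |x|}) = κ.real {x | s < |x|} := by
    have := (measurePreserving_snd (μ := κ) (ν := κ)).measureReal_preimage hsm.nullMeasurableSet
    exact this
  have hcov : (Set.univ : Set (ℝ × ℝ)) ⊆ E ∪ ({z : ℝ × ℝ | |z.1 - z.2| ≤ r} ∪
      ((Prod.fst ⁻¹' {x : ℝ | s < |x|}) ∪ (Prod.snd ⁻¹' {x : ℝ | s < |x|}))) := by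
    intro z _
    by_contra hc
    simp only [Set.mem_union, hE, Set.mem_ofPred_eq, Set.mem_preimage, not_or, not_and, not_le,
      not_lt] at hc
    obtain ⟨h1, h2, h3, h4⟩ := hc
    have := h1 h2
    have := abs_sub z.1 z.2
    linarith
  have h4 := measureReal_mono (μ := κ.prod κ) hcov
  have h5 := measureReal_union_le (μ := κ.prod κ) E ({z : ℝ × ℝ | |z.1 - z.2| ≤ r} ∪
      ((Prod.fst ⁻¹' {x : ℝ | s < |x|}) ∪ (Prod.snd ⁻¹' {x : ℝ | s < |x|})))
  have h6 := measureReal_union_le (μ := κ.prod κ) {z : ℝ × ℝ | |z.1 - z.2| ≤ r}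
      ((Prod.fst ⁻¹' {x : ℝ | s < |x|}) ∪ (Prod.snd ⁻¹' {x : ℝ | s < |x|}))
  have h7 := measureReal_union_le (μ := κ.prod κ) (Prod.fst ⁻¹' {x : ℝ | s < |x|})
    (Prod.snd ⁻¹' {x : ℝ | s < |x|})
  rw [probReal_univ] at h4
  nlinarith

section Tensor

variable {ι ρ : Type*} [Fintype ι] [DecidableEq ι]

-- Only a conditional bound is needed. Integrating the coordinates `E i` leaves every other factor
-- unchanged, so that factor is replaced by `q` and the induction continues, even though `g i` may
-- depend on coordinates outside `E i`.
open Function in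
lemma lintegral_prod_le_pow (κ : Measure ℝ) [IsProbabilityMeasure κ] (S : Finset ρ)
    (E : ρ → Finset ι) (g : ρ → (ι → ℝ) → ENNReal) (hg : ∀ i, Measurable (g i)) (q : ENNReal)
    (hindep : ∀ i ∈ S, ∀ i' ∈ S, i ≠ i' → ∀ w y, g i' (updateFinset w (E i) y) = g i' w)
    (hq : ∀ i ∈ S, ∀ w, lmarginal (fun _ => κ) (E i) (g i) w ≤ q) :
    ∫⁻ w, ∏ i ∈ S, g i w ∂(Measure.pi fun _ : ι => κ) ≤ q ^ S.card := by
  classical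
  induction S using Finset.induction_on with
  | empty => simp
  | insert i S hi ih =>
    have hP : Measurable fun w => ∏ j ∈ S, g j w := Finset.measurable_prod _ fun j _ => hg j
    have hPi : ∀ w y, ∏ j ∈ S, g j (updateFinset w (E i) y) = ∏ j ∈ S, g j w := by
      intro w y
      refine Finset.prod_congr rfl fun j hj => ?_
      exact hindep i (Finset.mem_insert_self _ _) j (Finset.mem_insert_of_mem hj)
        (fun h => hi (h ▸ hj)) w y
    calc ∫⁻ w, ∏ j ∈ insert i S, g j w ∂(Measure.pi fun _ : ι => κ)
        ≤ ∫⁻ w, q * ∏ j ∈ S, g j w ∂(Measure.pi fun _ : ι => κ) := by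
          simp_rw [Finset.prod_insert hi]
          refine lintegral_le_of_lmarginal_le (E i) ((hg i).mul hP) (hP.const_mul q) fun w => ?_
          simp only [lmarginal, hPi]
          rw [lintegral_mul_const _ (by
            exact (hg i).comp measurable_updateFinset)]
          have := hq i (Finset.mem_insert_self _ _) w
          rw [lmarginal] at this
          simp only [lintegral_const, measure_univ, mul_one]
          gcongr
      _ = q * ∫⁻ w, ∏ j ∈ S, g j w ∂(Measure.pi fun _ : ι => κ) := lintegral_const_mul _ hP
      _ ≤ q * q ^ S.card := by
          gcongr
          exact ih (fun a ha b hb => hindep a (Finset.mem_insert_of_mem ha) b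
            (Finset.mem_insert_of_mem hb)) fun a ha => hq a (Finset.mem_insert_of_mem ha)
      _ = q ^ (insert i S).card := by rw [Finset.card_insert_of_notMem hi, pow_succ, mul_comm]

end Tensor

lemma measure_le_exp_mul_lintegral {X : Type*} [MeasurableSpace X] (π : Measure X)
    {f : X → ENNReal} (hf : Measurable f) {s : Set X} {c : ℝ}
    (hs : ∀ x ∈ s, ENNReal.ofReal (Real.exp (-c)) ≤ f x) :
    π s ≤ ENNReal.ofReal (Real.exp c) * ∫⁻ x, f x ∂π := by
  have h1 : ENNReal.ofReal (Real.exp (-c)) * π s ≤ ∫⁻ x, f x ∂π :=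
    (mul_le_mul_right (measure_mono hs) _).trans (mul_meas_ge_le_lintegral hf _)
  calc π s = ENNReal.ofReal (Real.exp c) * (ENNReal.ofReal (Real.exp (-c)) * π s) := by
        rw [← mul_assoc, ← ENNReal.ofReal_mul (Real.exp_pos _).le, ← Real.exp_add]
        simp
    _ ≤ _ := by gcongr

/-- The entry vanishes with probability at least `1 - p`, so the moment is `1 + O(p)`. This is what
gives the sum of squares its order `p n²` rather than `n²`. -/
lemma lintegral_sparseLaw_exp_le {ν : Measure ℝ} {B : ℝ} (h : IsStandardSubgaussian ν B)
    (hB : 0 < B) (p : unitInterval) :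
    ∫⁻ x, ENNReal.ofReal (Real.exp (x ^ 2 / (2 * B ^ 2))) ∂(sparseLaw ν p) ≤
      ENNReal.ofReal (Real.exp (2 * p)) := by
  have := h.isProbabilityMeasure
  have hp0 := p.2.1
  have hp1 := sub_nonneg.2 p.2.2
  rw [sparseLaw_eq, lintegral_add_measure, lintegral_smul_measure, lintegral_smul_measure,
    lintegral_dirac' _ (by fun_prop)]
  calc _ ≤ ENNReal.ofReal p * 3 + ENNReal.ofReal (1 - p) * 1 := by
        refine add_le_add ?_ ?_
        · exact mul_le_mul_right (h.lintegral_exp_le hB) _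
        · simp
    _ = ENNReal.ofReal (2 * p + 1) := by
        rw [show (3 : ENNReal) = ENNReal.ofReal 3 by norm_num, ← ENNReal.ofReal_mul hp0, mul_one,
          ← ENNReal.ofReal_add (by positivity) hp1]
        congr 1; ring
    _ ≤ _ := ENNReal.ofReal_le_ofReal (Real.add_one_le_exp _)

/-- With overwhelming probability the sum of squares of the entries is of order `p n²`. -/
lemma measure_sum_sq_ge_le {ι : Type*} [Fintype ι] {ν : Measure ℝ} {B : ℝ}
    (h : IsStandardSubgaussian ν B) (hB : 0 < B) (p : unitInterval) {m H : ℝ}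
    (hm : (Fintype.card ι : ℝ) ≤ m) :
    (Measure.pi fun _ : ι => sparseLaw ν p) {w | H ≤ ∑ e, w e ^ 2} ≤
      ENNReal.ofReal (Real.exp (2 * p * m - H / (2 * B ^ 2))) := by
  classical
  have := h.isProbabilityMeasure
  set g : ι → (ι → ℝ) → ENNReal := fun e w => ENNReal.ofReal (Real.exp (w e ^ 2 / (2 * B ^ 2)))
  have h1 := lintegral_prod_le_pow (sparseLaw ν p) Finset.univ (fun e : ι => {e}) g
    (fun e => by fun_prop) (ENNReal.ofReal (Real.exp (2 * p))) (by
      intro i _ i' _ hne w y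
      simp only [g]
      rw [Function.updateFinset_def]
      simp [hne.symm]) (by
      intro e _ w
      rw [lmarginal_singleton]
      simp only [g, Function.update_self]
      exact lintegral_sparseLaw_exp_le h hB p)
  have h2 := measure_le_exp_mul_lintegral (Measure.pi fun _ : ι => sparseLaw ν p)
    (f := fun w => ∏ e, g e w) (by fun_prop) (s := {w | H ≤ ∑ e, w e ^ 2})
    (c := -(H / (2 * B ^ 2))) (by
      intro w hw
      simp only [g]
      rw [← ENNReal.ofReal_prod_of_nonneg fun e _ => (Real.exp_pos _).le, ← Real.exp_sum,
        ← Finset.sum_div, neg_neg]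
      refine ENNReal.ofReal_le_ofReal (Real.exp_le_exp.2 ?_)
      exact div_le_div_of_nonneg_right hw (by positivity))
  refine h2.trans ((mul_le_mul_right h1 _).trans ?_)
  rw [← ENNReal.ofReal_pow (Real.exp_pos _).le, ← ENNReal.ofReal_mul (Real.exp_pos _).le,
    ← Real.exp_nat_mul, ← Real.exp_add, Finset.card_univ]
  refine ENNReal.ofReal_le_ofReal (Real.exp_le_exp.2 ?_)
  have := mul_le_mul_of_nonneg_left hm (mul_nonneg zero_le_two p.2.1)
  linarith

/-- Rounding the coordinates of a vector to integers one at a time, at a cost controlled by the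
Hilbert-Schmidt norm. -/
lemma exists_rounding {m n : Type*} [Fintype m] [DecidableEq n] (M : m → n → ℝ) (f : n → ℝ)
    (hf : ∀ k, f k ∈ Set.Icc (0 : ℝ) 1) (S : Finset n) :
    ∃ s : n → ℝ, (∀ k, s k = 0 ∨ s k = 1) ∧
      ∑ i, (∑ k ∈ S, M i k * (f k - s k)) ^ 2 ≤ ∑ k ∈ S, ∑ i, M i k ^ 2 := by
  induction S using Finset.induction_on with
  | empty => exact ⟨fun _ => 0, fun _ => Or.inl rfl, by simp⟩
  | insert a S ha ih =>
    obtain ⟨s, hs, hle⟩ := ih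
    set z : m → ℝ := fun i => ∑ k ∈ S, M i k * (f k - s k) with hz
    -- The endpoint is chosen to make the cross term with the accumulated error non-positive, so
    -- squared errors add up without interaction.
    have key : ∃ x : ℝ, (x = 0 ∨ x = 1) ∧ (f a - x) * ∑ i, z i * M i a ≤ 0 := by
      rcases le_total 0 (∑ i, z i * M i a) with h | h
      · exact ⟨1, Or.inr rfl, mul_nonpos_of_nonpos_of_nonneg (by linarith [(hf a).2]) h⟩
      · exact ⟨0, Or.inl rfl, mul_nonpos_of_nonneg_of_nonpos (by linarith [(hf a).1]) h⟩
    obtain ⟨x, hx, hxle⟩ := key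
    refine ⟨Function.update s a x, fun k => ?_, ?_⟩
    · by_cases hk : k = a
      · subst hk; simpa using hx
      · simpa [hk] using hs k
    · have h1 : ∀ i, ∑ k ∈ insert a S, M i k * (f k - Function.update s a x k) =
          M i a * (f a - x) + z i := by
        intro i
        rw [Finset.sum_insert ha, Function.update_self]
        congr 1
        refine Finset.sum_congr rfl fun k hk => ?_
        rw [Function.update_of_ne (ne_of_mem_of_not_mem hk ha)]
      simp_rw [h1]
      rw [Finset.sum_insert ha]
      have h2 : ∑ i, (M i a * (f a - x) + z i) ^ 2 = (f a - x) ^ 2 * ∑ i, M i a ^ 2 +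
          2 * ((f a - x) * ∑ i, z i * M i a) + ∑ i, z i ^ 2 := by
        simp only [Finset.mul_sum, ← Finset.sum_add_distrib]
        refine Finset.sum_congr rfl fun i _ => by ring
      have h3 : (f a - x) ^ 2 ≤ 1 := by
        have := hf a
        rcases hx with rfl | rfl <;> nlinarith [this.1, this.2]
      have h4 : (f a - x) ^ 2 * ∑ i, M i a ^ 2 ≤ 1 * ∑ i, M i a ^ 2 :=
        mul_le_mul_of_nonneg_right h3 (Finset.sum_nonneg fun i _ => sq_nonneg _)
      rw [h2]
      linarith

end SparseSpectrum

namespace SparseSpectrum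

/-! ### The symmetric matrix as a function of its independent entries -/

/-- The position on or above the diagonal of the unordered pair `{i, j}`. -/
def upperPair {n : ℕ} (i j : Fin n) : UpperIndex n := ⟨(min i j, max i j), min_le_max⟩

/-- The symmetric matrix with prescribed entries on and above the diagonal. -/
def symMat {n : ℕ} (w : UpperIndex n → ℝ) : Matrix (Fin n) (Fin n) ℝ := fun i j => w (upperPair i j)

/-- The end point of `e` other than `i`. -/
def otherEnd {n : ℕ} (i : Fin n) (e : UpperIndex n) : Fin n := if e.1.1 = i then e.1.2 else e.1.1

lemma otherEnd_upperPair {n : ℕ} (i k : Fin n) : otherEnd i (upperPair i k) = k := by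
  unfold otherEnd upperPair
  rcases le_total i k with h | h
  · simp [h]
  · simp only [min_eq_right h, max_eq_left h]
    split_ifs with h1
    · exact h1.symm
    · rfl

lemma upperPair_injective {n : ℕ} (i : Fin n) : Function.Injective (upperPair i) :=
  Function.LeftInverse.injective (otherEnd_upperPair i)

lemma upperPair_eq {n : ℕ} {i i' k k' : Fin n} (h : upperPair i k = upperPair i' k') :
    i = i' ∨ i = k' := by
  unfold upperPair at h
  simp only [Subtype.mk.injEq, Prod.mk.injEq] at h
  obtain ⟨h1, h2⟩ := h
  rcases le_total i k with hik | hik <;> rcases le_total i' k' with hik' | hik' <;>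
    simp [hik, hik'] at h1 h2 <;> tauto

lemma card_upperIndex_le (n : ℕ) : (Fintype.card (UpperIndex n) : ℝ) ≤ (n : ℝ) ^ 2 := by
  have := Fintype.card_subtype_le fun e : Fin n × Fin n => e.1 ≤ e.2
  rw [Fintype.card_prod, Fintype.card_fin] at this
  rw [sq]
  exact_mod_cast this

lemma sum_symMat_sq_le {n : ℕ} (w : UpperIndex n → ℝ) :
    ∑ i, ∑ k, symMat w i k ^ 2 ≤ 2 * ∑ e, w e ^ 2 := by
  have h : ∀ z : Fin n × Fin n, symMat w z.1 z.2 ^ 2 ≤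
      ∑ e : UpperIndex n, ((if z = e.1 then w e ^ 2 else 0) + if z = e.1.swap then w e ^ 2 else 0) := by
    intro z
    have h0 : ∀ e ∈ Finset.univ, (0 : ℝ) ≤ (if z = (e : UpperIndex n).1 then w e ^ 2 else 0) +
        if z = e.1.swap then w e ^ 2 else 0 := by
      intro e _
      refine add_nonneg ?_ ?_ <;> split_ifs <;> positivity
    refine (Finset.single_le_sum h0 (Finset.mem_univ (upperPair z.1 z.2))).trans' ?_
    unfold symMat
    have h1 : (0 : ℝ) ≤ w (upperPair z.1 z.2) ^ 2 := sq_nonneg _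
    rcases le_total z.1 z.2 with hz | hz
    · have : z = (upperPair z.1 z.2).1 := by simp [upperPair, hz]
      rw [if_pos this]
      have : (0 : ℝ) ≤ if z = (upperPair z.1 z.2).1.swap then w (upperPair z.1 z.2) ^ 2 else 0 := by
        split_ifs <;> positivity
      linarith
    · have : z = (upperPair z.1 z.2).1.swap := by simp [upperPair, hz]
      rw [if_pos this]
      have : (0 : ℝ) ≤ if z = (upperPair z.1 z.2).1 then w (upperPair z.1 z.2) ^ 2 else 0 := by
        split_ifs <;> positivity
      linarith
  calc ∑ i, ∑ k, symMat w i k ^ 2 = ∑ z : Fin n × Fin n, symMat w z.1 z.2 ^ 2 :=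
        (Fintype.sum_prod_type fun z : Fin n × Fin n => symMat w z.1 z.2 ^ 2).symm
    _ ≤ ∑ z : Fin n × Fin n, ∑ e : UpperIndex n,
        ((if z = e.1 then w e ^ 2 else 0) + if z = e.1.swap then w e ^ 2 else 0) :=
        Finset.sum_le_sum fun z _ => h z
    _ = 2 * ∑ e, w e ^ 2 := by
        rw [Finset.sum_comm, Finset.mul_sum]
        refine Finset.sum_congr rfl fun e _ => ?_
        rw [Finset.sum_add_distrib]
        simp [two_mul]

/-- The coordinate `i` of `(symMat w - lam) x`. -/
def rowForm {n : ℕ} (lam : ℝ) (x : Fin n → ℝ) (i : Fin n) (w : UpperIndex n → ℝ) : ℝ :=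
  ∑ k, symMat w i k * x k - lam * x i

@[fun_prop]
lemma measurable_rowForm {n : ℕ} (lam : ℝ) (x : Fin n → ℝ) (i : Fin n) :
    Measurable (rowForm lam x i) := by
  unfold rowForm symMat
  fun_prop

-- Only the entries joining `i` to `J` are integrated. Everything else in the row, the shift by
-- `lam` included, is frozen and goes into `u`, over which `row_bound` is uniform.
open Function in
lemma lmarginal_rowForm_le {n : ℕ} (κ : Measure ℝ) [IsProbabilityMeasure κ]
    {a D r R b L t : ℝ} {v v' : Fin n → ℝ} {J : Finset (Fin n)} (lam : ℝ)
    (ha : 0 < a) (hD : 0 < D) (hr : 0 < r) (hb : 0 < b) (hbL : b ≤ L) (hL : L ≤ 1) (ht : 0 < t)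
    (hmass : 3 / 4 * a ≤ (κ.prod κ).real {z | r < |z.1 - z.2| ∧ |z.1 - z.2| ≤ R})
    (hlcd : LCDAtLeast a D fun k : J => v k / L)
    (hY : 24 * a * R ^ 2 * ∑ k ∈ J, (v' k - v k) ^ 2 ≤ (2 * Real.pi * t) ^ 2)
    (i : Fin n) (w : UpperIndex n → ℝ) :
    lmarginal (fun _ => κ) (J.image (upperPair i))
      (fun w => ENNReal.ofReal (Real.exp (-(rowForm lam v' i w / t) ^ 2 / 2))) w ≤
    ENNReal.ofReal
      (40 * t / (Real.sqrt a * r * b) + 6 * Real.exp (-(2 * Real.pi * t * D / R) ^ 2 / 8)) := by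
  set E := J.image (upperPair i) with hE
  have hsumE : ∀ F : UpperIndex n → ℝ, ∑ e : E, F e = ∑ k ∈ J, F (upperPair i k) := by
    intro F
    rw [Finset.sum_coe_sort E F, hE, Finset.sum_image fun x _ y _ h => upperPair_injective i h]
  have hsum : ∀ f : Fin n → ℝ, ∑ e : E, f (otherEnd i e) = ∑ k ∈ J, f k := by
    intro f
    rw [hsumE fun e => f (otherEnd i e)]
    simp_rw [otherEnd_upperPair]
  have hrow := row_bound (ι := E) κ (v := fun e => v (otherEnd i e))
    (v' := fun e => v' (otherEnd i e)) ha hD hr hb hbL hL ht hmass (by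
      intro θ h0 hθ
      refine (hlcd θ h0 hθ).trans_eq ?_
      rw [hsum fun k => distInt (θ * (v k / L)) ^ 2,
        Finset.sum_coe_sort J fun k => distInt (θ * (v k / L)) ^ 2]) (by
      rwa [hsum fun k => (v' k - v k) ^ 2])
  set u : ℝ := (∑ k ∈ Jᶜ, w (upperPair i k) * v' k - lam * v' i) / t with hu
  have hform : ∀ y : E → ℝ, rowForm lam v' i (updateFinset w E y) / t =
      ∑ e : E, v' (otherEnd i e) / t * y e + u := by
    intro y
    unfold rowForm symMat
    have h1 : ∑ k ∈ J, updateFinset w E y (upperPair i k) * v' k =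
        ∑ e : E, y e * v' (otherEnd i e) := by
      have : ∑ e : E, y e * v' (otherEnd i e) =
          ∑ e : E, updateFinset w E y e * v' (otherEnd i e) := by
        refine Finset.sum_congr rfl fun e _ => ?_
        rw [updateFinset_def]
        simp only [e.2, dite_true, Subtype.coe_eta]
      rw [this, hsumE fun e => updateFinset w E y e * v' (otherEnd i e)]
      simp_rw [otherEnd_upperPair]
    have h2 : ∑ k ∈ Jᶜ, updateFinset w E y (upperPair i k) * v' k =
        ∑ k ∈ Jᶜ, w (upperPair i k) * v' k := by
      refine Finset.sum_congr rfl fun k hk => ?_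
      rw [updateFinset_def]
      simp only
      rw [dif_neg]
      rw [hE, Finset.mem_image]
      rintro ⟨k', hk', h⟩
      rw [upperPair_injective i h] at hk'
      exact Finset.mem_compl.1 hk hk'
    rw [← Finset.sum_add_sum_compl J, h1, h2, hu, add_sub_assoc, add_div, Finset.sum_div]
    congr 1
    refine Finset.sum_congr rfl fun e _ => by ring
  rw [lmarginal]
  simp_rw [hform]
  rw [← ofReal_integral_eq_lintegral_ofReal]
  · exact ENNReal.ofReal_le_ofReal (hrow u)
  · refine Integrable.of_bound (Measurable.aestronglyMeasurable (by fun_prop)) 1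
      (Filter.Eventually.of_forall fun y => ?_)
    rw [Real.norm_eq_abs, abs_of_pos (Real.exp_pos _), Real.exp_le_one_iff]
    have := sq_nonneg (∑ e : E, v' (otherEnd i e) / t * y e + u)
    linarith
  · exact Filter.Eventually.of_forall fun y => (Real.exp_pos _).le

open Function in
/-- Small ball estimate for a fixed vector close to one with a large denominator on `J`. -/
lemma measure_rowForm_small_le {n : ℕ} (κ : Measure ℝ) [IsProbabilityMeasure κ]
    {a D r R b L t : ℝ} {v v' : Fin n → ℝ} {J : Finset (Fin n)} (lam : ℝ)
    (ha : 0 < a) (hD : 0 < D) (hr : 0 < r) (hb : 0 < b) (hbL : b ≤ L) (hL : L ≤ 1) (ht : 0 < t)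
    (hmass : 3 / 4 * a ≤ (κ.prod κ).real {z | r < |z.1 - z.2| ∧ |z.1 - z.2| ≤ R})
    (hlcd : LCDAtLeast a D fun k : J => v k / L)
    (hY : 24 * a * R ^ 2 * ∑ k ∈ J, (v' k - v k) ^ 2 ≤ (2 * Real.pi * t) ^ 2) :
    (Measure.pi fun _ : UpperIndex n => κ) {w | ∑ i, rowForm lam v' i w ^ 2 ≤ t ^ 2 * n} ≤
      ENNReal.ofReal (Real.exp (n / 2) * (40 * t / (Real.sqrt a * r * b) +
        6 * Real.exp (-(2 * Real.pi * t * D / R) ^ 2 / 8)) ^ (n - J.card)) := by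
  classical
  set Q := 40 * t / (Real.sqrt a * r * b) + 6 * Real.exp (-(2 * Real.pi * t * D / R) ^ 2 / 8)
  have hQ : 0 ≤ Q := by positivity
  set g : Fin n → (UpperIndex n → ℝ) → ENNReal :=
    fun i w => ENNReal.ofReal (Real.exp (-(rowForm lam v' i w / t) ^ 2 / 2)) with hg
  have hgm : ∀ i, Measurable (g i) := fun i => by fun_prop
  -- An entry joining `i ∉ J` to a column of `J` meets no other row outside `J`. Giving up the rows
  -- of `J` thus restores the conditional independence destroyed by symmetry.
  have h1 := lintegral_prod_le_pow κ Jᶜ (fun i => J.image (upperPair i)) g hgm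
    (ENNReal.ofReal Q) (by
      intro i hi i' hi' hne w y
      have : rowForm lam v' i' (updateFinset w (J.image (upperPair i)) y) = rowForm lam v' i' w := by
        unfold rowForm symMat
        congr 1
        refine Finset.sum_congr rfl fun k _ => ?_
        rw [updateFinset_def]
        simp only
        rw [dif_neg]
        rw [Finset.mem_image]
        rintro ⟨k', hk', h⟩
        rcases upperPair_eq h.symm with h2 | h2
        · exact hne h2.symm
        · rw [h2] at hi'; exact Finset.mem_compl.1 hi' hk'
      simp only [hg, this]) (by
      intro i _ w
      exact lmarginal_rowForm_le κ lam ha hD hr hb hbL hL ht hmass hlcd hY i w)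
  have h2 := measure_le_exp_mul_lintegral (Measure.pi fun _ : UpperIndex n => κ)
    (f := fun w => ∏ i ∈ Jᶜ, g i w) (Finset.measurable_prod _ fun i _ => hgm i)
    (s := {w | ∑ i, rowForm lam v' i w ^ 2 ≤ t ^ 2 * n}) (c := n / 2) (by
      intro w hw
      simp only [hg]
      rw [← ENNReal.ofReal_prod_of_nonneg fun e _ => (Real.exp_pos _).le, ← Real.exp_sum]
      refine ENNReal.ofReal_le_ofReal (Real.exp_le_exp.2 ?_)
      have h3 : ∑ i ∈ Jᶜ, rowForm lam v' i w ^ 2 ≤ t ^ 2 * n :=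
        (Finset.sum_le_sum_of_subset_of_nonneg (Finset.subset_univ _)
          fun i _ _ => sq_nonneg _).trans hw
      have h4 : ∑ i ∈ Jᶜ, -(rowForm lam v' i w / t) ^ 2 / 2 =
          -((∑ i ∈ Jᶜ, rowForm lam v' i w ^ 2) / (2 * t ^ 2)) := by
        rw [Finset.sum_div, ← Finset.sum_neg_distrib]
        refine Finset.sum_congr rfl fun i _ => by field_simp
      rw [h4, neg_le_neg_iff, div_le_div_iff₀ (by positivity) (by norm_num)]
      nlinarith)
  refine h2.trans ((mul_le_mul_right h1 _).trans_eq ?_)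
  rw [← ENNReal.ofReal_pow hQ, ← ENNReal.ofReal_mul (Real.exp_pos _).le, Finset.card_compl,
    Fintype.card_fin]

end SparseSpectrum

namespace SparseSpectrum

/-! ### The blocks of the partition -/

lemma chunk_subset {n : ℕ} (S : Finset (Fin n)) (a b : ℕ) : chunk S a b ⊆ S :=
  Finset.filter_subset _ _

lemma image_position {n : ℕ} (S : Finset (Fin n)) :
    S.image (fun i => (S.filter (· < i)).card) = Finset.range S.card ∧
      Set.InjOn (fun i => (S.filter (· < i)).card) S := by
  have hinj : Set.InjOn (fun i => (S.filter (· < i)).card) S := by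
    have hlt : ∀ i ∈ S, ∀ j ∈ S, i < j → (S.filter (· < i)).card < (S.filter (· < j)).card := by
      intro i hi j _ hij
      refine Finset.card_lt_card ⟨fun x hx => ?_, fun h => ?_⟩
      · rw [Finset.mem_filter] at hx ⊢
        exact ⟨hx.1, hx.2.trans hij⟩
      · have := h (Finset.mem_filter.2 ⟨hi, hij⟩)
        exact lt_irrefl _ (Finset.mem_filter.1 this).2
    intro i hi j hj h
    rcases lt_trichotomy i j with h1 | h1 | h1
    · exact absurd h (hlt i hi j hj h1).ne
    · exact h1
    · exact absurd h (hlt j hj i hi h1).ne'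
  refine ⟨Finset.eq_of_subset_of_card_le ?_ ?_, hinj⟩
  · intro k hk
    obtain ⟨i, hi, rfl⟩ := Finset.mem_image.1 hk
    rw [Finset.mem_range]
    refine Finset.card_lt_card ⟨Finset.filter_subset _ _, fun h => ?_⟩
    exact lt_irrefl _ (Finset.mem_filter.1 (h hi)).2
  · rw [Finset.card_image_of_injOn hinj, Finset.card_range]

lemma card_chunk {n : ℕ} (S : Finset (Fin n)) (a b : ℕ) :
    (chunk S a b).card = min b S.card - a := by
  obtain ⟨h1, h2⟩ := image_position S
  have h3 : (chunk S a b).image (fun i => (S.filter (· < i)).card) =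
      Finset.Ico a (min b S.card) := by
    ext k
    simp only [chunk, Finset.mem_image, Finset.mem_filter, Finset.mem_Ico, lt_min_iff]
    constructor
    · rintro ⟨i, ⟨hi, ha, hb⟩, rfl⟩
      have := Finset.mem_image_of_mem (fun i => (S.filter (· < i)).card) hi
      rw [h1, Finset.mem_range] at this
      exact ⟨ha, hb, this⟩
    · rintro ⟨ha, hb, hc⟩
      rw [← Finset.mem_range, ← h1] at hc
      obtain ⟨i, hi, rfl⟩ := Finset.mem_image.1 hc
      exact ⟨i, ⟨hi, ha, hb⟩, rfl⟩
  rw [← Finset.card_image_of_injOn (h2.mono (chunk_subset S a b)), h3, Nat.card_Ico]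

/-- The intervals from `f j` to `f (j + 1)` cover everything below `f k` as soon as `f 0 = 0`.
Monotonicity is not required, so truncated subtraction in `f` does no harm. -/
lemma exists_mem_chunk {n : ℕ} {S : Finset (Fin n)} (f : ℕ → ℕ) (hf : f 0 = 0) (k : ℕ) {i : Fin n}
    (hi : i ∈ S) (h : (S.filter (· < i)).card < f k) :
    ∃ j < k, i ∈ chunk S (f j) (f (j + 1)) := by
  induction k with
  | zero => rw [hf] at h; exact absurd h (Nat.not_lt_zero _)
  | succ k ih =>
    by_cases h1 : (S.filter (· < i)).card < f k
    · obtain ⟨j, hj, hm⟩ := ih h1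
      exact ⟨j, hj.trans (Nat.lt_succ_self k), hm⟩
    · exact ⟨k, Nat.lt_succ_self k, Finset.mem_filter.2 ⟨hi, not_lt.1 h1, h⟩⟩

/-- The number of elements of `σ` in a block that is not one of the last. -/
noncomputable def blockSpread {n : ℕ} (M ρ : ℝ) (m : ℕ) (σ τ' : Finset (Fin n)) : ℕ :=
  ⌈M * ρ ^ 2 / (2 * (blockCount m σ τ' : ℝ))⌉₊

lemma blockCount_mul_le {n : ℕ} (m : ℕ) (σ τ' : Finset (Fin n)) : blockCount m σ τ' * m ≤ n :=
  (Nat.div_mul_le_self _ _).trans (Nat.sub_le _ _)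

/-- The exact size of a block is not needed. This crude bound holds whatever the truncated
subtractions and the exhaustion of `σ` do. -/
lemma card_block_le {n : ℕ} (M ρ : ℝ) (m : ℕ) (σ τ' : Finset (Fin n)) (j : ℕ) :
    (block M ρ m σ τ' j).card ≤ m + blockSpread M ρ m σ τ' := by
  unfold block
  simp only
  rw [← blockSpread]
  set a := blockSpread M ρ m σ τ'
  refine (Finset.card_union_le _ _).trans ?_
  rw [card_chunk, card_chunk]
  have h1 : (j + 1) * a = j * a + a := by ring
  have h2 : (j + 1) * m = j * m + m := by ring
  rw [h1, h2]
  omega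

lemma chunk_subset_block {n : ℕ} (M ρ : ℝ) (m : ℕ) (σ τ' : Finset (Fin n)) (j : ℕ) :
    chunk σ (j * blockSpread M ρ m σ τ') ((j + 1) * blockSpread M ρ m σ τ') ⊆
      block M ρ m σ τ' j :=
  Finset.subset_union_left

/-- The blocks exhaust `σ`. What they miss lies in `τ` or in the tail of the remaining coordinates,
and that tail is shorter than `m`, being the remainder of a division by `m`. -/
lemma card_compl_blocks_le {n : ℕ} (M ρ : ℝ) {m : ℕ} (hm : 0 < m) (σ τ' : Finset (Fin n))
    (hσ : σ.card ≤ blockCount m σ τ' * blockSpread M ρ m σ τ') :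
    ((Finset.range (blockCount m σ τ')).biUnion (block M ρ m σ τ'))ᶜ.card ≤ τ'.card + m := by
  set k₀ := blockCount m σ τ' with hk₀
  set a := blockSpread M ρ m σ τ' with ha
  set S : Finset (Fin n) := ((τ' \ σ) ∪ σ)ᶜ with hS
  set f : ℕ → ℕ := fun j => j * m - min (j * a) σ.card with hf
  have hsub : ((Finset.range k₀).biUnion (block M ρ m σ τ'))ᶜ ⊆
      (τ' \ σ) ∪ chunk S (f k₀) S.card := by
    intro i hi
    rw [Finset.mem_compl, Finset.mem_biUnion] at hi
    rw [Finset.mem_union]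
    by_cases h1 : i ∈ τ' \ σ
    · exact Or.inl h1
    right
    by_cases h2 : i ∈ σ
    · exfalso
      obtain ⟨h3, -⟩ := image_position σ
      have h4 := Finset.mem_image_of_mem (fun i => (σ.filter (· < i)).card) h2
      rw [h3, Finset.mem_range] at h4
      obtain ⟨j, hj, hm⟩ := exists_mem_chunk (fun j => j * a) (zero_mul _) k₀ h2 (h4.trans_le hσ)
      exact hi ⟨j, Finset.mem_range.2 hj, chunk_subset_block M ρ m σ τ' j hm⟩
    have h3 : i ∈ S := by
      rw [hS, Finset.mem_compl, Finset.mem_union]; tauto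
    have h4 := Finset.mem_image_of_mem (fun i => (S.filter (· < i)).card) h3
    rw [(image_position S).1, Finset.mem_range] at h4
    refine Finset.mem_filter.2 ⟨h3, ?_, h4⟩
    by_contra h5
    obtain ⟨j, hj, hm⟩ := exists_mem_chunk f (by simp [hf]) k₀ h3 (not_le.1 h5)
    exact hi ⟨j, Finset.mem_range.2 hj, Finset.mem_union_right _ hm⟩
  refine (Finset.card_le_card hsub).trans ((Finset.card_union_le _ _).trans ?_)
  rw [card_chunk, min_self]
  have hSc : S.card = n - ((τ' \ σ).card + σ.card) := by
    rw [hS, Finset.card_compl, Fintype.card_fin,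
      Finset.card_union_of_disjoint Finset.sdiff_disjoint]
  have h6 : (τ' \ σ).card ≤ τ'.card := Finset.card_le_card Finset.sdiff_subset
  have h7 : n - (τ' \ σ).card < k₀ * m + m := by
    exact Nat.lt_div_mul_add (a := n - (τ' \ σ).card) hm
  have h8 : f k₀ = k₀ * m - min (k₀ * a) σ.card := rfl
  rw [min_eq_right hσ] at h8
  omega

/-! ### The least common denominator -/

lemma infDist_integerLattice {ι : Type*} [Fintype ι] (y : EuclideanSpace ℝ ι) :
    Metric.infDist y (integerLattice ι) = Real.sqrt (∑ i, distInt (y i) ^ 2) := by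
  have hne : (integerLattice ι).Nonempty := ⟨0, fun i => ⟨0, by simp⟩⟩
  apply le_antisymm
  · have hm : (WithLp.toLp 2 fun i => (round (y i) : ℝ)) ∈ integerLattice ι :=
      fun i => ⟨round (y i), rfl⟩
    refine (Metric.infDist_le_dist_of_mem hm).trans_eq ?_
    rw [EuclideanSpace.dist_eq]
    congr 1
  · rw [Metric.le_infDist hne]
    intro z hz
    rw [EuclideanSpace.dist_eq]
    refine Real.sqrt_le_sqrt (Finset.sum_le_sum fun i _ => ?_)
    obtain ⟨k, hk⟩ := hz i
    rw [hk, Real.dist_eq]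
    exact pow_le_pow_left₀ (distInt_nonneg _) (round_le _ _) 2

lemma mem_lcd_set_iff {ι : Type*} [Fintype ι] {a θ : ℝ} (ha : 0 < a) (x : EuclideanSpace ℝ ι) :
    Metric.infDist (θ • x) (integerLattice ι) <
      (Real.sqrt a)⁻¹ * Real.sqrt (Real.posLog (Real.sqrt a * θ)) ↔
    a * ∑ k, distInt (θ * x k) ^ 2 < Real.posLog (Real.sqrt a * θ) := by
  have h0 : 0 ≤ ∑ k, distInt (θ * x k) ^ 2 := Finset.sum_nonneg fun k _ => sq_nonneg _
  rw [infDist_integerLattice, ← Real.sqrt_inv, ← Real.sqrt_mul (by positivity)]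
  simp only [PiLp.smul_apply, smul_eq_mul]
  rw [Real.sqrt_lt_sqrt_iff h0, inv_mul_eq_div, lt_div_iff₀ ha, mul_comm]

lemma lcdAtLeast_of_le {ι : Type*} [Fintype ι] {δ₀ p D : ℝ} (ha : 0 < δ₀ * p)
    {x : EuclideanSpace ℝ ι} (h : D ≤ lcd δ₀ p x) : LCDAtLeast (δ₀ * p) D x := by
  intro θ h0 hθ
  by_contra hc
  rw [not_le, ← mem_lcd_set_iff ha] at hc
  have : lcd δ₀ p x ≤ θ := csInf_le ⟨0, fun y hy => hy.1.le⟩ ⟨h0, hc⟩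
  linarith

lemma exists_denominator {ι : Type*} [Fintype ι] {δ₀ p D : ℝ} (ha : 0 < δ₀ * p)
    {x : EuclideanSpace ℝ ι} (h : lcd δ₀ p x < D) :
    ∃ θ, 0 < θ ∧ θ < D ∧
      δ₀ * p * ∑ k, distInt (θ * x k) ^ 2 < Real.posLog (Real.sqrt (δ₀ * p) * θ) := by
  set a := δ₀ * p with ha'
  have hsa : 0 < Real.sqrt a := Real.sqrt_pos.2 ha
  -- The infimum of the empty set would be 0, so a denominator must be exhibited: for huge `θ` the
  -- logarithm exceeds the trivial bound by the dimension.
  have hne : {θ : ℝ | 0 < θ ∧ Metric.infDist (θ • x) (integerLattice ι) <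
      (Real.sqrt (δ₀ * p))⁻¹ * Real.sqrt (Real.posLog (Real.sqrt (δ₀ * p) * θ))}.Nonempty := by
    refine ⟨(Real.sqrt a)⁻¹ * Real.exp (a * (Fintype.card ι + 1)), by positivity, ?_⟩
    rw [← ha', mem_lcd_set_iff ha, mul_inv_cancel_left₀ hsa.ne']
    have h1 : ∑ k, distInt ((Real.sqrt a)⁻¹ * Real.exp (a * (Fintype.card ι + 1)) * x k) ^ 2 ≤
        Fintype.card ι := by
      refine (Finset.sum_le_card_nsmul _ _ 1 fun k _ => ?_).trans_eq (by simp)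
      have h0 := distInt_nonneg ((Real.sqrt a)⁻¹ * Real.exp (a * (Fintype.card ι + 1)) * x k)
      have h1 := distInt_le_half ((Real.sqrt a)⁻¹ * Real.exp (a * (Fintype.card ι + 1)) * x k)
      nlinarith
    calc _ ≤ a * Fintype.card ι := by gcongr
      _ < a * (Fintype.card ι + 1) := by gcongr; linarith
      _ = Real.log (Real.exp (a * (Fintype.card ι + 1))) := (Real.log_exp _).symm
      _ ≤ _ := le_max_right _ _
  obtain ⟨θ, hθ, hlt⟩ := exists_lt_of_csInf_lt hne h
  refine ⟨θ, hθ.1, hlt, ?_⟩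
  rw [← mem_lcd_set_iff ha]
  exact hθ.2

lemma posLog_lt_sq {w : ℝ} (hw : 0 < w) : Real.posLog w < w ^ 2 := by
  have h0 : Real.posLog w = max 0 (Real.log w) := rfl
  rw [h0, max_lt_iff]
  refine ⟨by positivity, ?_⟩
  have := Real.log_le_sub_one_of_pos hw
  nlinarith [sq_nonneg (w - 1)]

lemma distInt_of_abs_lt {y : ℝ} (h : |y| < 1 / 2) : distInt y = |y| := by
  have : round y = 0 := by
    rw [abs_lt] at h
    rw [round_eq, Int.floor_eq_zero_iff]
    constructor <;> linarith [h.1, h.2]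
  simp [distInt, this]

/-- The restriction of `v` to a block with a small denominator is close to a multiple of an
integer vector. -/
lemma exists_lattice_approx {n : ℕ} {a D μ L : ℝ} {v : Fin n → ℝ} {J : Finset (Fin n)}
    (ha : 0 < a) (hL : 0 ≤ L) (hLsq : L ^ 2 = ∑ k ∈ J, v k ^ 2)
    (hμ0 : 0 ≤ μ)
    (hμ : ∀ k ∈ J, |v k| ≤ μ) {θ : ℝ} (h0 : 0 < θ) (hθ : θ < D)
    (h : a * ∑ k ∈ J, distInt (θ * (L⁻¹ * v k)) ^ 2 < Real.posLog (Real.sqrt a * θ)) :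
    ∃ (t : ℝ) (q : Fin n → ℤ) (w : Fin n → ℝ), 0 ≤ t ∧ t ≤ 2 * μ ∧ t * θ = L ∧
      (∀ k ∈ J, v k = t * (q k + w k)) ∧
      a * ∑ k ∈ J, w k ^ 2 ≤ Real.posLog (Real.sqrt a * D) ∧
      ∑ k ∈ J, (q k : ℝ) ^ 2 ≤ 2 * θ ^ 2 + 2 * ∑ k ∈ J, w k ^ 2 := by
  have hsa : 0 < Real.sqrt a := Real.sqrt_pos.2 ha
  set y : Fin n → ℝ := fun k => θ * (L⁻¹ * v k) with hy
  have hvy : ∀ k ∈ J, v k = L / θ * y k := by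
    intro k hk
    rcases hL.eq_or_lt with h1 | h1
    · have : ∑ k ∈ J, v k ^ 2 = 0 := by rw [← hLsq, ← h1]; norm_num
      rw [Finset.sum_eq_zero_iff_of_nonneg fun k _ => sq_nonneg _] at this
      have := pow_eq_zero_iff two_ne_zero |>.1 (this k hk)
      rw [this, ← h1]; simp
    · simp only [hy]; field_simp
  have hysq : ∑ k ∈ J, y k ^ 2 ≤ θ ^ 2 := by
    simp only [hy, mul_pow, ← Finset.mul_sum]
    rw [← hLsq]
    rcases hL.eq_or_lt with h1 | h1
    · rw [← h1]; simp; positivity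
    · rw [← mul_pow L⁻¹, inv_mul_cancel₀ h1.ne']; simp
  refine ⟨L / θ, fun k => round (y k), fun k => y k - round (y k), by positivity, ?_,
    div_mul_cancel₀ _ h0.ne', fun k hk => ?_, ?_, ?_⟩
  -- If `t > 2μ`, all scaled coordinates are below `1/2` in absolute value, so their distance to the
  -- lattice is their norm `θ`. Then `a θ²` would be less than `posLog (√a θ)`, contrary to `posLog
  -- w < w²`.
  · by_contra hc
    rw [not_le] at hc
    have hLθ : 0 < L / θ := by linarith
    have hL0 : 0 < L := by
      rcases hL.eq_or_lt with h1 | h1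
      · rw [← h1] at hLθ; simp at hLθ
      · exact h1
    have hd : ∀ k ∈ J, distInt (y k) ^ 2 = y k ^ 2 := by
      intro k hk
      rw [distInt_of_abs_lt, sq_abs]
      have h1 := hμ k hk
      rw [hvy k hk, abs_mul, abs_of_pos hLθ] at h1
      by_contra h2
      have h3 := not_lt.1 h2
      nlinarith
    rw [Finset.sum_congr rfl hd] at h
    have hys : ∑ k ∈ J, y k ^ 2 = θ ^ 2 := by
      simp only [hy, mul_pow, ← Finset.mul_sum]
      rw [← hLsq, ← mul_pow L⁻¹, inv_mul_cancel₀ hL0.ne']; simp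
    rw [hys] at h
    have h4 := posLog_lt_sq (w := Real.sqrt a * θ) (by positivity)
    rw [mul_pow, Real.sq_sqrt ha.le] at h4
    linarith
  · rw [hvy k hk]; ring
  · have h1 : ∀ k, (y k - round (y k)) ^ 2 = distInt (y k) ^ 2 := fun k => by
      rw [distInt, sq_abs]
    simp_rw [h1]
    refine h.le.trans ?_
    exact Real.monotoneOn_posLog (Set.mem_Ici.2 (by positivity)) (Set.mem_Ici.2 (by
      have := h0.trans hθ; positivity)) (by gcongr)
  · have h1 : ∀ k, ((round (y k) : ℤ) : ℝ) ^ 2 ≤ 2 * y k ^ 2 + 2 * (y k - round (y k)) ^ 2 := by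
      intro k
      nlinarith [sq_nonneg (2 * y k - round (y k))]
    calc _ ≤ ∑ k ∈ J, (2 * y k ^ 2 + 2 * (y k - round (y k)) ^ 2) :=
          Finset.sum_le_sum fun k _ => h1 k
      _ = 2 * ∑ k ∈ J, y k ^ 2 + 2 * ∑ k ∈ J, (y k - round (y k)) ^ 2 := by
          rw [Finset.sum_add_distrib, Finset.mul_sum, Finset.mul_sum]
      _ ≤ _ := by gcongr

end SparseSpectrum

namespace SparseSpectrum

/-! ### Counting lattice codes -/

/-- Comparison with the Gaussian integral on each half line; the factor `π` in the exponent makes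
that integral exactly `1 / (2 √a)`. -/
lemma sum_exp_neg_sq_le {a : ℝ} (ha : 0 < a) (Q : ℕ) :
    ∑ q ∈ Finset.Icc (-(Q : ℤ)) Q, Real.exp (-(Real.pi * a) * (q : ℝ) ^ 2) ≤
      1 + (Real.sqrt a)⁻¹ := by
  set f : ℝ → ℝ := fun x => Real.exp (-(Real.pi * a) * x ^ 2) with hf
  have hs : 0 < Real.pi * a := mul_pos Real.pi_pos ha
  have hanti : AntitoneOn f (Set.Icc 0 (0 + (Q : ℕ))) := by
    intro x hx y hy hxy
    simp only [hf, Real.exp_le_exp]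
    have : x ^ 2 ≤ y ^ 2 := pow_le_pow_left₀ hx.1 hxy 2
    nlinarith
  have h1 := hanti.sum_le_integral
  have h2 : ∫ x in (0 : ℝ)..(0 + (Q : ℕ)), f x ≤ (Real.sqrt a)⁻¹ / 2 := by
    rw [intervalIntegral.integral_of_le (by simp)]
    have h3 := integral_gaussian_Ioi (Real.pi * a)
    rw [show Real.pi / (Real.pi * a) = a⁻¹ by field_simp, Real.sqrt_inv] at h3
    rw [← h3]
    refine setIntegral_mono_set (integrable_exp_neg_mul_sq hs).integrableOn
      (Filter.Eventually.of_forall fun x => (Real.exp_pos _).le) ?_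
    exact (Set.Ioc_subset_Ioi_self).eventuallyLE
  have h4 : ∀ Q : ℕ, ∑ q ∈ Finset.Icc (-(Q : ℤ)) Q, f q = 1 + 2 * ∑ i ∈ Finset.range Q, f (0 + (i + 1 : ℕ)) := by
    intro Q
    induction Q with
    | zero => simp [hf]
    | succ Q ih =>
      have h5 : Finset.Icc (-((Q + 1 : ℕ) : ℤ)) ((Q + 1 : ℕ) : ℤ) =
          insert (-((Q + 1 : ℕ) : ℤ)) (insert ((Q + 1 : ℕ) : ℤ) (Finset.Icc (-(Q : ℤ)) Q)) := by
        ext q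
        simp only [Finset.mem_insert, Finset.mem_Icc]
        push_cast
        omega
      rw [h5, Finset.sum_insert, Finset.sum_insert, ih, Finset.sum_range_succ]
      · have : f ((-((Q + 1 : ℕ) : ℤ) : ℤ) : ℝ) = f (((Q + 1 : ℕ) : ℤ) : ℝ) := by
          simp only [hf]; push_cast; ring_nf
        rw [this]
        simp only [zero_add, Int.cast_natCast]
        ring
      · simp only [Finset.mem_Icc]; push_cast; omega
      · simp only [Finset.mem_insert, Finset.mem_Icc]; push_cast; omega
  have h6 := h4 Q
  simp only [hf] at h6 h1 h2
  rw [h6]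
  linarith

/-- The number of points of a box under a weighted quadratic constraint. -/
lemma card_le_exp_mul_prod {κ : Type*} [Fintype κ] [DecidableEq κ] (s : κ → ℝ)
    (T : κ → Finset (ℤ × ℤ)) (A : Finset (κ → ℤ × ℤ)) {P : ℝ}
    (hA : ∀ c ∈ A, (∀ k, c k ∈ T k) ∧ ∑ k, s k * ((c k).1 : ℝ) ^ 2 ≤ P) :
    (A.card : ℝ) ≤ Real.exp P * ∏ k, ∑ x ∈ T k, Real.exp (-(s k * (x.1 : ℝ) ^ 2)) := by
  rw [Finset.prod_univ_sum, Finset.mul_sum]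
  have hsub : A ⊆ Fintype.piFinset T := fun c hc => Fintype.mem_piFinset.2 (hA c hc).1
  calc (A.card : ℝ) = ∑ c ∈ A, (1 : ℝ) := by simp
    _ ≤ ∑ c ∈ A, Real.exp P * ∏ k, Real.exp (-(s k * ((c k).1 : ℝ) ^ 2)) := by
        refine Finset.sum_le_sum fun c hc => ?_
        rw [← Real.exp_sum, ← Real.exp_add, Finset.sum_neg_distrib]
        apply Real.one_le_exp
        linarith [(hA c hc).2]
    _ ≤ _ := Finset.sum_le_sum_of_subset_of_nonneg hsub fun c _ _ => by positivity

lemma abs_floor_sub_floor_le (x y : ℝ) : |((⌊x⌋ - ⌊y⌋ : ℤ) : ℝ)| ≤ |x - y| + 1 := by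
  push_cast
  have h1 := Int.floor_le x
  have h2 := Int.lt_floor_add_one x
  have h3 := Int.floor_le y
  have h4 := Int.lt_floor_add_one y
  have h5 := le_abs_self (x - y)
  have h6 := neg_abs_le (x - y)
  rw [abs_le]
  constructor <;> linarith

/-- The vectors whose restrictions to the blocks `J j` are close to multiples `t` of integer
vectors, with a common scale. -/
def NearLattice {n : ℕ} {ι : Type*} (J : ι → Finset (Fin n)) (D μ K : ℝ) (v : Fin n → ℝ) : Prop :=
  ∀ j, ∃ (θ t : ℝ) (q : Fin n → ℤ) (w : Fin n → ℝ), 0 < θ ∧ θ ≤ D ∧ 0 ≤ t ∧ t ≤ 2 * μ ∧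
    t * θ ≤ 1 ∧ (∀ k ∈ J j, v k = t * (q k + w k)) ∧ ∑ k ∈ J j, w k ^ 2 ≤ K ∧
    ∑ k ∈ J j, (q k : ℝ) ^ 2 ≤ 2 * θ ^ 2 + 2 * K

/-- Chebyshev in each block. The map `jj` assigns one block to each coordinate, so disjointness of
the blocks is not used. -/
lemma card_large_le {n : ℕ} {ι : Type*} [Fintype ι] {J : ι → Finset (Fin n)} {jj : Fin n → ι}
    {w : ι → Fin n → ℝ} {K h : ℝ} (hh : 0 < h) (hw : ∀ j, ∑ k ∈ J j, w j k ^ 2 ≤ K)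
    (S : Finset (Fin n)) (hS : ∀ k ∈ S, k ∈ J (jj k) ∧ h < |w (jj k) k|) :
    (S.card : ℝ) ≤ Fintype.card ι * K / h ^ 2 := by
  classical
  rw [le_div_iff₀ (by positivity)]
  calc (S.card : ℝ) * h ^ 2 = ∑ k ∈ S, h ^ 2 := by simp
    _ ≤ ∑ k ∈ S, w (jj k) k ^ 2 := by
        refine Finset.sum_le_sum fun k hk => ?_
        rw [← sq_abs (w _ _)]
        exact pow_le_pow_left₀ hh.le (hS k hk).2.le 2
    _ = ∑ j, ∑ k ∈ S with jj k = j, w (jj k) k ^ 2 := (Finset.sum_fiberwise _ _ _).symm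
    _ ≤ ∑ j : ι, K := by
        refine Finset.sum_le_sum fun j _ => ?_
        refine le_trans ?_ (hw j)
        calc ∑ k ∈ S with jj k = j, w (jj k) k ^ 2 = ∑ k ∈ S with jj k = j, w j k ^ 2 :=
              Finset.sum_congr rfl fun k hk => by rw [(Finset.mem_filter.1 hk).2]
          _ ≤ _ := by
              refine Finset.sum_le_sum_of_subset_of_nonneg (fun k hk => ?_) fun _ _ _ => sq_nonneg _
              obtain ⟨h1, h2⟩ := Finset.mem_filter.1 hk
              exact h2 ▸ (hS k h1).1
    _ = Fintype.card ι * K := by simp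

/-- The codes of near lattice vectors with given outer data. -/
lemma card_codes_le {n m : ℕ} {ι : Type*} [Fintype ι] [DecidableEq ι] (hm : 0 < m)
    (hmn : Fintype.card ι * m ≤ n) {jj : Fin n → ι} {U : Finset (Fin n)} {R : ι → ℝ} (hR : ∀ j, 0 < R j) {b : ι → ℕ} {F : ℝ} {Q Z : ℕ}
    (hF : ∀ j, (1 + Real.sqrt (R j / m)) * (2 * b j + 1) ≤ F)
    (A : Finset (Fin n → ℤ × ℤ))
    (hA : ∀ c ∈ A, (∀ k ∈ U, |(c k).1| ≤ Q ∧ |(c k).2| ≤ b (jj k)) ∧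
      (∀ k ∉ U, (c k).1 = 0 ∧ |(c k).2| ≤ Z) ∧
      ∀ j, ∑ k ∈ U with jj k = j, ((c k).1 : ℝ) ^ 2 ≤ R j) :
    (A.card : ℝ) ≤ Real.exp (Real.pi * n) * (F ^ U.card * (2 * Z + 1) ^ (Uᶜ).card) := by
  classical
  have hm' : (0 : ℝ) < m := by exact_mod_cast hm
  -- With this weight each block contributes at most `π m` to the constraint, hence `π n` in total,
  -- while the Gaussian sum at one coordinate is at most `1 + √(R/m)`.
  set s : Fin n → ℝ := fun k => Real.pi * (m / R (jj k)) with hs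
  set T : Fin n → Finset (ℤ × ℤ) := fun k => if k ∈ U then
    Finset.Icc (-(Q : ℤ)) Q ×ˢ Finset.Icc (-(b (jj k) : ℤ)) (b (jj k)) else
    {0} ×ˢ Finset.Icc (-(Z : ℤ)) Z with hT
  have h1 := card_le_exp_mul_prod s T A (P := Real.pi * n) (by
    intro c hc
    obtain ⟨h1, h2, h3⟩ := hA c hc
    refine ⟨fun k => ?_, ?_⟩
    · simp only [hT]
      split_ifs with hk
      · rw [Finset.mem_product, Finset.mem_Icc, Finset.mem_Icc]
        exact ⟨abs_le.1 (h1 k hk).1, abs_le.1 (h1 k hk).2⟩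
      · rw [Finset.mem_product, Finset.mem_singleton, Finset.mem_Icc]
        exact ⟨(h2 k hk).1, abs_le.1 (h2 k hk).2⟩
    · have h4 : ∑ k, s k * ((c k).1 : ℝ) ^ 2 = ∑ k ∈ U, s k * ((c k).1 : ℝ) ^ 2 := by
        symm
        refine Finset.sum_subset (Finset.subset_univ _) fun k _ hk => ?_
        rw [(h2 k hk).1]; simp
      rw [h4, ← Finset.sum_fiberwise U jj]
      calc _ ≤ ∑ j : ι, Real.pi * m := by
            refine Finset.sum_le_sum fun j _ => ?_
            calc ∑ k ∈ U with jj k = j, s k * ((c k).1 : ℝ) ^ 2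
                = Real.pi * (m / R j) * ∑ k ∈ U with jj k = j, ((c k).1 : ℝ) ^ 2 := by
                  rw [Finset.mul_sum]
                  refine Finset.sum_congr rfl fun k hk => ?_
                  simp only [hs]
                  rw [(Finset.mem_filter.1 hk).2]
              _ ≤ Real.pi * (m / R j) * R j := by
                  have := Real.pi_pos
                  have := hR j
                  exact mul_le_mul_of_nonneg_left (h3 j) (by positivity)
              _ = Real.pi * m := by have := (hR j).ne'; field_simp
        _ = Real.pi * (Fintype.card ι * m : ℕ) := by simp; ring
        _ ≤ Real.pi * n := by
            refine mul_le_mul_of_nonneg_left ?_ Real.pi_pos.le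
            exact_mod_cast hmn)
  refine h1.trans (mul_le_mul_of_nonneg_left ?_ (Real.exp_pos _).le)
  rw [← Finset.prod_mul_prod_compl U, ← Finset.prod_const, ← Finset.prod_const]
  have hnn : ∀ k, 0 ≤ ∑ x ∈ T k, Real.exp (-(s k * (x.1 : ℝ) ^ 2)) := fun k =>
    Finset.sum_nonneg fun _ _ => (Real.exp_pos _).le
  refine mul_le_mul (Finset.prod_le_prod (fun k _ => hnn k) fun k hk => ?_)
    (Finset.prod_le_prod (fun k _ => hnn k) fun k hk => ?_)
    (Finset.prod_nonneg fun k _ => hnn k) (Finset.prod_nonneg fun k hk => ?_)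
  · have hTk : T k = Finset.Icc (-(Q : ℤ)) Q ×ˢ Finset.Icc (-(b (jj k) : ℤ)) (b (jj k)) := by
      simp only [hT, hk, if_true]
    rw [hTk, Finset.sum_product]
    have h5 := sum_exp_neg_sq_le (a := m / R (jj k)) (div_pos hm' (hR _)) Q
    rw [← Real.sqrt_inv, inv_div] at h5
    calc _ = (∑ q ∈ Finset.Icc (-(Q : ℤ)) Q, Real.exp (-(Real.pi * (m / R (jj k))) * (q : ℝ) ^ 2)) *
          (2 * b (jj k) + 1) := by
          rw [Finset.sum_mul]
          refine Finset.sum_congr rfl fun q _ => ?_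
          change ∑ _y ∈ Finset.Icc (-(b (jj k) : ℤ)) (b (jj k)), Real.exp (-(s k * (q : ℝ) ^ 2)) = _
          rw [Finset.sum_const, nsmul_eq_mul, mul_comm]
          have : ((Finset.Icc (-(b (jj k) : ℤ)) (b (jj k))).card : ℝ) = 2 * b (jj k) + 1 := by
            rw [Int.card_Icc, show (b (jj k) : ℤ) + 1 - -(b (jj k) : ℤ) = ((2 * b (jj k) + 1 : ℕ) : ℤ) by
              push_cast; ring, Int.toNat_natCast]
            push_cast; ring
          rw [this]
          simp only [hs, neg_mul]
      _ ≤ _ := by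
          refine le_trans ?_ (hF (jj k))
          exact mul_le_mul_of_nonneg_right h5 (by positivity)
  · have hk' := Finset.mem_compl.1 hk
    have hTk : T k = {0} ×ˢ Finset.Icc (-(Z : ℤ)) Z := by
      simp only [hT, hk', if_false]
    rw [hTk, Finset.sum_product, Finset.sum_singleton]
    have : ((Finset.Icc (-(Z : ℤ)) Z).card : ℝ) = 2 * Z + 1 := by
      rw [Int.card_Icc, show (Z : ℤ) + 1 - -(Z : ℤ) = ((2 * Z + 1 : ℕ) : ℤ) by
        push_cast; ring, Int.toNat_natCast]
      push_cast; ring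
    simp only [Int.cast_zero, ne_eq, OfNat.ofNat_ne_zero, not_false_eq_true, zero_pow, mul_zero,
      neg_zero, Real.exp_zero, Finset.sum_const, nsmul_eq_mul, mul_one, this, le_refl]
  · exact (by positivity : (0:ℝ) ≤ (1 + Real.sqrt (R (jj k) / m)) * (2 * b (jj k) + 1)).trans (hF _)

end SparseSpectrum

/-! ### Covering near-lattice vectors by mesh cells -/

namespace SparseSpectrum

/-- The number of cells of the mesh `η` met by near lattice vectors. -/
lemma exists_cover {n m : ℕ} {ι : Type*} [Fintype ι] [DecidableEq ι] (hm : 0 < m)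
    {J : ι → Finset (Fin n)} (hmn : Fintype.card ι * m ≤ n) (jj : Fin n → ι)
    (hjj : ∀ k j, k ∈ J j → k ∈ J (jj k)) {η β h D μ K F s : ℝ} {Z : ℕ}
    (hη : 0 < η) (hβ0 : 0 < β) (hh : 0 < h) (hD : 0 ≤ D) (hμ : 0 ≤ μ) (hK : 0 < K)
    (hβ : β * Real.sqrt (2 * D ^ 2 + 2 * K) ≤ η) (hF1 : 1 ≤ F)
    (hF : ∀ x y : ℝ, 0 ≤ x → x ≤ 2 * μ → 0 ≤ y → y ≤ D + 1 → x * (y - 1) ≤ 1 →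
      (1 + Real.sqrt ((2 * y ^ 2 + 2 * K) / m)) * (2 * ((x + β) * h / η + 3) + 1) ≤ F)
    (hs : ((Finset.univ.biUnion J)ᶜ.card : ℝ) + Fintype.card ι * K / h ^ 2 ≤ s)
    (hZ : 1 / η + 1 ≤ Z) :
    ∃ Λ : Finset (Fin n → ℤ), (Λ.card : ℝ) ≤ 2 ^ n *
        ((2 * μ / β + 1) * (D + 2)) ^ Fintype.card ι *
        (Real.exp (Real.pi * n) * (F ^ n * (2 * Z + 1) ^ ⌊s⌋₊)) ∧
      ∀ v : Fin n → ℝ, (∀ k, |v k| ≤ 1) → NearLattice J D μ K v → (fun k => ⌊v k / η⌋) ∈ Λ := by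
  classical
  set I : ℕ := ⌊2 * μ / β⌋₊ with hI
  set Q : ℕ := ⌈2 * D ^ 2 + 2 * K⌉₊ with hQ
  -- Radius of the correction box: the first term bounds `t w / η`. Of the 3, one unit is for
  -- rounding `t` to a multiple of `β` (by `hβ`), one for the difference of two floors, one for the
  -- floor in `b` itself.
  set b : (ι → ℕ) → ι → ℕ := fun i j => ⌊((i j : ℝ) * β + β) * h / η⌋₊ + 3 with hb
  -- Outer data: the regular coordinates, the scale in steps of `β`, and the rounded-up denominator.
  -- The last condition remembers `t θ ≤ 1`; without it the factor per coordinate would be quadratic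
  -- in `E`.
  set adm : Finset (Fin n) × (ι → ℕ) × (ι → ℕ) → Prop := fun o => (o.1ᶜ).card ≤ ⌊s⌋₊ ∧
    ∀ j, (o.2.1 j : ℝ) * β ≤ 2 * μ ∧ (o.2.2 j : ℝ) ≤ D + 1 ∧
      (o.2.1 j : ℝ) * β * (o.2.2 j - 1) ≤ 1 with hadm
  set 𝒪 : Finset (Finset (Fin n) × (ι → ℕ) × (ι → ℕ)) :=
    (Finset.univ ×ˢ (Fintype.piFinset fun _ => Finset.range (I + 1)) ×ˢ
      (Fintype.piFinset fun _ => Finset.range (⌈D⌉₊ + 1))).filter adm with h𝒪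
  set good : Finset (Fin n) × (ι → ℕ) × (ι → ℕ) → (Fin n → ℤ × ℤ) → Prop := fun o c =>
    (∀ k ∈ o.1, |(c k).1| ≤ Q ∧ |(c k).2| ≤ b o.2.1 (jj k)) ∧
      (∀ k ∉ o.1, (c k).1 = 0 ∧ |(c k).2| ≤ Z) ∧
      ∀ j, ∑ k ∈ o.1 with jj k = j, ((c k).1 : ℝ) ^ 2 ≤ 2 * (o.2.2 j : ℝ) ^ 2 + 2 * K with hgood
  set 𝒞 : Finset (Fin n) × (ι → ℕ) × (ι → ℕ) → Finset (Fin n → ℤ × ℤ) := fun o =>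
    (Fintype.piFinset fun k => Finset.Icc (-(Q : ℤ)) Q ×ˢ
      Finset.Icc (-((b o.2.1 (jj k) + Z : ℕ) : ℤ)) ((b o.2.1 (jj k) + Z : ℕ) : ℤ)).filter
        (good o) with h𝒞
  -- At a regular coordinate the code stores `q` and the offset of the cell of `v` from the cell of
  -- the rounded `t q`; at an exceptional one it stores the cell itself.
  set dec : Finset (Fin n) × (ι → ℕ) × (ι → ℕ) → (Fin n → ℤ × ℤ) → Fin n → ℤ := fun o c k =>
    if k ∈ o.1 then (c k).2 + ⌊(o.2.1 (jj k) : ℝ) * β * (c k).1 / η⌋ else (c k).2 with hdec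
  refine ⟨𝒪.biUnion fun o => (𝒞 o).image (dec o), ?_, ?_⟩
  · have hcodes : ∀ o ∈ 𝒪, ((𝒞 o).card : ℝ) ≤
        Real.exp (Real.pi * n) * (F ^ n * (2 * Z + 1) ^ ⌊s⌋₊) := by
      intro o ho
      obtain ⟨hcard, hj⟩ := (Finset.mem_filter.1 ho).2
      have h1 := card_codes_le hm hmn (jj := jj) (U := o.1)
        (R := fun j => 2 * (o.2.2 j : ℝ) ^ 2 + 2 * K) (fun j => by positivity) (b := b o.2.1)
        (F := F) (Q := Q) (Z := Z) (fun j => by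
          refine le_trans ?_ (hF (o.2.1 j * β) (o.2.2 j) (by positivity) (hj j).1 (by positivity)
            (hj j).2.1 (hj j).2.2)
          refine mul_le_mul_of_nonneg_left ?_ (by positivity)
          have := Nat.floor_le (by positivity : 0 ≤ ((o.2.1 j : ℝ) * β + β) * h / η)
          simp only [hb]
          push_cast
          linarith) (𝒞 o) fun c hc => (Finset.mem_filter.1 hc).2
      refine h1.trans (mul_le_mul_of_nonneg_left ?_ (Real.exp_pos _).le)
      have hU : o.1.card ≤ n := (Finset.card_le_univ _).trans_eq (Fintype.card_fin n)
      have hZ1 : (1 : ℝ) ≤ 2 * Z + 1 := by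
        have : (0 : ℝ) ≤ Z := Nat.cast_nonneg _
        linarith
      exact mul_le_mul (pow_le_pow_right₀ hF1 hU) (pow_le_pow_right₀ hZ1 hcard) (by positivity)
        (by positivity)
    have hcard𝒪 : (𝒪.card : ℝ) ≤ 2 ^ n * ((2 * μ / β + 1) * (D + 2)) ^ Fintype.card ι := by
      have h1 : 𝒪.card ≤ 2 ^ n * ((I + 1) ^ Fintype.card ι * (⌈D⌉₊ + 1) ^ Fintype.card ι) := by
        refine (Finset.card_filter_le _ _).trans_eq ?_
        rw [Finset.card_product, Finset.card_product, Fintype.card_piFinset,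
          Fintype.card_piFinset, Finset.prod_const, Finset.prod_const, Finset.card_range,
          Finset.card_range, Finset.card_univ, Finset.card_univ, Fintype.card_finset,
          Fintype.card_fin]
      have h2 : (I : ℝ) + 1 ≤ 2 * μ / β + 1 := by
        have := Nat.floor_le (by positivity : 0 ≤ 2 * μ / β)
        linarith
      have h3 : (⌈D⌉₊ : ℝ) + 1 ≤ D + 2 := by
        have := Nat.ceil_lt_add_one hD
        linarith
      calc (𝒪.card : ℝ) ≤ 2 ^ n * (((I : ℝ) + 1) ^ Fintype.card ι *
            ((⌈D⌉₊ : ℝ) + 1) ^ Fintype.card ι) := by exact_mod_cast h1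
        _ ≤ _ := by rw [mul_pow]; gcongr
    calc _ ≤ ((∑ o ∈ 𝒪, (𝒞 o).card : ℕ) : ℝ) := by
          exact_mod_cast Finset.card_biUnion_le.trans
            (Finset.sum_le_sum fun o _ => Finset.card_image_le)
      _ = ∑ o ∈ 𝒪, ((𝒞 o).card : ℝ) := by push_cast; rfl
      _ ≤ ∑ o ∈ 𝒪, Real.exp (Real.pi * n) * (F ^ n * (2 * Z + 1) ^ ⌊s⌋₊) :=
          Finset.sum_le_sum hcodes
      _ = 𝒪.card * (Real.exp (Real.pi * n) * (F ^ n * (2 * Z + 1) ^ ⌊s⌋₊)) := by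
          rw [Finset.sum_const, nsmul_eq_mul]
      _ ≤ _ := by gcongr
  · intro v hv1 hv
    choose θ t q w hθ0 hθD ht0 htμ htθ hvk hw hq using hv
    set i : ι → ℕ := fun j => ⌊t j / β⌋₊ with hi
    set R : ι → ℕ := fun j => ⌈θ j⌉₊ with hR
    set U : Finset (Fin n) := Finset.univ.filter fun k => k ∈ J (jj k) ∧ |w (jj k) k| ≤ h with hU
    set c : Fin n → ℤ × ℤ := fun k => if k ∈ U then
      (q (jj k) k, ⌊v k / η⌋ - ⌊(i (jj k) : ℝ) * β * q (jj k) k / η⌋) else (0, ⌊v k / η⌋) with hc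
    have hib : ∀ j, (i j : ℝ) * β ≤ t j := fun j => by
      have := Nat.floor_le (div_nonneg (ht0 j) hβ0.le)
      rwa [le_div_iff₀ hβ0] at this
    have hib' : ∀ j, t j ≤ (i j : ℝ) * β + β := fun j => by
      have := (Nat.lt_floor_add_one (t j / β)).le
      rw [div_le_iff₀ hβ0] at this
      linarith
    have hRθ : ∀ j, θ j ≤ R j := fun j => Nat.le_ceil _
    have hRθ' : ∀ j, (R j : ℝ) ≤ θ j + 1 := fun j => (Nat.ceil_lt_add_one (hθ0 j).le).le
    have hqD : ∀ j, ∀ k ∈ J j, (q j k : ℝ) ^ 2 ≤ 2 * D ^ 2 + 2 * K := by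
      intro j k hk
      have h1 := Finset.single_le_sum (f := fun k => (q j k : ℝ) ^ 2) (fun k _ => sq_nonneg _) hk
      have h2 : θ j ^ 2 ≤ D ^ 2 := pow_le_pow_left₀ (hθ0 j).le (hθD j) 2
      have := hq j
      linarith
    have hUJ : ∀ k ∈ U, k ∈ J (jj k) ∧ |w (jj k) k| ≤ h := fun k hk => (Finset.mem_filter.1 hk).2
    have hz1 : ∀ k, |⌊v k / η⌋| ≤ (Z : ℤ) := by
      intro k
      have h1 := abs_floor_sub_floor_le (v k / η) 0
      simp only [Int.floor_zero, sub_zero] at h1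
      have h2 : |v k / η| ≤ 1 / η := by
        rw [abs_div, abs_of_pos hη]
        exact div_le_div_of_nonneg_right (hv1 k) hη.le
      have h3 : ((|⌊v k / η⌋| : ℤ) : ℝ) ≤ ((Z : ℤ) : ℝ) := by
        rw [Int.cast_abs]; push_cast; linarith
      exact_mod_cast h3
    have hgoodc : good (U, i, R) c := by
      refine ⟨fun k hk => ?_, fun k hk => ?_, fun j => ?_⟩
      · obtain ⟨hkJ, hkw⟩ := hUJ k hk
        have hck : c k = (q (jj k) k, ⌊v k / η⌋ - ⌊(i (jj k) : ℝ) * β * q (jj k) k / η⌋) := by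
          simp only [hc, hk, if_true]
        have hq1 := hqD (jj k) k hkJ
        rw [hck]
        constructor
        · have h1 : ((|q (jj k) k| : ℤ) : ℝ) ≤ ((Q : ℤ) : ℝ) := by
            have h2 : |q (jj k) k| ≤ q (jj k) k ^ 2 := by
              rw [← sq_abs]
              rcases (abs_nonneg (q (jj k) k)).eq_or_lt with h | h
              · rw [← h]; norm_num
              · nlinarith
            have h3 : ((|q (jj k) k| : ℤ) : ℝ) ≤ (q (jj k) k : ℝ) ^ 2 := by exact_mod_cast h2
            have h4 := Nat.le_ceil (2 * D ^ 2 + 2 * K)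
            push_cast at *
            linarith
          exact_mod_cast h1
        · have h1 := abs_floor_sub_floor_le (v k / η) ((i (jj k) : ℝ) * β * q (jj k) k / η)
          have h2 : |v k / η - (i (jj k) : ℝ) * β * q (jj k) k / η| ≤
              ((i (jj k) : ℝ) * β + β) * h / η + 1 := by
            rw [← sub_div, abs_div, abs_of_pos hη, div_add_one hη.ne']
            refine div_le_div_of_nonneg_right ?_ hη.le
            rw [hvk (jj k) k hkJ]
            have e : t (jj k) * (q (jj k) k + w (jj k) k) - i (jj k) * β * q (jj k) k =
                t (jj k) * w (jj k) k + (t (jj k) - i (jj k) * β) * q (jj k) k := by ring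
            rw [e]
            refine (abs_add_le _ _).trans ?_
            rw [abs_mul, abs_mul, abs_of_nonneg (ht0 _), abs_of_nonneg (sub_nonneg.2 (hib _))]
            have h3 : |(q (jj k) k : ℝ)| ≤ Real.sqrt (2 * D ^ 2 + 2 * K) := Real.abs_le_sqrt hq1
            have h4 : t (jj k) * |w (jj k) k| ≤ ((i (jj k) : ℝ) * β + β) * h :=
              mul_le_mul (hib' _) hkw (abs_nonneg _) (by positivity)
            have h5 : (t (jj k) - i (jj k) * β) * |(q (jj k) k : ℝ)| ≤
                β * Real.sqrt (2 * D ^ 2 + 2 * K) :=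
              mul_le_mul (by linarith [hib' (jj k)]) h3 (abs_nonneg _) hβ0.le
            linarith
          have h3 := (Nat.lt_floor_add_one (((i (jj k) : ℝ) * β + β) * h / η)).le
          have h4 : ((|⌊v k / η⌋ - ⌊(i (jj k) : ℝ) * β * q (jj k) k / η⌋| : ℤ) : ℝ) ≤
              ((b i (jj k) : ℤ) : ℝ) := by
            rw [Int.cast_abs]
            simp only [hb]
            push_cast at *
            linarith
          exact_mod_cast h4
      · have hck : c k = (0, ⌊v k / η⌋) := by simp only [hc]; rw [if_neg hk]
        rw [hck]
        exact ⟨rfl, hz1 k⟩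
      · calc ∑ k ∈ U with jj k = j, ((c k).1 : ℝ) ^ 2
            = ∑ k ∈ U with jj k = j, (q j k : ℝ) ^ 2 := by
              refine Finset.sum_congr rfl fun k hk => ?_
              obtain ⟨h1, h2⟩ := Finset.mem_filter.1 hk
              simp only [hc, h1, if_true, h2]
          _ ≤ ∑ k ∈ J j, (q j k : ℝ) ^ 2 := by
              refine Finset.sum_le_sum_of_subset_of_nonneg (fun k hk => ?_) fun _ _ _ => sq_nonneg _
              obtain ⟨h1, h2⟩ := Finset.mem_filter.1 hk
              exact h2 ▸ (hUJ k h1).1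
          _ ≤ 2 * θ j ^ 2 + 2 * K := hq j
          _ ≤ 2 * (R j : ℝ) ^ 2 + 2 * K := by
              have := pow_le_pow_left₀ (hθ0 j).le (hRθ j) 2
              linarith
    rw [Finset.mem_biUnion]
    refine ⟨(U, i, R), ?_, Finset.mem_image.2 ⟨c, ?_, ?_⟩⟩
    · rw [h𝒪, Finset.mem_filter, Finset.mem_product, Finset.mem_product]
      refine ⟨⟨Finset.mem_univ _, Fintype.mem_piFinset.2 fun j => ?_,
        Fintype.mem_piFinset.2 fun j => ?_⟩, ?_, fun j => ⟨(hib j).trans (htμ j),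
          (hRθ' j).trans (by linarith [hθD j]), ?_⟩⟩
      · rw [Finset.mem_range, Nat.lt_succ_iff]
        exact Nat.floor_le_floor (div_le_div_of_nonneg_right (htμ j) hβ0.le)
      · rw [Finset.mem_range, Nat.lt_succ_iff]
        exact Nat.ceil_le_ceil (hθD j)
      · refine Nat.le_floor (le_trans ?_ hs)
        have h1 : Uᶜ ⊆ (Finset.univ.biUnion J)ᶜ ∪
            Finset.univ.filter fun k => k ∈ J (jj k) ∧ h < |w (jj k) k| := by
          intro k hk
          rw [Finset.mem_union]
          by_cases h1 : ∃ j, k ∈ J j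
          · right
            obtain ⟨j, hj⟩ := h1
            refine Finset.mem_filter.2 ⟨Finset.mem_univ _, hjj k j hj, ?_⟩
            by_contra h2
            exact Finset.mem_compl.1 hk (Finset.mem_filter.2 ⟨Finset.mem_univ _, hjj k j hj,
              not_lt.1 h2⟩)
          · left
            rw [Finset.mem_compl, Finset.mem_biUnion]
            rintro ⟨j, -, hj⟩
            exact h1 ⟨j, hj⟩
        have h2 := card_large_le hh hw (jj := jj)
          (Finset.univ.filter fun k => k ∈ J (jj k) ∧ h < |w (jj k) k|)
          fun k hk => (Finset.mem_filter.1 hk).2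
        have h3 : ((Uᶜ).card : ℝ) ≤ ((Finset.univ.biUnion J)ᶜ.card : ℝ) +
            ((Finset.univ.filter fun k => k ∈ J (jj k) ∧ h < |w (jj k) k|).card : ℝ) := by
          exact_mod_cast (Finset.card_le_card h1).trans (Finset.card_union_le _ _)
        exact h3.trans (by linarith)
      · rcases le_total ((R j : ℝ) - 1) 0 with h1 | h1
        · have : (i j : ℝ) * β * (R j - 1) ≤ 0 := mul_nonpos_of_nonneg_of_nonpos (by positivity) h1
          exact this.trans zero_le_one
        · calc (i j : ℝ) * β * (R j - 1) ≤ t j * θ j :=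
                mul_le_mul (hib j) (by linarith [hRθ' j]) h1 (ht0 j)
            _ ≤ 1 := htθ j
    · rw [h𝒞, Finset.mem_filter]
      refine ⟨Fintype.mem_piFinset.2 fun k => ?_, hgoodc⟩
      rw [Finset.mem_product, Finset.mem_Icc, Finset.mem_Icc, ← abs_le, ← abs_le]
      by_cases hk : k ∈ U
      · obtain ⟨h1, h2⟩ := hgoodc.1 k hk
        refine ⟨h1, h2.trans ?_⟩
        push_cast; linarith [Int.natCast_nonneg Z]
      · obtain ⟨h1, h2⟩ := hgoodc.2.1 k hk
        rw [h1]
        refine ⟨by simp, h2.trans ?_⟩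
        push_cast; linarith [Int.natCast_nonneg (b i (jj k))]
    · ext k
      by_cases hk : k ∈ U
      · have hk' : k ∈ (U, i, R).1 := hk
        simp only [hdec, hc, hk, if_true]
        ring
      · simp only [hdec, hc, hk, if_false]

end SparseSpectrum

namespace SparseSpectrum

/-! ### Union bound over the rounded vectors -/

lemma rowForm_eq_sum {n : ℕ} (lam : ℝ) (x : Fin n → ℝ) (i : Fin n) (w : UpperIndex n → ℝ) :
    rowForm lam x i w = ∑ k, (symMat w i k - if i = k then lam else 0) * x k := by
  unfold rowForm
  simp only [sub_mul, Finset.sum_sub_distrib, ite_mul, zero_mul, Finset.sum_ite_eq,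
    Finset.mem_univ, if_true]

lemma sum_symMat_sub_sq_le {n : ℕ} (lam : ℝ) (w : UpperIndex n → ℝ) :
    ∑ k, ∑ i, (symMat w i k - if i = k then lam else 0) ^ 2 ≤
      4 * ∑ e, w e ^ 2 + 2 * lam ^ 2 * n := by
  rw [Finset.sum_comm]
  calc ∑ i, ∑ k, (symMat w i k - if i = k then lam else 0) ^ 2
      ≤ ∑ i, ∑ k, (2 * symMat w i k ^ 2 + if i = k then 2 * lam ^ 2 else 0) := by
        refine Finset.sum_le_sum fun i _ => Finset.sum_le_sum fun k _ => ?_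
        split_ifs
        · nlinarith [sq_nonneg (symMat w i k + lam)]
        · nlinarith [sq_nonneg (symMat w i k)]
    _ = 2 * ∑ i, ∑ k, symMat w i k ^ 2 + 2 * lam ^ 2 * n := by
        simp only [Finset.sum_add_distrib, Finset.mul_sum, Finset.sum_ite_eq, Finset.mem_univ,
          if_true, Finset.sum_const, Finset.card_univ, Fintype.card_fin, nsmul_eq_mul]
        ring
    _ ≤ _ := by linarith [sum_symMat_sq_le w]

/-- A union bound over the roundings of the vectors of `V` to a mesh, where the error is
controlled by the Hilbert-Schmidt norm. -/
lemma measure_exists_small_le {n : ℕ} (π : Measure (UpperIndex n → ℝ)) {V : Set (Fin n → ℝ)}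
    {lam η t T H : ℝ} (hη : 0 < η) {P : ENNReal} (Λ : Finset (Fin n → ℤ))
    (hΛ : ∀ v ∈ V, (fun k => ⌊v k / η⌋) ∈ Λ)
    (hP : ∀ v ∈ V, ∀ v' : Fin n → ℝ, (∀ k, |v' k - v k| ≤ η) →
      π {w | ∑ i, rowForm lam v' i w ^ 2 ≤ t ^ 2 * n} ≤ P)
    (ht : 2 * T ^ 2 + 2 * (η ^ 2 * (4 * H + 2 * lam ^ 2 * n)) ≤ t ^ 2 * n) :
    π {w | ∃ v ∈ V, ∑ i, rowForm lam v i w ^ 2 ≤ T ^ 2} ≤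
      π {w | H ≤ ∑ e, w e ^ 2} + ((Λ.card * 2 ^ n : ℕ) : ENNReal) * P := by
  classical
  -- A net point is a cell together with a corner of it, whence the factor `2^n`.
  set pt : (Fin n → ℤ) × (Fin n → Bool) → Fin n → ℝ :=
    fun z k => η * (z.1 k + if z.2 k then 1 else 0) with hpt
  -- Only corners within `η` of an actual vector of `V` are kept, since the small ball bound is
  -- available only near `V`.
  set G : Finset ((Fin n → ℤ) × (Fin n → Bool)) :=
    (Λ ×ˢ Finset.univ).filter fun z => ∃ v ∈ V, ∀ k, |pt z k - v k| ≤ η with hG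
  have hsub : {w | ∃ v ∈ V, ∑ i, rowForm lam v i w ^ 2 ≤ T ^ 2} ⊆
      {w | H ≤ ∑ e, w e ^ 2} ∪ ⋃ z ∈ G, {w | ∑ i, rowForm lam (pt z) i w ^ 2 ≤ t ^ 2 * n} := by
    rintro w ⟨v, hv, hw⟩
    by_cases hH : H ≤ ∑ e, w e ^ 2
    · exact Or.inl hH
    right
    rw [not_le] at hH
    have hf : ∀ k, v k / η - ⌊v k / η⌋ ∈ Set.Icc (0 : ℝ) 1 := fun k =>
      ⟨Int.fract_nonneg _, (Int.fract_lt_one _).le⟩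
    obtain ⟨s, hs, hle⟩ := exists_rounding
      (fun i k => symMat w i k - if i = k then lam else 0) _ hf Finset.univ
    set z : (Fin n → ℤ) × (Fin n → Bool) := (fun k => ⌊v k / η⌋, fun k => decide (s k = 1)) with hz
    have hptz : ∀ k, pt z k = η * (⌊v k / η⌋ + s k) := by
      intro k
      simp only [hpt, hz, decide_eq_true_eq]
      rcases hs k with h | h <;> rw [h] <;> simp
    have hvk : ∀ k, v k = η * (⌊v k / η⌋ + (v k / η - ⌊v k / η⌋)) := by
      intro k; field_simp; ring
    have hnear : ∀ k, |pt z k - v k| ≤ η := by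
      intro k
      have : pt z k - v k = η * (s k - (v k / η - ⌊v k / η⌋)) := by
        rw [hptz]; nth_rewrite 2 [hvk k]; ring
      rw [this, abs_mul, abs_of_pos hη]
      have h1 : |s k - (v k / η - ⌊v k / η⌋)| ≤ 1 := by
        rw [abs_le]
        rcases hs k with h | h <;> rw [h] <;> constructor <;> linarith [(hf k).1, (hf k).2]
      nlinarith
    have hzG : z ∈ G := by
      rw [hG, Finset.mem_filter, Finset.mem_product]
      exact ⟨⟨hΛ v hv, Finset.mem_univ _⟩, v, hv, hnear⟩
    refine Set.mem_biUnion hzG ?_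
    change ∑ i, rowForm lam (pt z) i w ^ 2 ≤ t ^ 2 * n
    have hrow : ∀ i, rowForm lam (pt z) i w = rowForm lam v i w -
        η * ∑ k, (symMat w i k - if i = k then lam else 0) * (v k / η - ⌊v k / η⌋ - s k) := by
      intro i
      rw [rowForm_eq_sum, rowForm_eq_sum, Finset.mul_sum, ← Finset.sum_sub_distrib]
      refine Finset.sum_congr rfl fun k _ => ?_
      rw [hptz]
      have := hvk k
      generalize (symMat w i k - if i = k then lam else 0) = A
      have e : η * (v k / η) = v k := by field_simp
      linear_combination A * e
    have h1 : ∑ i, rowForm lam (pt z) i w ^ 2 ≤ 2 * ∑ i, rowForm lam v i w ^ 2 +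
        2 * (η ^ 2 * ∑ i, (∑ k, (symMat w i k - if i = k then lam else 0) *
          (v k / η - ⌊v k / η⌋ - s k)) ^ 2) := by
      rw [Finset.mul_sum, Finset.mul_sum, Finset.mul_sum, ← Finset.sum_add_distrib]
      refine Finset.sum_le_sum fun i _ => ?_
      rw [hrow i]
      generalize rowForm lam v i w = A
      generalize (∑ k, (symMat w i k - if i = k then lam else 0) *
          (v k / η - ⌊v k / η⌋ - s k)) = A'
      nlinarith [sq_nonneg (A + η * A')]
    have h2 := hle.trans (sum_symMat_sub_sq_le lam w)
    have h3 : η ^ 2 * ∑ i, (∑ k, (symMat w i k - if i = k then lam else 0) *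
          (v k / η - ⌊v k / η⌋ - s k)) ^ 2 ≤ η ^ 2 * (4 * H + 2 * lam ^ 2 * n) :=
      mul_le_mul_of_nonneg_left (h2.trans (by linarith)) (sq_nonneg _)
    linarith
  refine (measure_mono hsub).trans ((measure_union_le _ _).trans (add_le_add le_rfl ?_))
  refine (measure_biUnion_finset_le _ _).trans ?_
  calc ∑ z ∈ G, π {w | ∑ i, rowForm lam (pt z) i w ^ 2 ≤ t ^ 2 * n} ≤ ∑ z ∈ G, P := by
        refine Finset.sum_le_sum fun z hz => ?_
        obtain ⟨v, hv, hn⟩ := (Finset.mem_filter.1 hz).2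
        exact hP v hv _ hn
    _ = G.card * P := by rw [Finset.sum_const, nsmul_eq_mul]
    _ ≤ _ := by
        gcongr
        refine (Finset.card_filter_le _ _).trans_eq ?_
        rw [Finset.card_product, Finset.card_univ]
        simp

/-! ### The structure of the vectors of a level set -/

section LevelSet

variable {n : ℕ} {M ρ : ℝ} {m : ℕ} {v : EuclideanSpace ℝ (Fin n)}
  {σ τ' : EuclideanSpace ℝ (Fin n) → Finset (Fin n)}

lemma norm_restrict_sq (v : EuclideanSpace ℝ (Fin n)) (J : Finset (Fin n)) :
    ‖restrict v J‖ ^ 2 = ∑ k ∈ J, v k ^ 2 := by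
  rw [EuclideanSpace.norm_sq_eq]
  simp only [restrict, Real.norm_eq_abs, sq_abs]
  exact Finset.sum_coe_sort J fun k => v k ^ 2

lemma norm_restrict_le (v : EuclideanSpace ℝ (Fin n)) (J : Finset (Fin n)) :
    ‖restrict v J‖ ≤ ‖v‖ := by
  rw [← sq_le_sq₀ (norm_nonneg _) (norm_nonneg _), norm_restrict_sq, EuclideanSpace.norm_sq_eq]
  simp only [Real.norm_eq_abs, sq_abs]
  exact Finset.sum_le_sum_of_subset_of_nonneg (Finset.subset_univ _) fun _ _ _ => sq_nonneg _

/-- Elements of `σ` satisfy this by choice. Any other element lies outside the `⌊M⌋` largest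
coordinates, so together with them it gives `⌊M⌋ + 1` squares at least `(v k)²` with sum at most 1.
-/
lemma abs_le_of_mem_block (hM : 0 < M) (hv : v ∈ Incomp n M ρ) (hσ : IsSpreadChoice M ρ σ)
    (hτ : IsTopChoice M ρ τ') {j : ℕ} {k : Fin n} (hk : k ∈ block M ρ m (σ v) (τ' v) j) :
    |v k| ≤ 1 / Real.sqrt M := by
  rcases Finset.mem_union.1 hk with h | h
  · exact ((hσ v hv).1 k (chunk_subset _ _ _ h)).2
  · have h1 := chunk_subset _ _ _ h
    rw [Finset.mem_compl, Finset.mem_union, Finset.mem_sdiff] at h1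
    have h2 : k ∉ τ' v := by tauto
    obtain ⟨h3, h4⟩ := hτ v hv
    rw [le_div_iff₀ (Real.sqrt_pos.2 hM), ← abs_of_nonneg (Real.sqrt_nonneg M), ← abs_mul]
    rw [← sq_le_one_iff_abs_le_one, mul_pow, Real.sq_sqrt hM.le]
    have h5 : ∑ i ∈ insert k (τ' v), v k ^ 2 ≤ 1 := by
      calc ∑ i ∈ insert k (τ' v), v k ^ 2 ≤ ∑ i ∈ insert k (τ' v), v i ^ 2 := by
            refine Finset.sum_le_sum fun i hi => ?_
            rcases Finset.mem_insert.1 hi with rfl | hi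
            · exact le_rfl
            · exact sq_le_sq.2 (h4 i hi k h2)
        _ ≤ ∑ i, v i ^ 2 := Finset.sum_le_sum_of_subset_of_nonneg (Finset.subset_univ _)
            fun _ _ _ => sq_nonneg _
        _ = ‖v‖ ^ 2 := by
            rw [EuclideanSpace.norm_sq_eq]; simp
        _ = 1 := by rw [hv.1]; norm_num
    rw [Finset.sum_const, Finset.card_insert_of_notMem h2, h3, nsmul_eq_mul] at h5
    have h6 := (Nat.lt_floor_add_one M).le
    push_cast at h5
    nlinarith [sq_nonneg (v k)]

/-- Each block holds its share of `σ`, and every coordinate of `σ` has square at least `ρ²/(2n)`. -/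
lemma le_norm_restrict_sq (hM : 0 < M) (hρ : 0 < ρ) (hv : v ∈ Incomp n M ρ)
    (hσ : IsSpreadChoice M ρ σ) {j : ℕ} (hj : j < blockCount m (σ v) (τ' v)) {Y : ℝ}
    (hY : (blockCount m (σ v) (τ' v) : ℝ) ≤ Y) (hY2 : 4 * Y ^ 2 ≤ M * ρ ^ 2) :
    M * ρ ^ 4 / (8 * n * Y) ≤ ‖restrict v (block M ρ m (σ v) (τ' v) j)‖ ^ 2 := by
  set k₀ := blockCount m (σ v) (τ' v) with hk₀
  set a := blockSpread M ρ m (σ v) (τ' v) with ha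
  set c₀ := M * ρ ^ 2 / 2 with hc₀
  have hk0 : (1 : ℝ) ≤ k₀ := by exact_mod_cast (Nat.zero_le j).trans_lt hj
  have hj1 : (j : ℝ) + 1 ≤ k₀ := by exact_mod_cast hj
  have hY0 : 0 < Y := by linarith
  have hn : 0 < n := ((Nat.zero_le j).trans_lt hj).trans_le
    ((Nat.div_le_self _ _).trans (Nat.sub_le _ _))
  have hn' : (0 : ℝ) < n := by exact_mod_cast hn
  have hσc : c₀ ≤ ((σ v).card : ℝ) := by
    rw [(hσ v hv).2]; exact Nat.le_ceil _
  have ha1 : c₀ / k₀ ≤ a := by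
    rw [ha, blockSpread, hc₀, div_div]; exact Nat.le_ceil _
  have ha2 : (a : ℝ) ≤ c₀ / k₀ + 1 := by
    rw [ha, blockSpread, hc₀, div_div]
    exact (Nat.ceil_lt_add_one (by positivity)).le
  -- Rounding the share up may exhaust `σ` before the last block; the deficit is at most `k₀`, which
  -- `hY2` makes at most half of the share.
  have hcard : c₀ / k₀ - k₀ ≤ ((chunk (σ v) (j * a) ((j + 1) * a)).card : ℝ) := by
    rw [card_chunk]
    have h1 : c₀ / k₀ - k₀ + (j * a : ℕ) ≤ (min ((j + 1) * a) (σ v).card : ℕ) := by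
      rw [Nat.cast_min, le_min_iff]
      push_cast
      constructor
      · linarith
      · have h2 : (j : ℝ) * a ≤ (k₀ - 1) * (c₀ / k₀ + 1) := by gcongr; linarith
        have h3 : (k₀ - 1) * (c₀ / k₀ + 1) = c₀ - c₀ / k₀ + k₀ - 1 := by field_simp; ring
        linarith
    have h4 : ((min ((j + 1) * a) (σ v).card : ℕ) : ℝ) ≤
        ((min ((j + 1) * a) (σ v).card - j * a : ℕ) : ℝ) + (j * a : ℕ) := by
      exact_mod_cast le_tsub_add
    linarith
  have hcard2 : M * ρ ^ 2 / (4 * Y) ≤ c₀ / k₀ - k₀ := by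
    have h1 : c₀ / Y ≤ c₀ / k₀ := by gcongr
    have h2 : c₀ / Y = M * ρ ^ 2 / (4 * Y) + M * ρ ^ 2 / (4 * Y) := by
      rw [hc₀]; field_simp; norm_num
    have h3 : Y ≤ M * ρ ^ 2 / (4 * Y) := by
      rw [le_div_iff₀ (by positivity)]; linarith
    linarith
  rw [norm_restrict_sq]
  calc M * ρ ^ 4 / (8 * n * Y) = M * ρ ^ 2 / (4 * Y) * (ρ ^ 2 / (2 * n)) := by field_simp; norm_num
    _ ≤ ((chunk (σ v) (j * a) ((j + 1) * a)).card : ℝ) * (ρ ^ 2 / (2 * n)) := by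
        gcongr; linarith
    _ = ∑ k ∈ chunk (σ v) (j * a) ((j + 1) * a), ρ ^ 2 / (2 * n) := by simp
    _ ≤ ∑ k ∈ chunk (σ v) (j * a) ((j + 1) * a), v k ^ 2 := by
        refine Finset.sum_le_sum fun k hk => ?_
        have h1 := ((hσ v hv).1 k (chunk_subset _ _ _ hk)).1
        rw [← sq_abs (v k)]
        refine le_trans ?_ (pow_le_pow_left₀ (by positivity) h1 2)
        rw [div_pow, Real.sq_sqrt (by positivity)]
    _ ≤ _ := Finset.sum_le_sum_of_subset_of_nonneg (chunk_subset_block _ _ _ _ _ _)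
        fun _ _ _ => sq_nonneg _

lemma nearLattice_blocks (hM : 0 < M) (hv : v ∈ Incomp n M ρ) (hσ : IsSpreadChoice M ρ σ)
    (hτ : IsTopChoice M ρ τ') {δ₀ p α D Kb : ℝ} (ha : 0 < δ₀ * p) (hD : 0 < D)
    (hm : m = ⌈α * n⌉₊)
    (hreg : regLCD δ₀ p M ρ α (σ v) (τ' v) v ≤ 2 * D)
    (hK : Real.posLog (Real.sqrt (δ₀ * p) * (3 * D)) ≤ δ₀ * p * Kb) :
    NearLattice (fun j : Fin (blockCount m (σ v) (τ' v)) => block M ρ m (σ v) (τ' v) j) (3 * D)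
      (1 / Real.sqrt M) Kb v := by
  subst hm
  intro j
  set J := block M ρ ⌈α * n⌉₊ (σ v) (τ' v) j with hJ
  -- `3D` instead of `2D` makes the inequality strict, so that a denominator can be extracted from
  -- the infimum.
  have h1 : lcd δ₀ p (‖restrict v J‖⁻¹ • restrict v J) < 3 * D := by
    have h2 := le_ciSup (f := fun j : Fin (blockCount ⌈α * n⌉₊ (σ v) (τ' v)) =>
      lcd δ₀ p (‖restrict v (block M ρ ⌈α * n⌉₊ (σ v) (τ' v) j)‖⁻¹ •
        restrict v (block M ρ ⌈α * n⌉₊ (σ v) (τ' v) j))) (Set.finite_range _).bddAbove j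
    have h3 : lcd δ₀ p (‖restrict v J‖⁻¹ • restrict v J) ≤ 2 * D := h2.trans hreg
    linarith
  obtain ⟨θ, hθ0, hθ, hlt⟩ := exists_denominator ha h1
  have h4 : ∑ k : J, distInt (θ * (‖restrict v J‖⁻¹ • restrict v J) k) ^ 2 =
      ∑ k ∈ J, distInt (θ * (‖restrict v J‖⁻¹ * v k)) ^ 2 :=
    Finset.sum_coe_sort J fun k => distInt (θ * (‖restrict v J‖⁻¹ * v k)) ^ 2
  rw [h4] at hlt
  obtain ⟨t, q, w, ht0, htμ, htθ, hvk, hw, hq⟩ := exists_lattice_approx (v := v) ha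
    (norm_nonneg _) (norm_restrict_sq v J) (by positivity)
    (fun k hk => abs_le_of_mem_block hM hv hσ hτ hk) hθ0 hθ hlt
  have hwK : ∑ k ∈ J, w k ^ 2 ≤ Kb := by
    have := hw.trans hK
    exact le_of_mul_le_mul_left this ha
  refine ⟨θ, t, q, w, hθ0, hθ.le, ht0, htμ, ?_, hvk, hwK, by linarith⟩
  rw [htθ]
  exact (norm_restrict_le v J).trans_eq hv.1

lemma exists_block_lcdAtLeast {δ₀ p α D : ℝ} (ha : 0 < δ₀ * p) (hD : 0 < D)
    (hm : m = ⌈α * n⌉₊) (hreg : D ≤ regLCD δ₀ p M ρ α (σ v) (τ' v) v) :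
    ∃ j < blockCount m (σ v) (τ' v), LCDAtLeast (δ₀ * p) D
      fun k : block M ρ m (σ v) (τ' v) j => v k / ‖restrict v (block M ρ m (σ v) (τ' v) j)‖ := by
  subst hm
  -- With no block the supremum would take the default value 0, which is less than `D`.
  have hne : Nonempty (Fin (blockCount ⌈α * n⌉₊ (σ v) (τ' v))) := by
    by_contra hc
    rw [not_nonempty_iff] at hc
    rw [regLCD, Real.iSup_of_isEmpty] at hreg
    linarith
  obtain ⟨j, hj⟩ := exists_eq_ciSup_of_finite
    (f := fun j : Fin (blockCount ⌈α * n⌉₊ (σ v) (τ' v)) =>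
      lcd δ₀ p (‖restrict v (block M ρ ⌈α * n⌉₊ (σ v) (τ' v) j)‖⁻¹ •
        restrict v (block M ρ ⌈α * n⌉₊ (σ v) (τ' v) j)))
  refine ⟨j, j.2, ?_⟩
  rw [regLCD, ← hj] at hreg
  have h := lcdAtLeast_of_le ha hreg
  intro θ h0 hθ
  refine (h θ h0 hθ).trans_eq ?_
  congr 2; ext k
  congr 3
  change _ = v k / ‖restrict v (block M ρ ⌈α * n⌉₊ (σ v) (τ' v) j)‖
  rw [div_eq_inv_mul]; rfl

end LevelSet

end SparseSpectrum

/-! ### Cover of the level set and the union bound -/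

namespace SparseSpectrum

/-- The zero vector is sparse and at distance 1 from every unit vector. -/
lemma rho_lt_one_of_mem_incomp {n : ℕ} {M ρ : ℝ} (hM : 0 ≤ M) {v : EuclideanSpace ℝ (Fin n)}
    (hv : v ∈ Incomp n M ρ) : ρ < 1 := by
  by_contra hc
  refine hv.2 ⟨hv.1, 0, ?_, ?_⟩
  · simpa [Sparse] using hM
  · rw [sub_zero, hv.1]; exact not_lt.1 hc

section Cover

variable {n m : ℕ} {M ρ α a D Y Kb h η β F s g : ℝ} {Z : ℕ}

/-- Numerical relations between the parameters of the cover of a level set. -/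
structure CoverParams (n m : ℕ) (M ρ α a D Y Kb h η β F s g : ℝ) (Z : ℕ) : Prop where
  n_pos : 0 < n
  M_pos : 0 < M
  rho_pos : 0 < ρ
  alpha_pos : 0 < α
  m_eq : m = ⌈α * n⌉₊
  a_pos : 0 < a
  D_pos : 0 < D
  one_le_alpha_mul : 1 ≤ α * Y
  Y_sq_le : 4 * Y ^ 2 ≤ M * ρ ^ 2
  Kb_pos : 0 < Kb
  posLog_le : Real.posLog (Real.sqrt a * (3 * D)) ≤ a * Kb
  h_pos : 0 < h
  eta_pos : 0 < η
  beta_pos : 0 < β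
  beta_mul_le : β * Real.sqrt (2 * (3 * D) ^ 2 + 2 * Kb) ≤ η
  one_le_F : 1 ≤ F
  le_F : ∀ x y : ℝ, 0 ≤ x → x ≤ 2 * (1 / Real.sqrt M) → 0 ≤ y → y ≤ 3 * D + 1 →
    x * (y - 1) ≤ 1 →
    (1 + Real.sqrt ((2 * y ^ 2 + 2 * Kb) / m)) * (2 * ((x + β) * h / η + 3) + 1) ≤ F
  le_s : M + α * n + 2 + Y * Kb / h ^ 2 ≤ s
  le_Z : 1 / η + 1 ≤ Z
  base_le : (2 * (1 / Real.sqrt M) / β + 1) * (3 * D + 2) ≤ Real.exp g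
  Z_le : 2 * (Z : ℝ) + 1 ≤ Real.exp g
  g_nonneg : 0 ≤ g
  g_mul_Y : g * Y ≤ n
  g_mul_s : g * s ≤ n

namespace CoverParams

lemma m_pos (hp : CoverParams n m M ρ α a D Y Kb h η β F s g Z) : 0 < m := by
  rw [hp.m_eq, Nat.ceil_pos]
  have := hp.alpha_pos
  have : (0 : ℝ) < n := by exact_mod_cast hp.n_pos
  positivity

lemma m_le (hp : CoverParams n m M ρ α a D Y Kb h η β F s g Z) : (m : ℝ) ≤ α * n + 1 := by
  rw [hp.m_eq]
  have := hp.alpha_pos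
  exact (Nat.ceil_lt_add_one (by positivity)).le

lemma blockCount_le (hp : CoverParams n m M ρ α a D Y Kb h η β F s g Z) (S₁ S₂ : Finset (Fin n)) :
    (blockCount m S₁ S₂ : ℝ) ≤ Y := by
  have h1 : ((blockCount m S₁ S₂ * m : ℕ) : ℝ) ≤ n := by exact_mod_cast blockCount_mul_le m S₁ S₂
  have h2 : α * n ≤ m := by rw [hp.m_eq]; exact Nat.le_ceil _
  have hα := hp.alpha_pos
  have hn : (0 : ℝ) < n := by exact_mod_cast hp.n_pos
  push_cast at h1
  have h3 : (blockCount m S₁ S₂ : ℝ) * (α * n) ≤ n :=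
    (mul_le_mul_of_nonneg_left h2 (Nat.cast_nonneg _)).trans h1
  have h4 : (blockCount m S₁ S₂ : ℝ) * α ≤ 1 := by
    by_contra hc
    have := mul_lt_mul_of_pos_right (not_le.1 hc) hn
    linarith
  by_contra hc
  have := mul_lt_mul_of_pos_left (not_le.1 hc) hα
  linarith [hp.one_le_alpha_mul]

lemma Y_pos (hp : CoverParams n m M ρ α a D Y Kb h η β F s g Z) : 0 < Y := by
  by_contra hc
  have := mul_nonpos_of_nonneg_of_nonpos hp.alpha_pos.le (not_lt.1 hc)
  linarith [hp.one_le_alpha_mul]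

lemma s_nonneg (hp : CoverParams n m M ρ α a D Y Kb h η β F s g Z) : 0 ≤ s := by
  have := hp.Y_pos
  have := hp.M_pos
  have := hp.alpha_pos
  have := hp.Kb_pos
  have : 0 ≤ M + α * n + 2 + Y * Kb / h ^ 2 := by positivity
  exact this.trans hp.le_s

variable {v : EuclideanSpace ℝ (Fin n)} {σ τ' : EuclideanSpace ℝ (Fin n) → Finset (Fin n)}

lemma card_spread_le (hv : v ∈ Incomp n M ρ)
    (hσ : IsSpreadChoice M ρ σ) (hk : 0 < blockCount m (σ v) (τ' v)) :
    (σ v).card ≤ blockCount m (σ v) (τ' v) * blockSpread M ρ m (σ v) (τ' v) := by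
  rw [(hσ v hv).2, Nat.ceil_le]
  have hk' : (0 : ℝ) < blockCount m (σ v) (τ' v) := by exact_mod_cast hk
  have h1 := Nat.le_ceil (M * ρ ^ 2 / (2 * (blockCount m (σ v) (τ' v) : ℝ)))
  have h2 := mul_le_mul_of_nonneg_left h1 hk'.le
  push_cast
  refine le_trans (le_of_eq ?_) h2
  field_simp

lemma card_block_le_s (hp : CoverParams n m M ρ α a D Y Kb h η β F s g Z) (hv : v ∈ Incomp n M ρ)
    (hk : 0 < blockCount m (σ v) (τ' v)) (j : ℕ) :
    ((block M ρ m (σ v) (τ' v) j).card : ℝ) ≤ s := by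
  have h1 : ((block M ρ m (σ v) (τ' v) j).card : ℝ) ≤ m + blockSpread M ρ m (σ v) (τ' v) := by
    exact_mod_cast card_block_le M ρ m (σ v) (τ' v) j
  have hk' : (1 : ℝ) ≤ blockCount m (σ v) (τ' v) := by exact_mod_cast hk
  have hρ := rho_lt_one_of_mem_incomp hp.M_pos.le hv
  have hM := hp.M_pos
  have hρ0 := hp.rho_pos
  have h2 : (blockSpread M ρ m (σ v) (τ' v) : ℝ) ≤
      M * ρ ^ 2 / (2 * (blockCount m (σ v) (τ' v) : ℝ)) + 1 :=
    (Nat.ceil_lt_add_one (by positivity)).le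
  have h3 : M * ρ ^ 2 / (2 * (blockCount m (σ v) (τ' v) : ℝ)) ≤ M := by
    rw [div_le_iff₀ (by positivity)]
    have : ρ ^ 2 ≤ 1 := by nlinarith
    nlinarith
  have h4 : 0 ≤ Y * Kb / h ^ 2 := by
    have := hp.Y_pos
    have := hp.Kb_pos
    positivity
  linarith [hp.m_le, hp.le_s]

/-- For prescribed values of `σ v` and `τ' v` the blocks no longer depend on `v`, so a single cover
serves the whole fiber. -/
lemma exists_cover_fiber (hp : CoverParams n m M ρ α a D Y Kb h η β F s g Z) {δ₀ p : ℝ}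
    (hap : a = δ₀ * p) (hσ : IsSpreadChoice M ρ σ) (hτ : IsTopChoice M ρ τ')
    (S₁ S₂ : Finset (Fin n)) :
    ∃ Λ : Finset (Fin n → ℤ), (Λ.card : ℝ) ≤
        2 ^ n * Real.exp n * (Real.exp (Real.pi * n) * (F ^ n * Real.exp n)) ∧
      ∀ v ∈ Incomp n M ρ, regLCD δ₀ p M ρ α (σ v) (τ' v) v ∈ Set.Icc D (2 * D) →
        σ v = S₁ → τ' v = S₂ → (fun k => ⌊v k / η⌋) ∈ Λ := by
  classical
  subst hap
  have hF0 : 0 ≤ F := zero_le_one.trans hp.one_le_F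
  -- A vector in the fiber guarantees at least one block and the sizes of the two sets; an empty
  -- fiber needs no cover.
  by_cases hex : ∃ v ∈ Incomp n M ρ, regLCD δ₀ p M ρ α (σ v) (τ' v) v ∈ Set.Icc D (2 * D) ∧
      σ v = S₁ ∧ τ' v = S₂
  swap
  · refine ⟨∅, by simp; positivity, fun v hv h1 h2 h3 => ?_⟩
    exact absurd ⟨v, hv, h1, h2, h3⟩ hex
  obtain ⟨v₀, hv₀, hreg, rfl, rfl⟩ := hex
  obtain ⟨j₀, hj₀, -⟩ := exists_block_lcdAtLeast hp.a_pos hp.D_pos hp.m_eq hreg.1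
  have hk : 0 < blockCount m (σ v₀) (τ' v₀) := (Nat.zero_le _).trans_lt hj₀
  set k₀ := blockCount m (σ v₀) (τ' v₀) with hk₀
  set J : Fin k₀ → Finset (Fin n) := fun j => block M ρ m (σ v₀) (τ' v₀) j with hJ
  set jj : Fin n → Fin k₀ := fun k => if h : ∃ j, k ∈ J j then h.choose else ⟨0, hk⟩ with hjj
  have hcompl : ((Finset.univ.biUnion J)ᶜ.card : ℝ) ≤ M + α * n + 1 := by
    have h1 := card_compl_blocks_le M ρ hp.m_pos (σ v₀) (τ' v₀)
      (card_spread_le (τ' := τ') hv₀ hσ hk)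
    have h2 : (Finset.univ.biUnion J) =
        (Finset.range k₀).biUnion (block M ρ m (σ v₀) (τ' v₀)) := by
      ext k
      simp only [Finset.mem_biUnion, Finset.mem_univ, true_and, Finset.mem_range, hJ]
      constructor
      · rintro ⟨j, hj⟩; exact ⟨j, j.2, hj⟩
      · rintro ⟨j, hj, h⟩; exact ⟨⟨j, hj⟩, h⟩
    rw [h2]
    have h3 : (((Finset.range k₀).biUnion (block M ρ m (σ v₀) (τ' v₀)))ᶜ.card : ℝ) ≤
        (τ' v₀).card + m := by exact_mod_cast h1
    have h4 : ((τ' v₀).card : ℝ) ≤ M := by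
      rw [(hτ v₀ hv₀).1]; exact Nat.floor_le hp.M_pos.le
    linarith [hp.m_le]
  have hkY := hp.blockCount_le (σ v₀) (τ' v₀)
  obtain ⟨Λ, hΛ, hmem⟩ := exists_cover (ι := Fin k₀) (n := n) hp.m_pos (J := J)
    (by rw [Fintype.card_fin]; exact blockCount_mul_le m _ _) jj (by
      intro k j hkj
      have h : ∃ j, k ∈ J j := ⟨j, hkj⟩
      simp only [hjj, dif_pos h]
      exact h.choose_spec) hp.eta_pos hp.beta_pos hp.h_pos (D := 3 * D)
    (by have := hp.D_pos; positivity) (μ := 1 / Real.sqrt M) (by positivity) hp.Kb_pos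
    hp.beta_mul_le hp.one_le_F hp.le_F (s := s) (by
      refine le_trans ?_ hp.le_s
      have h1 : (Fintype.card (Fin k₀) : ℝ) * Kb / h ^ 2 ≤ Y * Kb / h ^ 2 := by
        rw [Fintype.card_fin]
        have := hp.Kb_pos
        gcongr
      linarith) hp.le_Z
  refine ⟨Λ, hΛ.trans ?_, fun v hv hv2 h1 h2 => ?_⟩
  · rw [Fintype.card_fin]
    have hD := hp.D_pos
    have hβ := hp.beta_pos
    have e1 : ((2 * (1 / Real.sqrt M) / β + 1) * (3 * D + 2)) ^ k₀ ≤ Real.exp n := by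
      calc _ ≤ Real.exp g ^ k₀ := pow_le_pow_left₀ (by positivity) hp.base_le _
        _ = Real.exp (k₀ * g) := (Real.exp_nat_mul _ _).symm
        _ ≤ Real.exp n := by
            rw [Real.exp_le_exp]
            have := mul_le_mul_of_nonneg_right hkY hp.g_nonneg
            linarith [hp.g_mul_Y]
    have e2 : (2 * (Z : ℝ) + 1) ^ ⌊s⌋₊ ≤ Real.exp n := by
      calc _ ≤ Real.exp g ^ ⌊s⌋₊ := pow_le_pow_left₀ (by positivity) hp.Z_le _
        _ = Real.exp (⌊s⌋₊ * g) := (Real.exp_nat_mul _ _).symm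
        _ ≤ Real.exp n := by
            rw [Real.exp_le_exp]
            have := mul_le_mul_of_nonneg_right (Nat.floor_le hp.s_nonneg) hp.g_nonneg
            linarith [hp.g_mul_s]
    gcongr
  · refine hmem (fun k => v k) (fun k => ?_) ?_
    · have := PiLp.norm_apply_le v k
      rwa [hv.1, Real.norm_eq_abs] at this
    · have h3 := nearLattice_blocks hp.M_pos hv hσ hτ hp.a_pos hp.D_pos hp.m_eq hv2.2 hp.posLog_le
      rw [h1, h2] at h3
      exact h3

/-- However irregular the choices of `σ` and `τ'` are, they take at most `4^n` pairs of values. -/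
lemma exists_cover_level (hp : CoverParams n m M ρ α a D Y Kb h η β F s g Z) {δ₀ p : ℝ}
    (hap : a = δ₀ * p) (hσ : IsSpreadChoice M ρ σ) (hτ : IsTopChoice M ρ τ') :
    ∃ Λ : Finset (Fin n → ℤ), (Λ.card : ℝ) ≤
        4 ^ n * (2 ^ n * Real.exp n * (Real.exp (Real.pi * n) * (F ^ n * Real.exp n))) ∧
      ∀ v ∈ Incomp n M ρ, regLCD δ₀ p M ρ α (σ v) (τ' v) v ∈ Set.Icc D (2 * D) →
        (fun k => ⌊v k / η⌋) ∈ Λ := by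
  classical
  choose Λ hΛ hmem using fun S : Finset (Fin n) × Finset (Fin n) =>
    hp.exists_cover_fiber hap hσ hτ S.1 S.2
  refine ⟨Finset.univ.biUnion Λ, ?_, fun v hv hreg => ?_⟩
  · calc _ ≤ ((∑ S, (Λ S).card : ℕ) : ℝ) := by exact_mod_cast Finset.card_biUnion_le
      _ = ∑ S, ((Λ S).card : ℝ) := by push_cast; rfl
      _ ≤ ∑ S : Finset (Fin n) × Finset (Fin n),
          (2 ^ n * Real.exp n * (Real.exp (Real.pi * n) * (F ^ n * Real.exp n))) :=
          Finset.sum_le_sum fun S _ => hΛ S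
      _ = _ := by
          rw [Finset.sum_const, Finset.card_univ, Fintype.card_prod, Fintype.card_finset,
            Fintype.card_fin, nsmul_eq_mul, ← mul_pow]
          norm_num
  · exact Finset.mem_biUnion.2 ⟨(σ v, τ' v), Finset.mem_univ _, hmem _ v hv hreg rfl rfl⟩

end CoverParams

end Cover

/-- Numerical relations used in the union bound over the cover of a level set. -/
structure SmallBallParams (n : ℕ) (ρ M a D Y η F s g B r R lam H t T b E CF κ p : ℝ) :
    Prop where
  B_pos : 0 < B
  r_pos : 0 < r
  b_pos : 0 < b
  b_sq_le : b ^ 2 ≤ M * ρ ^ 4 / (8 * n * Y)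
  t_pos : 0 < t
  t_sq : 2 * T ^ 2 + 2 * (η ^ 2 * (4 * H + 2 * lam ^ 2 * n)) ≤ t ^ 2 * n
  near : 24 * a * R ^ 2 * (n * η ^ 2) ≤ (2 * Real.pi * t) ^ 2
  H_ge : 2 * p * (n : ℝ) ^ 2 - H / (2 * B ^ 2) ≤ -2 * n
  E_pos : 0 < E
  CF_pos : 0 < CF
  F_eq : F = CF * E
  E_le : E ≤ Real.exp g
  kappa_pos : 0 < κ
  kappa_le : κ * (16 * CF) ≤ Real.exp (-9)
  kappa_le_one : κ ≤ 1
  row_le : 40 * t / (Real.sqrt a * r * b) + 6 * Real.exp (-(2 * Real.pi * t * D / R) ^ 2 / 8) ≤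
    κ ^ 2 / E
  s_le : 2 * s ≤ n

/-- The net contributes `(CF * E)^n` and the rows `(κ²/E)^(n - |J|)`. As `|J| ≤ s`, `E ≤ exp g` and
`g s ≤ n`, the uncancelled `E^|J|` is at most `exp n`; as `2|J| ≤ n`, a factor `κ^n` survives and
beats all exponentials. -/
theorem measure_level_le {n m : ℕ} {M ρ α D Y Kb h η β F s g B r R lam H t T b E CF κ δ₀ : ℝ}
    {Z : ℕ} {p : unitInterval}
    (hp : CoverParams n m M ρ α (δ₀ * p) D Y Kb h η β F s g Z)
    (hq : SmallBallParams n ρ M (δ₀ * p) D Y η F s g B r R lam H t T b E CF κ p)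
    {σ τ' : EuclideanSpace ℝ (Fin n) → Finset (Fin n)}
    (hσ : IsSpreadChoice M ρ σ) (hτ : IsTopChoice M ρ τ') {ν : Measure ℝ}
    (hν : IsStandardSubgaussian ν B)
    (hmass : 3 / 4 * (δ₀ * p) ≤ ((sparseLaw ν p).prod (sparseLaw ν p)).real
        {z | r < |z.1 - z.2| ∧ |z.1 - z.2| ≤ R}) :
    (Measure.pi fun _ : UpperIndex n => sparseLaw ν p)
      {w | ∃ v : EuclideanSpace ℝ (Fin n), (v ∈ Incomp n M ρ ∧
        regLCD δ₀ p M ρ α (σ v) (τ' v) v ∈ Set.Icc D (2 * D)) ∧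
        ∑ i, rowForm lam (fun k => v k) i w ^ 2 ≤ T ^ 2} ≤ ENNReal.ofReal (Real.exp (-n)) := by
  have := hν.isProbabilityMeasure
  obtain ⟨Λ, hΛ, hmem⟩ := hp.exists_cover_level rfl hσ hτ
  set V : Set (Fin n → ℝ) := {u | ∃ v : EuclideanSpace ℝ (Fin n), (v ∈ Incomp n M ρ ∧
        regLCD δ₀ p M ρ α (σ v) (τ' v) v ∈ Set.Icc D (2 * D)) ∧ u = fun k => v k} with hV
  have hn1 : (1 : ℝ) ≤ n := by exact_mod_cast hp.n_pos
  have hE := hq.E_pos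
  have hκ := hq.kappa_pos
  set Q := 40 * t / (Real.sqrt (δ₀ * p) * r * b) +
    6 * Real.exp (-(2 * Real.pi * t * D / R) ^ 2 / 8) with hQ
  have hQ0 : 0 ≤ Q := by
    have := hq.t_pos
    have := hq.r_pos
    have := hq.b_pos
    positivity
  set P : ℝ := Real.exp (n / 2) * (κ ^ n * Real.exp n / E ^ n) with hP
  have hbad : ∀ v ∈ V, ∀ v' : Fin n → ℝ, (∀ k, |v' k - v k| ≤ η) →
      (Measure.pi fun _ : UpperIndex n => sparseLaw ν p)
        {w | ∑ i, rowForm lam v' i w ^ 2 ≤ t ^ 2 * n} ≤ ENNReal.ofReal P := by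
    rintro _ ⟨v, ⟨hv, hreg⟩, rfl⟩ v' hv'
    obtain ⟨j, hj, hlcd⟩ := exists_block_lcdAtLeast hp.a_pos hp.D_pos hp.m_eq hreg.1
    set J := block M ρ m (σ v) (τ' v) j with hJ
    have hJs : (J.card : ℝ) ≤ s := hp.card_block_le_s hv ((Nat.zero_le j).trans_lt hj) j
    have hbL : b ≤ ‖restrict v J‖ := by
      rw [← sq_le_sq₀ hq.b_pos.le (norm_nonneg _)]
      exact hq.b_sq_le.trans (le_norm_restrict_sq hp.M_pos hp.rho_pos hv hσ hj
        (hp.blockCount_le _ _) hp.Y_sq_le)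
    have hnear : 24 * (δ₀ * p) * R ^ 2 * ∑ k ∈ J, (v' k - v k) ^ 2 ≤ (2 * Real.pi * t) ^ 2 := by
      refine le_trans ?_ hq.near
      have h1 : ∑ k ∈ J, (v' k - v k) ^ 2 ≤ n * η ^ 2 := by
        calc ∑ k ∈ J, (v' k - v k) ^ 2 ≤ ∑ k : Fin n, (v' k - v k) ^ 2 :=
              Finset.sum_le_sum_of_subset_of_nonneg (Finset.subset_univ _)
                fun _ _ _ => sq_nonneg _
          _ ≤ ∑ k : Fin n, η ^ 2 := by
              refine Finset.sum_le_sum fun k _ => ?_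
              rw [← sq_abs]
              exact pow_le_pow_left₀ (abs_nonneg _) (hv' k) 2
          _ = n * η ^ 2 := by simp
      have h2 := hp.a_pos
      exact mul_le_mul_of_nonneg_left h1 (by positivity)
    refine (measure_rowForm_small_le (sparseLaw ν p) (v := fun k => v k) lam hp.a_pos hp.D_pos
      hq.r_pos hq.b_pos hbL ((norm_restrict_le v J).trans_eq hv.1) hq.t_pos hmass hlcd
      hnear).trans (ENNReal.ofReal_le_ofReal ?_)
    refine mul_le_mul_of_nonneg_left ?_ (Real.exp_pos _).le
    have hJn : J.card ≤ n := (Finset.card_le_univ _).trans_eq (Fintype.card_fin n)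
    have h2J : n ≤ 2 * (n - J.card) := by
      have h1 : 2 * (J.card : ℝ) ≤ n := by linarith [hq.s_le]
      have h2 : 2 * J.card ≤ n := by exact_mod_cast h1
      omega
    have hsplit : E ^ n = E ^ (n - J.card) * E ^ J.card := by
      rw [← pow_add]; congr 1; omega
    calc Q ^ (n - J.card) ≤ (κ ^ 2 / E) ^ (n - J.card) := pow_le_pow_left₀ hQ0 hq.row_le _
      _ = κ ^ (2 * (n - J.card)) * E ^ J.card / E ^ n := by
          rw [div_pow, ← pow_mul, hsplit]; field_simp
      _ ≤ κ ^ n * Real.exp n / E ^ n := by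
          refine div_le_div_of_nonneg_right (mul_le_mul ?_ ?_ (by positivity) (by positivity))
            (by positivity)
          · exact pow_le_pow_of_le_one hκ.le hq.kappa_le_one h2J
          · calc E ^ J.card ≤ Real.exp g ^ J.card := pow_le_pow_left₀ hE.le hq.E_le _
              _ = Real.exp (J.card * g) := (Real.exp_nat_mul _ _).symm
              _ ≤ Real.exp n := by
                  rw [Real.exp_le_exp]
                  have := mul_le_mul_of_nonneg_right hJs hp.g_nonneg
                  linarith [hp.g_mul_s]
  have hmain := measure_exists_small_le (Measure.pi fun _ : UpperIndex n => sparseLaw ν p)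
    (V := V) (T := T) (H := H) hp.eta_pos Λ (by
      rintro _ ⟨v, hv, rfl⟩
      exact hmem v hv.1 hv.2) hbad hq.t_sq
  have hset : {w : UpperIndex n → ℝ | ∃ v : EuclideanSpace ℝ (Fin n), (v ∈ Incomp n M ρ ∧
        regLCD δ₀ p M ρ α (σ v) (τ' v) v ∈ Set.Icc D (2 * D)) ∧
        ∑ i, rowForm lam (fun k => v k) i w ^ 2 ≤ T ^ 2} ⊆
      {w | ∃ v ∈ V, ∑ i, rowForm lam v i w ^ 2 ≤ T ^ 2} := by
    rintro w ⟨v, hv, hw⟩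
    exact ⟨fun k => v k, ⟨v, hv, rfl⟩, hw⟩
  have hHS := measure_sum_sq_ge_le (ι := UpperIndex n) hν hq.B_pos p (m := (n : ℝ) ^ 2) (H := H)
    (card_upperIndex_le n)
  have hcount : ((Λ.card * 2 ^ n : ℕ) : ENNReal) * ENNReal.ofReal P ≤
      ENNReal.ofReal (Real.exp (-2 * n)) := by
    rw [← ENNReal.ofReal_natCast, ← ENNReal.ofReal_mul (Nat.cast_nonneg _)]
    refine ENNReal.ofReal_le_ofReal ?_
    push_cast
    have hpi : Real.exp (Real.pi * n) ≤ Real.exp (7 / 2 * n) := by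
      rw [Real.exp_le_exp]
      have := Real.pi_lt_d2
      nlinarith
    have hCF := hq.CF_pos
    calc (Λ.card : ℝ) * 2 ^ n * P
        ≤ (4 ^ n * (2 ^ n * Real.exp n * (Real.exp (7 / 2 * n) * ((CF * E) ^ n * Real.exp n)))) *
          2 ^ n * P := by
          rw [← hq.F_eq]
          have : 0 < P := by positivity
          have hF0 : 0 ≤ F := zero_le_one.trans hp.one_le_F
          refine mul_le_mul_of_nonneg_right (mul_le_mul_of_nonneg_right (hΛ.trans ?_)
            (by positivity)) this.le
          gcongr
      -- `16 = 4 * 2 * 2`: pairs of index sets, sets of regular coordinates, corners of cells. The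
      -- exponentials total `exp (7n)`, so `exp (-9n)` leaves `exp (-2n)`.
      _ = (κ * (16 * CF)) ^ n * (Real.exp n * Real.exp (7 / 2 * n) * Real.exp n *
          Real.exp (n / 2) * Real.exp n) := by
          rw [hP, mul_pow CF, mul_pow κ, mul_pow 16 CF, show (16 : ℝ) = 4 * (2 * 2) by norm_num,
            mul_pow 4, mul_pow 2]
          field_simp
      _ ≤ Real.exp (-9) ^ n * (Real.exp n * Real.exp (7 / 2 * n) * Real.exp n *
          Real.exp (n / 2) * Real.exp n) := by
          refine mul_le_mul_of_nonneg_right (pow_le_pow_left₀ (by positivity) hq.kappa_le _)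
            (by positivity)
      _ = Real.exp (-2 * n) := by
          rw [← Real.exp_nat_mul, ← Real.exp_add, ← Real.exp_add, ← Real.exp_add, ← Real.exp_add,
            ← Real.exp_add]
          congr 1; ring
  calc _ ≤ _ := (measure_mono hset).trans hmain
    _ ≤ ENNReal.ofReal (Real.exp (-2 * n)) + ENNReal.ofReal (Real.exp (-2 * n)) := by
        refine add_le_add (hHS.trans (ENNReal.ofReal_le_ofReal (Real.exp_le_exp.2 hq.H_ge))) hcount
    _ = ENNReal.ofReal (2 * Real.exp (-2 * n)) := by
        rw [← ENNReal.ofReal_add (by positivity) (by positivity), two_mul]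
    _ ≤ ENNReal.ofReal (Real.exp (-n)) := by
        refine ENNReal.ofReal_le_ofReal ?_
        have h1 : Real.exp (-2 * n) = Real.exp (-n) * Real.exp (-n) := by
          rw [← Real.exp_add]; ring_nf
        have h2 : 2 * Real.exp (-n) ≤ 1 := by
          rw [Real.exp_neg, ← div_eq_mul_inv, div_le_one (Real.exp_pos _)]
          linarith [Real.add_one_le_exp (n : ℝ)]
        rw [h1]
        nlinarith [Real.exp_pos (-(n : ℝ))]

end SparseSpectrum

/-! ### Explicit parameters in large dimension -/

namespace SparseSpectrum

section LargeDimension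

variable {n : ℕ} {p x δ₀ cbar D : ℝ}

lemma pow_le_sqrt_dim (hp1 : p ≤ 1) (hnp : n * p = x ^ 32) :
    x ^ 16 ≤ Real.sqrt n := by
  apply Real.le_sqrt_of_sq_le
  have : (n : ℝ) * p ≤ n := by
    have := mul_le_mul_of_nonneg_left hp1 (Nat.cast_nonneg (α := ℝ) n)
    linarith
  calc (x ^ 16) ^ 2 = x ^ 32 := by ring
    _ ≤ (n : ℝ) := by linarith

/-- After expansion the product of the two large factors is controlled by `u (y - 1) ≤ 1`, so it is
`O(E)` instead of `O(E²)`. The constant terms are absorbed by `1 ≤ cbar * E`, the lower bound on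
`D`. -/
lemma cover_factor_le {N w x D S c cbar μ : ℝ} (hx1 : 1 ≤ x)
    (hw0 : 0 < w) (hwn : w ^ 2 = N) (hc : 2 * c ≤ N / x ^ 2) (hEc : 1 ≤ cbar * (D * x / w))
    (hxw : x / w ≤ 1 / 2) (hD1 : 1 ≤ D) (hS : D ≤ S) (hμ : N / x ^ 2 ≤ μ) (u y : ℝ) (hu0 : 0 ≤ u)
    (hu : u ≤ 2 * (x / w)) (hy0 : 0 ≤ y) (hy : y ≤ 3 * D + 1) (huy : u * (y - 1) ≤ 1) :
    (1 + Real.sqrt ((2 * y ^ 2 + 2 * c) / μ)) *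
      (2 * ((u + 1 / (x ^ 8 * D) / S) * (1 / x ^ 8) / (1 / (x ^ 8 * D)) + 3) + 1) ≤
      (74 + 37 * cbar) * (D * x / w) := by
  have hx0 : 0 < x := by linarith
  have hD0 : 0 < D := by linarith
  have hS0 : 0 < S := hD0.trans_le hS
  have hN : 0 < N := by rw [← hwn]; positivity
  set E := D * x / w with hE
  have hE0 : 0 < E := by positivity
  have h1 : Real.sqrt ((2 * y ^ 2 + 2 * c) / μ) ≤ 3 / 2 * (y * x / w) + 1 := by
    apply Real.sqrt_le_iff.2
    refine ⟨by positivity, ?_⟩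
    calc (2 * y ^ 2 + 2 * c) / μ ≤ (2 * y ^ 2 + N / x ^ 2) / (N / x ^ 2) := by gcongr
      _ = 2 * (y * x / w) ^ 2 + 1 := by rw [← hwn]; field_simp
      _ ≤ _ := by
        have : 0 ≤ y * x / w := by positivity
        linarith [sq_nonneg (y * x / w)]
  have h2 : (u + 1 / (x ^ 8 * D) / S) * (1 / x ^ 8) / (1 / (x ^ 8 * D)) =
      u * D + 1 / (x ^ 8 * S) := by field_simp
  have h3 : 1 / (x ^ 8 * S) ≤ 1 := by
    rw [div_le_one (by positivity)]
    exact one_le_mul_of_one_le_of_one_le (one_le_pow₀ hx1) (hD1.trans hS)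
  rw [h2]
  have hux : u * D ≤ 2 * E := by
    calc u * D ≤ 2 * (x / w) * D := by gcongr
      _ = 2 * E := by rw [hE]; ring
  have hu1 : u ≤ 1 := by linarith
  have hyx : y * x / w ≤ 4 * E := by
    calc y * x / w ≤ (4 * D) * x / w := by gcongr; linarith
      _ = 4 * E := by rw [hE]; ring
  have huyE : (y * x / w) * (u * D) ≤ 2 * E := by
    calc (y * x / w) * (u * D) = (u * y) * E := by rw [hE]; ring
      _ ≤ 2 * E := by gcongr; linarith
  have hA : 0 ≤ y * x / w := by positivity
  have hB : 0 ≤ u * D := by positivity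
  calc _ ≤ (1 + (3 / 2 * (y * x / w) + 1)) * (2 * (u * D + 1 + 3) + 1) := by gcongr
    _ = 3 * ((y * x / w) * (u * D)) + 27 / 2 * (y * x / w) + 4 * (u * D) + 18 := by ring
    _ ≤ 68 * E + 18 * (cbar * E) := by linarith
    _ ≤ _ := by linarith

/-- `Y = 1/α`; `Kb` comes from `log (3D √a) ≤ 2x`; `h / η = D` makes the correction boxes of size
`O(E)`; and `h = x⁻⁸` leaves only `O(n/x¹³)` coordinates with large `w`. All outer counts are at
most `exp (4x)` because `D ≤ exp x`, and `x * n / x²` is much smaller than `n`. -/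
lemma coverParams_of_large {ρ ρ₀ : ℝ} (hx : 12 ≤ x) (hp0 : 0 < p) (hp1 : p ≤ 1)
    (hnp : n * p = x ^ 32) (hδ₀ : 0 < δ₀) (hδ₁ : δ₀ ≤ 1) (hρ₀ : 0 < ρ₀) (hρ : ρ₀ ≤ ρ)
    (hcbar : 0 < cbar) (q2 : 4 ≤ ρ₀ ^ 2 * x) (q3 : 4 ≤ δ₀ * x) (q4 : cbar ≤ x)
    (q5 : 5 * (2 * (5 + cbar) * x ^ 10 + 1) ≤ Real.exp x) (q6 : 7 * x ^ 8 ≤ Real.exp x)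
    (hD1 : Real.sqrt n / x ≤ cbar * D) (hD2 : D ≤ Real.exp x) :
    CoverParams n ⌈1 / x ^ 2 * n⌉₊ (n / x ^ 2) ρ (1 / x ^ 2) (δ₀ * p) D (x ^ 2) (2 * x / (δ₀ * p))
      (1 / x ^ 8) (1 / (x ^ 8 * D))
      (1 / (x ^ 8 * D) / Real.sqrt (2 * (3 * D) ^ 2 + 2 * (2 * x / (δ₀ * p))))
      ((74 + 37 * cbar) * (D * x / Real.sqrt n)) (3 * n / x ^ 2) (4 * x) ⌈x ^ 8 * D + 1⌉₊ := by
  have hx0 : 0 < x := by linarith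
  have hx1 : 1 ≤ x := by linarith
  have hxk : ∀ j : ℕ, 1 ≤ x ^ j := fun j => one_le_pow₀ hx1
  have hn : (0 : ℝ) < n := by
    by_contra hc
    have := mul_nonpos_of_nonpos_of_nonneg (not_lt.1 hc) hp0.le
    rw [hnp] at this
    linarith [hxk 32]
  set w := Real.sqrt n with hw
  have hw16 : x ^ 16 ≤ w := pow_le_sqrt_dim hp1 hnp
  have hw0 : 0 < w := Real.sqrt_pos.2 hn
  have hwn : w ^ 2 = n := Real.sq_sqrt hn.le
  have hn32 : x ^ 32 ≤ n := by
    rw [← hwn]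
    calc x ^ 32 = (x ^ 16) ^ 2 := by ring
      _ ≤ w ^ 2 := by gcongr
  have hwD : w ≤ x * cbar * D := by
    rw [div_le_iff₀ hx0] at hD1; linarith
  have hD15 : x ^ 14 ≤ D := by
    have h1 : x ^ 16 ≤ x * cbar * D := hw16.trans hwD
    have hD0 : 0 ≤ D := by
      by_contra hc
      have := mul_neg_of_pos_of_neg (mul_pos hx0 hcbar) (not_le.1 hc)
      linarith [hxk 16]
    have h2 : x * cbar * D ≤ x * x * D := by gcongr
    have h3 : x ^ 2 * x ^ 14 ≤ x ^ 2 * D := by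
      calc x ^ 2 * x ^ 14 = x ^ 16 := by ring
        _ ≤ x * x * D := h1.trans h2
        _ = x ^ 2 * D := by ring
    exact le_of_mul_le_mul_left h3 (by positivity)
  have hD1' : 1 ≤ D := (hxk 14).trans hD15
  have hD0 : 0 < D := by linarith
  have ha : 0 < δ₀ * p := by positivity
  have hKb : 0 < 2 * x / (δ₀ * p) := by positivity
  have hpn : p = x ^ 32 / n := by rw [← hnp]; field_simp
  have hKbn : 2 * (2 * x / (δ₀ * p)) ≤ n / x ^ 2 := by
    have h1 : 2 * (2 * x / (δ₀ * p)) = 4 * n / (δ₀ * x ^ 31) := by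
      rw [hpn]; field_simp; ring
    rw [h1, div_le_div_iff₀ (by positivity) (by positivity)]
    have h2 : 4 * x ^ 2 ≤ δ₀ * x ^ 31 := by
      calc 4 * x ^ 2 ≤ δ₀ * x * x ^ 2 := by gcongr
        _ = δ₀ * x ^ 3 := by ring
        _ ≤ δ₀ * x ^ 31 := by gcongr; linarith
    calc 4 * n * x ^ 2 = n * (4 * x ^ 2) := by ring
      _ ≤ _ := by gcongr
  have hsqM : 1 / Real.sqrt (n / x ^ 2) = x / w := by
    rw [Real.sqrt_div hn.le, Real.sqrt_sq hx0.le, one_div_div]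
  set S := Real.sqrt (2 * (3 * D) ^ 2 + 2 * (2 * x / (δ₀ * p))) with hS
  have hSlow : D ≤ S := by
    apply Real.le_sqrt_of_sq_le
    linarith [sq_nonneg D]
  have hSup : S ≤ 5 * D + w := by
    apply Real.sqrt_le_iff.2
    refine ⟨by positivity, ?_⟩
    have h1 : (n : ℝ) / x ^ 2 ≤ n := div_le_self hn.le (hxk 2)
    linarith [mul_pos hD0 hw0, sq_nonneg D]
  have hS0 : 0 < S := hD0.trans_le hSlow
  set E := D * x / w with hE
  have hE0 : 0 < E := by positivity
  have hEc : 1 ≤ cbar * E := by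
    rw [hE, ← mul_div_assoc, le_div_iff₀ hw0]; linarith
  have hxw : x / w ≤ 1 / 2 := by
    rw [div_le_div_iff₀ hw0 (by norm_num)]
    have h1 : x ^ 2 ≤ x ^ 16 := pow_le_pow_right₀ hx1 (by norm_num)
    have h2 : 12 * x ≤ x * x := by gcongr
    linarith
  have hexp3 : 3 ≤ Real.exp x := by linarith [Real.add_one_le_exp x]
  have hexp1 : 1 ≤ Real.exp x := by linarith
  refine ⟨by exact_mod_cast hn, by positivity, hρ₀.trans_le hρ, by positivity, rfl, ha, hD0, ?_, ?_,
    hKb, ?_, by positivity, by positivity, by positivity, ?_, ?_, ?_, ?_, ?_, ?_, ?_, by positivity,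
    ?_, ?_⟩
  · rw [one_div, inv_mul_cancel₀ (by positivity)]
  · have h1 : ρ₀ ^ 2 ≤ ρ ^ 2 := by gcongr
    calc 4 * (x ^ 2) ^ 2 ≤ (ρ₀ ^ 2 * x) * (x ^ 2) ^ 2 := by gcongr
      _ = x ^ 5 * ρ₀ ^ 2 := by ring
      _ ≤ x ^ 30 * ρ₀ ^ 2 := by gcongr; linarith
      _ ≤ n / x ^ 2 * ρ ^ 2 := by
          gcongr
          rw [le_div_iff₀ (by positivity)]
          calc x ^ 30 * x ^ 2 = x ^ 32 := by ring
            _ ≤ (n : ℝ) := hn32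
  · have e1 : δ₀ * p * (2 * x / (δ₀ * p)) = 2 * x := by field_simp
    rw [e1, Real.posLog_def]
    refine max_le (by positivity) ?_
    rw [Real.log_le_iff_le_exp (by positivity)]
    have h1 : Real.sqrt (δ₀ * p) ≤ 1 := by
      rw [Real.sqrt_le_one]
      exact mul_le_one₀ hδ₁ hp0.le hp1
    calc Real.sqrt (δ₀ * p) * (3 * D) ≤ 1 * (3 * D) := by gcongr
      _ ≤ Real.exp x * Real.exp x := by rw [one_mul]; gcongr
      _ = Real.exp (2 * x) := by rw [← Real.exp_add]; ring_nf
  · rw [div_mul_cancel₀ _ hS0.ne']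
  · linarith
  · rw [hsqM]
    refine cover_factor_le hx1 hw0 hwn hKbn hEc hxw hD1' hSlow (le_of_eq ?_ |>.trans (Nat.le_ceil _))
    ring
  · have e1 : x ^ 2 * (2 * x / (δ₀ * p)) / (1 / x ^ 8) ^ 2 = 2 * n / (δ₀ * x ^ 13) := by
      rw [hpn]; field_simp
    have e2 : 1 / x ^ 2 * (n : ℝ) = n / x ^ 2 := by ring
    rw [e1, e2]
    have h1 : 2 * n / (δ₀ * x ^ 13) ≤ n / x ^ 2 / 2 := by
      rw [div_div, div_le_div_iff₀ (by positivity) (by positivity)]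
      have : 4 * x ^ 2 ≤ δ₀ * x ^ 13 := by
        calc 4 * x ^ 2 ≤ δ₀ * x * x ^ 2 := by gcongr
          _ = δ₀ * x ^ 3 := by ring
          _ ≤ δ₀ * x ^ 13 := by gcongr; linarith
      have := mul_le_mul_of_nonneg_left this hn.le
      linarith
    have h2 : 2 ≤ n / x ^ 2 / 2 := by
      rw [div_div, le_div_iff₀ (by positivity)]
      have : x ^ 3 ≤ x ^ 32 := pow_le_pow_right₀ hx1 (by norm_num)
      have h3 : 12 * x ^ 2 ≤ x * x ^ 2 := by gcongr
      linarith [hxk 2]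
    have e3 : 3 * (n : ℝ) / x ^ 2 = 3 * (n / x ^ 2) := by ring
    rw [e3]
    linarith
  · rw [one_div_one_div]
    exact Nat.le_ceil _
  · rw [hsqM]
    have e1 : 2 * (x / w) / (1 / (x ^ 8 * D) / S) = 2 * (x / w) * (x ^ 8 * D * S) := by
      field_simp
    rw [e1]
    have hS2 : S ≤ (5 + cbar) * x * D := by
      have := mul_le_mul_of_nonneg_right hx1 hD0.le
      linarith
    have h1 : 2 * (x / w) * (x ^ 8 * D * S) + 1 ≤ (2 * (5 + cbar) * x ^ 10 + 1) * D ^ 2 := by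
      have h2 : 2 * (x / w) * (x ^ 8 * D * S) ≤ 2 * x * (x ^ 8 * D * ((5 + cbar) * x * D)) := by
        gcongr
        exact div_le_self hx0.le ((hxk 16).trans hw16)
      have : 1 ≤ D ^ 2 := one_le_pow₀ hD1'
      linarith
    calc _ ≤ ((2 * (5 + cbar) * x ^ 10 + 1) * D ^ 2) * (5 * D) := by
          gcongr
          linarith
      _ = 5 * (2 * (5 + cbar) * x ^ 10 + 1) * D ^ 3 := by ring
      _ ≤ Real.exp x * Real.exp x ^ 3 := by gcongr
      _ = Real.exp (4 * x) := by
          rw [← pow_succ', ← Real.exp_nat_mul]; norm_num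
  · have h1 : (⌈x ^ 8 * D + 1⌉₊ : ℝ) ≤ x ^ 8 * D + 1 + 1 :=
      (Nat.ceil_lt_add_one (by positivity)).le
    have h2 : 1 ≤ x ^ 8 * D := one_le_mul_of_one_le_of_one_le (hxk 8) hD1'
    calc 2 * (⌈x ^ 8 * D + 1⌉₊ : ℝ) + 1 ≤ 7 * x ^ 8 * D := by linarith
      _ ≤ Real.exp x * Real.exp x := by gcongr
      _ = Real.exp (2 * x) := by rw [← Real.exp_add]; ring_nf
      _ ≤ Real.exp (4 * x) := by rw [Real.exp_le_exp]; linarith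
  · have : 4 * x * x ^ 2 ≤ x ^ 32 := by
      calc 4 * x * x ^ 2 ≤ x * x * x ^ 2 := by gcongr; linarith
        _ = x ^ 4 := by ring
        _ ≤ x ^ 32 := pow_le_pow_right₀ hx1 (by norm_num)
    linarith
  · rw [← mul_div_assoc, div_le_iff₀ (by positivity)]
    have := mul_le_mul_of_nonneg_left hx (mul_pos hn hx0).le
    linarith

/-- The threshold per row is `t = 2 ct x¹³ / D`: it exceeds the rounding error, of order `η x¹⁶ =
x⁸/D`, and it makes the main term of the row bound a multiple of `ct / E`. The main term and the
Gaussian tail each take half of `κ²/E`. -/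
lemma smallBallParams_of_large {ρ ρ₀ B K r R lam ct κ : ℝ} (hx : 12 ≤ x) (hp0 : 0 < p)
    (hp1 : p ≤ 1) (hnp : n * p = x ^ 32) (hδ₀ : 0 < δ₀) (hδ₁ : δ₀ ≤ 1) (hρ₀ : 0 < ρ₀)
    (hρ : ρ₀ ≤ ρ) (hcbar : 0 < cbar) (hB : 0 < B) (hr : 0 < r) (hR : 0 < R) (hct : 0 < ct)
    (hκ : κ = Real.exp (-9) / (16 * (74 + 37 * cbar)))
    (hctκ : 480 * ct ≤ κ ^ 2 * (Real.sqrt δ₀ * r * ρ₀ ^ 2))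
    (hlam : lam ^ 2 ≤ K ^ 2 * x ^ 32)
    (q7 : R ^ 2 ≤ 6 * ct ^ 2 * x) (q8 : 32 * B ^ 2 + 2 * K ^ 2 ≤ ct ^ 2 * x)
    (q9 : 12 * x ≤ κ ^ 2 * Real.exp x) (hD0 : 0 < D) (hD2 : D ≤ Real.exp x) :
    SmallBallParams n ρ (n / x ^ 2) (δ₀ * p) D (x ^ 2) (1 / (x ^ 8 * D))
      ((74 + 37 * cbar) * (D * x / Real.sqrt n)) (3 * n / x ^ 2) (4 * x) B r R lam
      (8 * B ^ 2 * (x ^ 32 * n)) (2 * ct * x ^ 13 / D) (ct * x ^ 13 * Real.sqrt n / D)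
      (ρ₀ ^ 2 / (3 * x ^ 2)) (D * x / Real.sqrt n) (74 + 37 * cbar) κ p := by
  have hx0 : 0 < x := by linarith
  have hx1 : 1 ≤ x := by linarith
  have hxk : ∀ j : ℕ, 1 ≤ x ^ j := fun j => one_le_pow₀ hx1
  have hn : (0 : ℝ) < n := by
    by_contra hc
    have := mul_nonpos_of_nonpos_of_nonneg (not_lt.1 hc) hp0.le
    rw [hnp] at this
    linarith [hxk 32]
  set w := Real.sqrt n with hw
  have hw16 : x ^ 16 ≤ w := pow_le_sqrt_dim hp1 hnp
  have hw0 : 0 < w := Real.sqrt_pos.2 hn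
  have hwn : w ^ 2 = n := Real.sq_sqrt hn.le
  have hpn : p = x ^ 32 / n := by rw [← hnp]; field_simp
  have hE0 : 0 < D * x / w := by positivity
  have hκ0 : 0 < κ := by rw [hκ]; positivity
  have hEle : D * x / w ≤ Real.exp x * x := by
    refine (div_le_self (by positivity) ((hxk 16).trans hw16)).trans ?_
    gcongr
  have hpi := Real.pi_gt_three
  refine ⟨hB, hr, by positivity, ?_, by positivity, ?_, ?_, ?_, hE0, by positivity, rfl, ?_, hκ0,
    ?_, ?_, ?_, ?_⟩
  · have e1 : (n : ℝ) / x ^ 2 * ρ ^ 4 / (8 * n * x ^ 2) = ρ ^ 4 / (8 * x ^ 4) := by field_simp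
    rw [e1]
    calc (ρ₀ ^ 2 / (3 * x ^ 2)) ^ 2 = ρ₀ ^ 4 / (9 * x ^ 4) := by
          field_simp; norm_num
      _ ≤ ρ ^ 4 / (8 * x ^ 4) := by gcongr; norm_num
  · have h1 : 4 * (8 * B ^ 2 * (x ^ 32 * n)) + 2 * lam ^ 2 * n ≤
        (32 * B ^ 2 + 2 * K ^ 2) * (x ^ 32 * n) := by
      have := mul_le_mul_of_nonneg_right hlam hn.le
      linarith
    have h2 : (32 * B ^ 2 + 2 * K ^ 2) * (x ^ 32 * n) ≤ ct ^ 2 * x ^ 42 * n := by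
      calc _ ≤ ct ^ 2 * x * (x ^ 32 * n) := by gcongr
        _ = ct ^ 2 * x ^ 33 * n := by ring
        _ ≤ ct ^ 2 * x ^ 42 * n := by gcongr; linarith
    calc 2 * (ct * x ^ 13 * w / D) ^ 2 + 2 * ((1 / (x ^ 8 * D)) ^ 2 *
          (4 * (8 * B ^ 2 * (x ^ 32 * n)) + 2 * lam ^ 2 * n))
        ≤ 2 * (ct * x ^ 13 * w / D) ^ 2 + 2 * ((1 / (x ^ 8 * D)) ^ 2 *
          (ct ^ 2 * x ^ 42 * n)) := by gcongr; linarith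
      _ = (2 * ct * x ^ 13 / D) ^ 2 * n := by rw [← hwn]; field_simp; ring
  · have h0 : 24 * R ^ 2 ≤ 144 * ct ^ 2 * x := by linarith
    have h1 : 24 * (δ₀ * p) * R ^ 2 * (n * (1 / (x ^ 8 * D)) ^ 2) =
        δ₀ * (24 * R ^ 2) * (x ^ 16 / D ^ 2) := by rw [hpn]; field_simp
    rw [h1]
    calc δ₀ * (24 * R ^ 2) * (x ^ 16 / D ^ 2) ≤ 1 * (144 * ct ^ 2 * x) * (x ^ 16 / D ^ 2) := by
          gcongr
      _ = 144 * ct ^ 2 * x ^ 17 / D ^ 2 := by ring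
      _ ≤ 144 * ct ^ 2 * x ^ 26 / D ^ 2 := by gcongr; linarith
      _ = (2 * 3 * (2 * ct * x ^ 13 / D)) ^ 2 := by field_simp; norm_num
      _ ≤ _ := by gcongr
  · have h1 : 8 * B ^ 2 * (x ^ 32 * n) / (2 * B ^ 2) = 4 * (x ^ 32 * n) := by field_simp; norm_num
    have h2 : 2 * p * (n : ℝ) ^ 2 = 2 * (x ^ 32 * n) := by rw [← hnp]; ring
    rw [h1, h2]
    have := mul_le_mul_of_nonneg_right (hxk 32) hn.le
    linarith
  · refine hEle.trans ?_
    calc Real.exp x * x ≤ Real.exp x * Real.exp x := by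
          gcongr; linarith [Real.add_one_le_exp x]
      _ = Real.exp (2 * x) := by rw [← Real.exp_add]; ring_nf
      _ ≤ Real.exp (4 * x) := by rw [Real.exp_le_exp]; linarith
  · rw [hκ, div_mul_cancel₀ _ (by positivity)]
  · rw [hκ, div_le_one (by positivity)]
    have : Real.exp (-9) ≤ 1 := Real.exp_le_one_iff.2 (by norm_num)
    linarith
  · have hsq : Real.sqrt (δ₀ * p) = Real.sqrt δ₀ * (x ^ 16 / w) := by
      rw [Real.sqrt_mul hδ₀.le, hpn, Real.sqrt_div (by positivity),
        show x ^ 32 = (x ^ 16) ^ 2 by ring, Real.sqrt_sq (by positivity)]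
    have hsδ : 0 < Real.sqrt δ₀ := Real.sqrt_pos.2 hδ₀
    have h1 : 40 * (2 * ct * x ^ 13 / D) / (Real.sqrt (δ₀ * p) * r * (ρ₀ ^ 2 / (3 * x ^ 2))) =
        (480 * ct / (Real.sqrt δ₀ * r * ρ₀ ^ 2)) / (D * x / w) / 2 := by
      rw [hsq]; field_simp; norm_num
    have h2 : 480 * ct / (Real.sqrt δ₀ * r * ρ₀ ^ 2) ≤ κ ^ 2 := by
      rw [div_le_iff₀ (by positivity)]; exact hctκ
    have h3 : 6 * Real.exp (-(2 * Real.pi * (2 * ct * x ^ 13 / D) * D / R) ^ 2 / 8) ≤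
        κ ^ 2 / (D * x / w) / 2 := by
      have h4 : 2 * x ≤ (2 * Real.pi * (2 * ct * x ^ 13 / D) * D / R) ^ 2 / 8 := by
        have e1 : (2 * Real.pi * (2 * ct * x ^ 13 / D) * D / R) ^ 2 / 8 =
            2 * Real.pi ^ 2 * ct ^ 2 * x ^ 26 / R ^ 2 := by field_simp; norm_num
        rw [e1, le_div_iff₀ (by positivity)]
        have h6 : 1 ≤ x ^ 24 := hxk 24
        calc 2 * x * R ^ 2 ≤ 2 * x * (6 * ct ^ 2 * x) := by gcongr
          _ = 12 * ct ^ 2 * x ^ 2 := by ring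
          _ ≤ 18 * ct ^ 2 * x ^ 26 := by gcongr <;> linarith
          _ = 2 * 3 ^ 2 * ct ^ 2 * x ^ 26 := by ring
          _ ≤ _ := by gcongr
      have h5 : Real.exp (-(2 * Real.pi * (2 * ct * x ^ 13 / D) * D / R) ^ 2 / 8) ≤
          Real.exp (-(2 * x)) := by
        rw [Real.exp_le_exp, neg_div]; linarith
      rw [div_div, le_div_iff₀ (by positivity)]
      calc _ ≤ 6 * Real.exp (-(2 * x)) * ((Real.exp x * x) * 2) := by gcongr
        _ = 12 * x * (Real.exp (-(2 * x)) * Real.exp x) := by ring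
        _ ≤ κ ^ 2 * Real.exp x * (Real.exp (-(2 * x)) * Real.exp x) := by gcongr
        _ = κ ^ 2 * Real.exp (x + (-(2 * x) + x)) := by rw [Real.exp_add, Real.exp_add]; ring
        _ = κ ^ 2 := by ring_nf; simp
    rw [h1]
    have h7 : 480 * ct / (Real.sqrt δ₀ * r * ρ₀ ^ 2) / (D * x / w) / 2 ≤
        κ ^ 2 / (D * x / w) / 2 := by gcongr
    linarith
  · rw [← mul_div_assoc, div_le_iff₀ (by positivity)]
    have h1 : 12 * 12 ≤ x * x := by gcongr
    have := mul_le_mul_of_nonneg_left h1 hn.le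
    linarith

end LargeDimension

end SparseSpectrum

/-! ### The estimate in large dimension -/

namespace SparseSpectrum

/-- Since `p ≥ n^(-1+δ)`, the denominator in `ell0` is at least `(δ/2) log n`, and for `δ ≤ 1` the
numerator is at most `(1 - δ) log n`. So `ell0` is bounded and `ρ` stays above a constant. -/
lemma le_rho {δ C K p : ℝ} {n : ℕ} (hδ : 0 < δ) (hCK : 1 < C * K) (hn : 2 ≤ n)
    (hp : (n : ℝ) ^ (-1 + δ) ≤ p) (hp1 : p ≤ 1) :
    (C * K) ^ (-⌈2 / δ⌉ - 6) ≤ rho C K n p := by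
  have hn1 : (1 : ℝ) < n := by exact_mod_cast hn
  have hn0 : (0 : ℝ) < n := by linarith
  have hp0 : 0 < p := (Real.rpow_pos_of_pos hn0 _).trans_le hp
  have hlogn : 0 < Real.log n := Real.log_pos hn1
  have h1 : (-1 + δ) * Real.log n ≤ Real.log p := by
    rw [← Real.log_rpow hn0]
    exact Real.log_le_log (Real.rpow_pos_of_pos hn0 _) hp
  have h2 : Real.log (Real.sqrt (p * n)) = (Real.log p + Real.log n) / 2 := by
    rw [Real.log_sqrt (by positivity), Real.log_mul hp0.ne' hn0.ne']
  have h3 : Real.log (1 / (8 * p)) ≤ -Real.log p := by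
    rw [one_div, Real.log_inv, Real.log_mul (by norm_num) hp0.ne']
    have : 0 < Real.log 8 := Real.log_pos (by norm_num)
    linarith
  have h4 : 0 < Real.log (Real.sqrt (p * n)) := by
    rw [h2]
    have := mul_pos hδ hlogn
    linarith
  have h5 : ell0 n p ≤ ⌈2 / δ⌉ := by
    apply Int.ceil_le_ceil
    rw [div_le_iff₀ h4, h2, div_mul_div_comm, mul_comm δ 2, mul_div_mul_left _ _ two_ne_zero,
      le_div_iff₀ hδ]
    have hlp : Real.log p ≤ 0 := Real.log_nonpos hp0.le hp1
    -- For `δ > 1` the hypotheses force `p = 1`.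
    by_cases hd : δ ≤ 1
    · have : Real.log (1 / (8 * p)) * δ ≤ (-Real.log p) * δ := by gcongr
      nlinarith
    · have e : 0 ≤ (-1 + δ) * Real.log n := mul_nonneg (by linarith) hlogn.le
      have e0 : Real.log p = 0 := le_antisymm hlp (e.trans h1)
      rw [e0] at h3 ⊢
      nlinarith
  unfold rho
  exact zpow_le_zpow_right₀ hCK.le (by linarith)

lemma eventually_le_mul {k : ℝ} (hk : 0 < k) (c : ℝ) : ∀ᶠ x : ℝ in Filter.atTop, c ≤ k * x :=
  (Filter.tendsto_id.const_mul_atTop hk).eventually_ge_atTop c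

lemma eventually_mul_pow_le_exp (c : ℝ) (k : ℕ) :
    ∀ᶠ x : ℝ in Filter.atTop, c * x ^ k ≤ Real.exp x := by
  filter_upwards [(Real.tendsto_exp_div_pow_atTop k).eventually_ge_atTop c,
    Filter.eventually_gt_atTop 0] with x hx hx0
  rwa [le_div_iff₀ (by positivity)] at hx

theorem exists_measure_levelSet_le {δ B K C cbar δ₀ r : ℝ} (hδ : 0 < δ) (hB : 0 < B)
    (hCK : 1 < C * K) (hcbar : 0 < cbar) (h : IsLCDConstant B δ₀ r) :
    ∃ ct : ℝ, 0 < ct ∧ ∃ n₀ : ℕ, ∀ (n : ℕ) (p : unitInterval), n₀ ≤ n →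
      (n : ℝ) ^ (-1 + δ) ≤ (p : ℝ) →
      ∀ lam : ℝ, |lam| ≤ K * Real.sqrt (p * n) →
      ∀ D : ℝ, 1 / cbar * (Real.sqrt n / ((n : ℝ) * p) ^ (1 / 32 : ℝ)) ≤ D →
        D ≤ Real.exp (((n : ℝ) * p) ^ (1 / 32 : ℝ)) →
      ∀ σ τ' : EuclideanSpace ℝ (Fin n) → Finset (Fin n),
        IsSpreadChoice (bigM n p) (rho C K n p) σ → IsTopChoice (bigM n p) (rho C K n p) τ' →
      ∀ ν : Measure ℝ, IsStandardSubgaussian ν B →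
      (Measure.pi fun _ : UpperIndex n => sparseLaw ν p)
        {w | ∃ v ∈ levelSet n p C K δ₀ D σ τ', ∑ i, rowForm lam (fun k => v k) i w ^ 2 ≤
          (ct * (Real.sqrt n / (((n : ℝ) * p) ^ (1 / 32 : ℝ) * D)) *
            ((n : ℝ) * p) ^ (7 / 16 : ℝ)) ^ 2} ≤ ENNReal.ofReal (Real.exp (-n)) := by
  obtain ⟨R, hR, hmass⟩ := h.exists_mass_le hB
  have hr := h.radius_mem_Ioo.1
  have hδ₀ := h.mem_Ioo.1
  have hCK0 : 0 < C * K := by linarith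
  set ρ₀ := (C * K) ^ (-⌈2 / δ⌉ - 6) with hρ₀
  have hρ₀0 : 0 < ρ₀ := zpow_pos hCK0 _
  set κ := Real.exp (-9) / (16 * (74 + 37 * cbar)) with hκ
  have hκ0 : 0 < κ := by positivity
  have hsδ : 0 < Real.sqrt δ₀ := Real.sqrt_pos.2 hδ₀
  -- The largest value allowed by `480 * ct ≤ κ² * (√δ₀ * r * ρ₀²)`, that is, by half of the row
  -- budget.
  set ct := κ ^ 2 * (Real.sqrt δ₀ * r * ρ₀ ^ 2) / 480 with hct
  have hct0 : 0 < ct := by positivity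
  have hev : ∀ᶠ x : ℝ in Filter.atTop, 12 ≤ x ∧ 4 ≤ ρ₀ ^ 2 * x ∧ 4 ≤ δ₀ * x ∧ cbar ≤ x ∧
      5 * (2 * (5 + cbar) * x ^ 10 + 1) ≤ Real.exp x ∧ 7 * x ^ 8 ≤ Real.exp x ∧
      R ^ 2 ≤ 6 * ct ^ 2 * x ∧ 32 * B ^ 2 + 2 * K ^ 2 ≤ ct ^ 2 * x ∧
      12 * x ≤ κ ^ 2 * Real.exp x := by
    filter_upwards [Filter.eventually_ge_atTop 12, eventually_le_mul (pow_pos hρ₀0 2) 4,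
      eventually_le_mul hδ₀ 4, Filter.eventually_ge_atTop cbar,
      eventually_mul_pow_le_exp (10 * (5 + cbar) + 5) 10, eventually_mul_pow_le_exp 7 8,
      eventually_le_mul (k := 6 * ct ^ 2) (by positivity) (R ^ 2),
      eventually_le_mul (pow_pos hct0 2) (32 * B ^ 2 + 2 * K ^ 2),
      eventually_mul_pow_le_exp (12 / κ ^ 2) 1] with x h1 h2 h3 h4 h5 h6 h7 h8 h9
    refine ⟨h1, h2, h3, h4, le_trans ?_ h5, h6, h7, h8, ?_⟩
    · have : (1 : ℝ) ≤ x ^ 10 := one_le_pow₀ (by linarith)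
      linarith
    · rw [pow_one, div_mul_eq_mul_div, div_le_iff₀ (by positivity)] at h9
      linarith
  obtain ⟨x₀, hx₀⟩ := Filter.eventually_atTop.1 hev
  -- `np ≥ n^δ` gives `x ≥ n^(δ/32)`, so large `n` makes `x` large uniformly in `p`.
  have hn₀ : ∀ᶠ n : ℕ in Filter.atTop, x₀ ≤ (n : ℝ) ^ (δ / 32) ∧ 2 ≤ n :=
    (((tendsto_rpow_atTop (by positivity : 0 < δ / 32)).comp
      tendsto_natCast_atTop_atTop).eventually_ge_atTop x₀).and (Filter.eventually_ge_atTop 2)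
  obtain ⟨n₀, hn₀⟩ := Filter.eventually_atTop.1 hn₀
  refine ⟨ct, hct0, n₀, fun n p hn hp lam hlam D hD1 hD2 σ τ' hσ hτ ν hν => ?_⟩
  obtain ⟨hnx, hn2⟩ := hn₀ n hn
  have hn1 : (1 : ℝ) < n := by exact_mod_cast hn2
  have hn0 : (0 : ℝ) < n := by linarith
  have hp0 : (0 : ℝ) < p := (Real.rpow_pos_of_pos hn0 _).trans_le hp
  have hp1 : (p : ℝ) ≤ 1 := p.2.2
  have hN0 : 0 < (n : ℝ) * p := by positivity
  set x := ((n : ℝ) * p) ^ (1 / 32 : ℝ) with hx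
  have hx0 : 0 < x := Real.rpow_pos_of_pos hN0 _
  have hxpow : ∀ k : ℕ, ((n : ℝ) * p) ^ (k / 32 : ℝ) = x ^ k := fun k => by
    rw [hx, ← Real.rpow_natCast, ← Real.rpow_mul hN0.le]; ring_nf
  have hnp : (n : ℝ) * p = x ^ 32 := by rw [← hxpow]; norm_num
  have hxx : x₀ ≤ x := by
    refine hnx.trans ?_
    have h1 : (n : ℝ) ^ δ ≤ n * p := by
      calc (n : ℝ) ^ δ = n * (n : ℝ) ^ (-1 + δ) := by
            rw [Real.rpow_add hn0, Real.rpow_neg_one, ← mul_assoc, mul_inv_cancel₀ hn0.ne', one_mul]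
        _ ≤ n * p := by gcongr
    calc (n : ℝ) ^ (δ / 32) = ((n : ℝ) ^ δ) ^ (1 / 32 : ℝ) := by
          rw [← Real.rpow_mul hn0.le]; ring_nf
      _ ≤ x := by rw [hx]; gcongr
  obtain ⟨h12, q2, q3, q4, q5, q6, q7, q8, q9⟩ := hx₀ x hxx
  have hM : bigM n p = n / x ^ 2 := by
    rw [bigM, ← hxpow 2]; norm_num
  have hα : alpha n p = 1 / x ^ 2 := by
    rw [alpha, ← hxpow 2, Real.rpow_neg hN0.le, one_div]; norm_num
  have hD1' : Real.sqrt n / x ≤ cbar * D := by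
    rw [one_div, inv_mul_le_iff₀ hcbar] at hD1
    exact hD1
  have hD0 : 0 < D := by
    have : 0 < cbar * D := lt_of_lt_of_le (div_pos (Real.sqrt_pos.2 hn0) hx0) hD1'
    exact pos_of_mul_pos_right this hcbar.le
  have hlam2 : lam ^ 2 ≤ K ^ 2 * x ^ 32 := by
    rw [← sq_abs, ← hnp]
    calc |lam| ^ 2 ≤ (K * Real.sqrt (p * n)) ^ 2 := by gcongr
      _ = K ^ 2 * (n * p) := by rw [mul_pow, Real.sq_sqrt (by positivity)]; ring
  have hρ := le_rho hδ hCK hn2 hp hp1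
  have hT : ct * (Real.sqrt n / (x * D)) * ((n : ℝ) * p) ^ (7 / 16 : ℝ) =
      ct * x ^ 13 * Real.sqrt n / D := by
    rw [show (7 / 16 : ℝ) = ((14 : ℕ) : ℝ) / 32 by norm_num, hxpow]
    field_simp
  simp only [hT, levelSet]
  rw [hM] at hσ hτ ⊢
  rw [hα]
  exact measure_level_le (coverParams_of_large h12 hp0 hp1 hnp hδ₀ h.mem_Ioo.2.le hρ₀0 hρ hcbar
      q2 q3 q4 q5 q6 hD1' hD2)
    (smallBallParams_of_large h12 hp0 hp1 hnp hδ₀ h.mem_Ioo.2.le hρ₀0 hρ hcbar hB hr hR hct0 hκ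
      (by rw [hct]; linarith) hlam2 q7 q8 q9 hD0 hD2) hσ hτ hν (hmass ν hν p)

end SparseSpectrum

namespace SparseSpectrum

/-! ### Invertibility of a shifted symmetric matrix with positive probability -/

/-- The first `k` rows of `symMat w - lam`, followed by rows of the identity. -/
def partialMat {n : ℕ} (lam : ℝ) (k : ℕ) (w : UpperIndex n → ℝ) : Matrix (Fin n) (Fin n) ℝ :=
  Matrix.of fun i j => if (i : ℕ) < k then symMat w i j - if i = j then lam else 0
    else if i = j then 1 else 0

variable {n : ℕ} {lam : ℝ}

lemma partialMat_zero (w : UpperIndex n → ℝ) : partialMat lam 0 w = 1 := by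
  ext i j
  simp [partialMat, Matrix.one_apply]

lemma measurable_det_partialMat (k : ℕ) :
    Measurable fun w : UpperIndex n → ℝ => (partialMat lam k w).det := by
  unfold partialMat symMat
  simp only [Matrix.det_apply', Matrix.of_apply]
  refine Finset.measurable_sum _ fun σ _ => Measurable.const_mul ?_ _
  refine Finset.measurable_prod _ fun i _ => ?_
  split_ifs <;> fun_prop

/-- The diagonal entry at `k` occurs only in row `k`, which is still a row of the identity. -/
lemma partialMat_update (k : Fin n) {j : ℕ} (hj : j ≤ k) (w : UpperIndex n → ℝ) (x : ℝ) :
    partialMat lam j (Function.update w (upperPair k k) x) = partialMat lam j w := by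
  ext i l
  simp only [partialMat, Matrix.of_apply, symMat]
  by_cases h1 : (i : ℕ) < j
  · have : upperPair i l ≠ upperPair k k := by
      intro h
      have h2 := upperPair_eq h
      have : i ≠ k := by rintro rfl; omega
      tauto
    rw [Function.update_of_ne this]
  · rw [if_neg h1, if_neg h1]

/-- Linearity in row `k`: replacing that row by the unit vector gives back the preceding partial
matrix, so the slope is its determinant. -/
lemma det_partialMat_update (k : Fin n) (w : UpperIndex n → ℝ) : ∃ c : ℝ, ∀ x : ℝ,
    (partialMat lam (k + 1) (Function.update w (upperPair k k) x)).det =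
      (x - lam) * (partialMat lam k w).det + c := by
  refine ⟨((partialMat lam k w).updateRow k
    fun l => if k = l then 0 else symMat w k l).det, fun x => ?_⟩
  have h1 : partialMat lam (k + 1) (Function.update w (upperPair k k) x) =
      (partialMat lam k w).updateRow k
        ((x - lam) • Pi.single k 1 + fun l => if k = l then 0 else symMat w k l) := by
    ext i l
    by_cases hi : i = k
    · subst hi
      rw [Matrix.updateRow_self]
      by_cases hl : i = l
      · subst hl
        simp [partialMat, symMat]
      · have : upperPair i l ≠ upperPair i i := fun h => hl ((upperPair_injective i h).symm)
        simp [partialMat, symMat, hl, Function.update_of_ne this, Ne.symm hl]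
    · rw [Matrix.updateRow_ne hi, ← partialMat_update k le_rfl w x]
      have : (i : ℕ) < k + 1 ↔ (i : ℕ) < k := by
        have : (i : ℕ) ≠ k := fun h => hi (Fin.ext h)
        omega
      simp only [partialMat, Matrix.of_apply, this]
  have h2 : (partialMat lam k w).updateRow k (Pi.single k 1) = partialMat lam k w := by
    ext i l
    by_cases hi : i = k
    · subst hi
      simp [partialMat, Pi.single_apply, eq_comm]
    · rw [Matrix.updateRow_ne hi]
  rw [h1, Matrix.det_updateRow_add, Matrix.det_updateRow_smul, h2]

lemma measurableSet_le_det (r : ℝ) (k : ℕ) :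
    MeasurableSet {w : UpperIndex n → ℝ |
      r * |(partialMat lam k w).det| ≤ |(partialMat lam (k + 1) w).det|} :=
  measurableSet_le ((measurable_det_partialMat k).abs.const_mul r)
    (measurable_det_partialMat (k + 1)).abs

/-- Integrate the diagonal entry at `k` with all others frozen. The earlier minors are unaffected,
and the new one is small relative to its predecessor only if the entry falls in an interval of
radius `r`. -/
lemma pow_le_measure_le_det (μ : Measure ℝ) [IsProbabilityMeasure μ] {r : ℝ} {q : ENNReal}
    (hq : ∀ u, q ≤ μ {x | r < |x - u|}) (k : ℕ) (hk : k ≤ n) :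
    q ^ k ≤ (Measure.pi fun _ : UpperIndex n => μ) {w | ∀ j < k,
      r * |(partialMat lam j w).det| ≤ |(partialMat lam (j + 1) w).det|} := by
  have hmeas : ∀ k, MeasurableSet {w : UpperIndex n → ℝ | ∀ j < k,
      r * |(partialMat lam j w).det| ≤ |(partialMat lam (j + 1) w).det|} := by
    intro k
    simp only [Set.ofPred_forall]
    exact MeasurableSet.iInter fun j => MeasurableSet.iInter fun _ => measurableSet_le_det r j
  induction k with
  | zero => simp
  | succ k ih =>
    refine (pow_succ' q k).trans_le ((mul_le_mul_right (ih (by omega)) q).trans ?_)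
    rw [← lintegral_indicator_one (hmeas _), ← lintegral_indicator_one (hmeas _),
      ← lintegral_const_mul _ (measurable_one.indicator (hmeas _))]
    set κ : Fin n := ⟨k, hk⟩ with hκ
    refine lintegral_le_of_lmarginal_le {upperPair κ κ}
      ((measurable_one.indicator (hmeas _)).const_mul q) (measurable_one.indicator (hmeas _)) ?_
    rw [lmarginal_singleton, lmarginal_singleton]
    intro w
    have hupd : ∀ j ≤ k, ∀ x, partialMat lam j (Function.update w (upperPair κ κ) x) =
        partialMat lam j w := fun j hj x => partialMat_update κ hj w x
    by_cases hw : ∀ j < k, r * |(partialMat lam j w).det| ≤ |(partialMat lam (j + 1) w).det|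
    · obtain ⟨c, hc⟩ := det_partialMat_update (lam := lam) κ w
      have hmem : ∀ x, r * |(partialMat lam k w).det| ≤ |(x - lam) * (partialMat lam k w).det + c| →
          Function.update w (upperPair κ κ) x ∈ {w : UpperIndex n → ℝ | ∀ j < k + 1,
            r * |(partialMat lam j w).det| ≤ |(partialMat lam (j + 1) w).det|} := by
        intro x hx j hj
        rcases Nat.lt_succ_iff_lt_or_eq.1 hj with h | rfl
        · rw [hupd j h.le, hupd (j + 1) h]; exact hw j h
        · rw [hupd j le_rfl]
          exact hx.trans_eq (by rw [hc x])
      obtain ⟨u, hu⟩ : ∃ u, {x | r < |x - u|} ⊆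
          {x | r * |(partialMat lam k w).det| ≤ |(x - lam) * (partialMat lam k w).det + c|} := by
        set d := (partialMat lam k w).det with hd
        by_cases hd0 : d = 0
        · exact ⟨0, fun x _ => by simp [hd0]⟩
        · refine ⟨lam - c / d, fun x hx => ?_⟩
          have : (x - lam) * d + c = (x - (lam - c / d)) * d := by field_simp; ring
          rw [Set.mem_ofPred_eq, this, abs_mul]
          have : r < |x - (lam - c / d)| := hx
          gcongr
      calc _ ≤ ∫⁻ _, q ∂μ := by
            refine lintegral_mono fun x => ?_
            simp only [Set.indicator_apply]
            split_ifs <;> simp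
        _ = q := by simp
        _ ≤ μ {x | r < |x - u|} := hq u
        _ = ∫⁻ x, Set.indicator {x | r < |x - u|} 1 x ∂μ :=
            (lintegral_indicator_one (measurableSet_lt (by fun_prop) (by fun_prop))).symm
        _ ≤ _ := by
            refine lintegral_mono fun x => ?_
            by_cases hx : x ∈ {x | r < |x - u|}
            · rw [Set.indicator_of_mem hx, Set.indicator_of_mem (hmem x (hu hx))]
              rfl
            · rw [Set.indicator_of_notMem hx]
              exact zero_le
    · have : ∀ x, Function.update w (upperPair κ κ) x ∉ {w : UpperIndex n → ℝ | ∀ j < k,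
            r * |(partialMat lam j w).det| ≤ |(partialMat lam (j + 1) w).det|} := by
        intro x hx
        refine hw fun j hj => ?_
        have := hx j hj
        rwa [hupd j hj.le, hupd (j + 1) hj] at this
      simp [this]

lemma pow_le_abs_det {r : ℝ} (hr : 0 ≤ r) {w : UpperIndex n → ℝ} (k : ℕ)
    (h : ∀ j < k, r * |(partialMat lam j w).det| ≤ |(partialMat lam (j + 1) w).det|) :
    r ^ k ≤ |(partialMat lam k w).det| := by
  induction k with
  | zero => simp [partialMat_zero]
  | succ k ih =>
    rw [pow_succ']
    exact (mul_le_mul_of_nonneg_left (ih fun j hj => h j (by omega)) hr).trans (h k (by omega))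

/-- Cramer: `det A • v` is the adjugate applied to `A v`. Cofactors are determinants with one row
replaced by a unit vector, and `1 ≤ L` keeps their entries below `L`. -/
lemma abs_det_mul_le {A : Matrix (Fin n) (Fin n) ℝ} {L τ : ℝ} (hL : 1 ≤ L)
    (hA : ∀ i j, |A i j| ≤ L) {v : Fin n → ℝ} (hv : ∀ j, |A.mulVec v j| ≤ τ) (i : Fin n) :
    |A.det| * |v i| ≤ n * (n.factorial * L ^ n * τ) := by
  have h1 : A.det * v i = ∑ j, A.adjugate i j * A.mulVec v j := by
    have : (A.adjugate * A).mulVec v = A.adjugate.mulVec (A.mulVec v) :=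
      (Matrix.mulVec_mulVec _ _ _).symm
    rw [Matrix.adjugate_mul, Matrix.smul_mulVec, Matrix.one_mulVec] at this
    have := congrFun this i
    simpa [Matrix.mulVec, dotProduct] using this
  have h2 : ∀ i j, |A.adjugate i j| ≤ n.factorial * L ^ n := by
    intro i j
    rw [Matrix.adjugate_apply]
    have := Matrix.det_le (A := A.updateRow j (Pi.single i 1)) (abv := AbsoluteValue.abs) (x := L)
      (fun a b => ?_)
    · simpa [nsmul_eq_mul] using this
    · rw [AbsoluteValue.abs_apply]
      by_cases ha : a = j
      · subst ha
        rw [Matrix.updateRow_self, Pi.single_apply]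
        split_ifs <;> simp <;> linarith
      · rw [Matrix.updateRow_ne ha]
        exact hA a b
  rw [← abs_mul, h1]
  calc _ ≤ ∑ j, |A.adjugate i j * A.mulVec v j| := Finset.abs_sum_le_sum_abs _ _
    _ ≤ ∑ _j : Fin n, (n.factorial * L ^ n * τ) := by
        refine Finset.sum_le_sum fun j _ => ?_
        rw [abs_mul]
        exact mul_le_mul (h2 i j) (hv j) (abs_nonneg _) (by positivity)
    _ = _ := by simp

end SparseSpectrum

/-! ### From determinants to a smallest singular value, and reduction to product laws -/

namespace SparseSpectrum

/-- Otherwise every coordinate of `v` would be at most `1/(2n)`, too small for a unit vector. -/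
lemma not_sum_sq_le_of_le_abs_det {n : ℕ} {A : Matrix (Fin n) (Fin n) ℝ} {d L : ℝ} (hd : 0 < d)
    (hL : 1 ≤ L) (hA : ∀ i j, |A i j| ≤ L) (hdet : d ≤ |A.det|) {v : EuclideanSpace ℝ (Fin n)}
    (hv : ‖v‖ = 1) :
    ¬ ∑ i, A.mulVec (fun k => v k) i ^ 2 ≤ (d / (2 * n ^ 2 * (n.factorial * L ^ n))) ^ 2 := by
  intro hle
  set τ := d / (2 * (n : ℝ) ^ 2 * (n.factorial * L ^ n)) with hτ
  have hn : (0 : ℝ) < n := by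
    rcases Nat.eq_zero_or_pos n with rfl | h
    · have : v = 0 := by ext i; exact i.elim0
      simp [this] at hv
    · exact_mod_cast h
  have hfac : (0 : ℝ) < n.factorial := by exact_mod_cast n.factorial_pos
  have hL0 : 0 < L := by linarith
  have hτ0 : 0 < τ := by positivity
  have h1 : ∀ j, |A.mulVec (fun k => v k) j| ≤ τ := fun j => by
    refine abs_le_of_sq_le_sq ?_ hτ0.le
    exact (Finset.single_le_sum (f := fun i => A.mulVec (fun k => v k) i ^ 2)
      (fun i _ => sq_nonneg _) (Finset.mem_univ j)).trans hle
  have h2 : ∀ i, |v i| ≤ 1 / (2 * n) := fun i => by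
    have h3 := abs_det_mul_le hL hA h1 i
    have h4 : d * |v i| ≤ n * (n.factorial * L ^ n * τ) :=
      (mul_le_mul_of_nonneg_right hdet (abs_nonneg _)).trans h3
    have h5 : n * (n.factorial * L ^ n * τ) = d * (1 / (2 * n)) := by
      rw [hτ]; field_simp
    rw [h5] at h4
    exact le_of_mul_le_mul_left h4 hd
  have h3 : ∑ i, v i ^ 2 = 1 := by
    have := EuclideanSpace.norm_sq_eq v
    simpa [hv, sq_abs] using this.symm
  have h4 : ∑ i, v i ^ 2 ≤ ∑ _i : Fin n, (1 / (2 * (n : ℝ))) ^ 2 := by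
    refine Finset.sum_le_sum fun i _ => ?_
    rw [← sq_abs]
    have := h2 i
    gcongr
  rw [h3, Finset.sum_const, Finset.card_univ, Fintype.card_fin, nsmul_eq_mul] at h4
  have h5 : (n : ℝ) * (1 / (2 * n)) ^ 2 = 1 / (4 * n) := by field_simp; norm_num
  have hn1 : (1 : ℝ) ≤ n := by
    have : 0 < n := by exact_mod_cast hn
    exact_mod_cast this
  rw [h5, le_div_iff₀ (by positivity)] at h4
  linarith

lemma rowForm_eq_mulVec {n : ℕ} (lam : ℝ) (w : UpperIndex n → ℝ) (v : Fin n → ℝ) (i : Fin n) :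
    rowForm lam v i w = (symMat w - lam • (1 : Matrix (Fin n) (Fin n) ℝ)).mulVec v i := by
  rw [Matrix.sub_mulVec, Matrix.smul_mulVec, Matrix.one_mulVec]
  rfl

lemma partialMat_self {n : ℕ} (lam : ℝ) (w : UpperIndex n → ℝ) :
    partialMat lam n w = symMat w - lam • (1 : Matrix (Fin n) (Fin n) ℝ) := by
  ext i j
  simp [partialMat, Matrix.one_apply]

lemma measure_exists_lt_abs_le {ι : Type*} [Fintype ι] (μ : Measure ℝ) [IsProbabilityMeasure μ]
    (R : ℝ) {q : ENNReal} (hq : μ {x | R < |x|} ≤ q) :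
    (Measure.pi fun _ : ι => μ) {w | ∃ e, R < |w e|} ≤ Fintype.card ι * q := by
  have : {w : ι → ℝ | ∃ e, R < |w e|} = ⋃ e, Function.eval e ⁻¹' {x | R < |x|} := by
    ext w; simp
  rw [this]
  refine (measure_iUnion_fintype_le _ _).trans ?_
  calc _ ≤ ∑ _e : ι, q := by
        refine Finset.sum_le_sum fun e _ => ?_
        rw [(measurePreserving_eval (fun _ : ι => μ) e).measure_preimage
          (measurableSet_lt (by fun_prop) (by fun_prop)).nullMeasurableSet]
        exact hq
    _ = _ := by simp

/-- In a fixed dimension, a shifted sparse matrix is well invertible with positive probability. -/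
lemma exists_measure_exists_small_le {B δ₀ r p₀ : ℝ} (h : IsLCDConstant B δ₀ r) (hB : 0 < B)
    (hp₀ : 0 < p₀) (n : ℕ) (Λ : ℝ) :
    ∃ τ : ℝ, 0 < τ ∧ ∃ η : ℝ, 0 < η ∧ η < 1 ∧ ∀ (p : unitInterval), p₀ ≤ p →
      ∀ lam : ℝ, |lam| ≤ Λ → ∀ ν : Measure ℝ, IsStandardSubgaussian ν B →
      (Measure.pi fun _ : UpperIndex n => sparseLaw ν p) {w | ∃ v : EuclideanSpace ℝ (Fin n),
        ‖v‖ = 1 ∧ ∑ i, rowForm lam (fun k => v k) i w ^ 2 ≤ τ ^ 2} ≤ ENNReal.ofReal (1 - η) := by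
  have hr := h.radius_mem_Ioo.1
  have hδ₀ := h.mem_Ioo.1
  set q := min (1 / 2) (δ₀ * p₀) with hqdef
  have hq0 : 0 < q := lt_min (by norm_num) (by positivity)
  have hq1 : q < 1 := (min_le_left _ _).trans_lt (by norm_num)
  -- The union bound over the entries then costs at most half of the probability `q^n` that the
  -- determinant is large.
  set ε := q ^ n / (2 * (Fintype.card (UpperIndex n) + 1)) with hε
  have hε0 : 0 < ε := by positivity
  obtain ⟨R, hR0, hR⟩ : ∃ R : ℝ, 0 < R ∧ 2 * Real.exp (-R ^ 2 / B ^ 2) ≤ ε := by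
    have ht : Filter.Tendsto (fun R : ℝ => 2 * Real.exp (-R ^ 2 / B ^ 2)) Filter.atTop
        (nhds (2 * 0)) := by
      refine Filter.Tendsto.const_mul _ (Real.tendsto_exp_atBot.comp ?_)
      refine Filter.Tendsto.atBot_div_const (by positivity) ?_
      exact Filter.tendsto_neg_atTop_atBot.comp (Filter.tendsto_pow_atTop two_ne_zero)
    rw [mul_zero] at ht
    obtain ⟨R, hR, hR0⟩ := ((ht.eventually (ge_mem_nhds hε0)).and
      (Filter.eventually_gt_atTop 0)).exists
    exact ⟨R, hR0, hR⟩
  set L := R + |Λ| + 1 with hL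
  have hL1 : 1 ≤ L := by have := abs_nonneg Λ; linarith
  have hd : 0 < r ^ n := pow_pos hr n
  have hqn : q ^ n ≤ 1 := pow_le_one₀ hq0.le hq1.le
  refine ⟨if n = 0 then 1 else r ^ n / (2 * n ^ 2 * (n.factorial * L ^ n)), ?_, q ^ n / 2,
    by positivity, by linarith, fun p hp lam hlam ν hν => ?_⟩
  · split_ifs with hn
    · exact one_pos
    · have : (0 : ℝ) < n := by exact_mod_cast Nat.pos_of_ne_zero hn
      have hfac : (0 : ℝ) < n.factorial := by exact_mod_cast n.factorial_pos
      positivity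
  have := hν.isProbabilityMeasure
  set π := Measure.pi fun _ : UpperIndex n => sparseLaw ν p with hπ
  set G := {w : UpperIndex n → ℝ | ∀ j < n,
      r * |(partialMat lam j w).det| ≤ |(partialMat lam (j + 1) w).det|} with hG
  have hGm : MeasurableSet G := by
    simp only [hG, Set.ofPred_forall]
    exact MeasurableSet.iInter fun j => MeasurableSet.iInter fun _ => measurableSet_le_det r j
  have hGq : ENNReal.ofReal (q ^ n) ≤ π G := by
    rw [ENNReal.ofReal_pow hq0.le]
    refine pow_le_measure_le_det _ (fun u => ?_) n le_rfl
    have h1 := h.measure_le hν p u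
    have hm : MeasurableSet {x : ℝ | |x - u| ≤ r} := measurableSet_le (by fun_prop) (by fun_prop)
    have h2 := measureReal_compl (μ := sparseLaw ν p) hm
    have h3 : {x : ℝ | |x - u| ≤ r}ᶜ = {x | r < |x - u|} := by ext x; simp
    rw [h3, probReal_univ] at h2
    rw [← ofReal_measureReal, h2]
    refine ENNReal.ofReal_le_ofReal ((min_le_right _ _).trans ?_)
    have : δ₀ * p₀ ≤ δ₀ * p := by gcongr
    linarith
  have htail : sparseLaw ν p {x | R < |x|} ≤ ENNReal.ofReal ε := by
    rw [← ofReal_measureReal]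
    refine ENNReal.ofReal_le_ofReal (((sparseLaw_tail_le hν p hR0)).trans (le_trans ?_ hR))
    have : (0 : ℝ) ≤ 2 * Real.exp (-R ^ 2 / B ^ 2) := by positivity
    exact mul_le_of_le_one_left this p.2.2
  have hbig := measure_exists_lt_abs_le (ι := UpperIndex n) (sparseLaw ν p) R htail
  have hsub : {w : UpperIndex n → ℝ | ∃ v : EuclideanSpace ℝ (Fin n), ‖v‖ = 1 ∧
      ∑ i, rowForm lam (fun k => v k) i w ^ 2 ≤
        (if n = 0 then 1 else r ^ n / (2 * n ^ 2 * (n.factorial * L ^ n))) ^ 2} ⊆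
      Gᶜ ∪ {w | ∃ e, R < |w e|} := by
    rintro w ⟨v, hv, hle⟩
    by_contra hc
    simp only [Set.mem_union, Set.mem_compl_iff, not_or, not_not, Set.mem_ofPred_eq, not_exists,
      not_lt] at hc
    have hn : n ≠ 0 := by
      rintro rfl
      have : v = 0 := by ext i; exact i.elim0
      simp [this] at hv
    rw [if_neg hn] at hle
    simp only [rowForm_eq_mulVec] at hle
    refine not_sum_sq_le_of_le_abs_det hd hL1 (fun i j => ?_) ?_ hv hle
    · rw [Matrix.sub_apply, Matrix.smul_apply, Matrix.one_apply]
      have h1 := hc.2 (upperPair i j)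
      have h2 : |lam • (if i = j then (1 : ℝ) else 0)| ≤ |Λ| := by
        split_ifs
        · simpa using hlam.trans (le_abs_self _)
        · simp
      calc _ ≤ |symMat w i j| + |lam • (if i = j then (1 : ℝ) else 0)| := abs_sub _ _
        _ ≤ R + |Λ| := add_le_add h1 h2
        _ ≤ L := by linarith
    · rw [← partialMat_self]
      exact pow_le_abs_det hr.le n hc.1
  refine (measure_mono hsub).trans ((measure_union_le _ _).trans ?_)
  calc _ ≤ (1 - ENNReal.ofReal (q ^ n)) + Fintype.card (UpperIndex n) * ENNReal.ofReal ε := by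
        gcongr
        rw [prob_compl_eq_one_sub hGm]
        gcongr
    _ = ENNReal.ofReal (1 - q ^ n + Fintype.card (UpperIndex n) * ε) := by
        rw [ENNReal.ofReal_add (by linarith) (by positivity), ENNReal.ofReal_sub _ (by positivity),
          ENNReal.ofReal_one, ENNReal.ofReal_mul (by positivity), ENNReal.ofReal_natCast]
    _ ≤ ENNReal.ofReal (1 - q ^ n / 2) := by
        refine ENNReal.ofReal_le_ofReal ?_
        have : (Fintype.card (UpperIndex n) : ℝ) * ε ≤ q ^ n / 2 := by
          rw [hε, ← mul_div_assoc, div_le_div_iff₀ (by positivity) (by norm_num)]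
          have : 0 ≤ q ^ n := by positivity
          nlinarith
        linarith

/-! ### The law of a sparse symmetric matrix -/

lemma symMat_eq {n : ℕ} {A : Matrix (Fin n) (Fin n) ℝ} (hA : A.IsSymm) :
    symMat (fun e : UpperIndex n => A e.1.1 e.1.2) = A := by
  ext i j
  simp only [symMat, upperPair]
  rcases le_total i j with h | h
  · rw [min_eq_left h, max_eq_right h]
  · rw [min_eq_right h, max_eq_left h]
    exact hA.apply i j

/-- Independence over the disjoint union of the two index sets is a product law; regrouping it into
pairs by position and multiplying within each pair gives the law of the entries. -/
lemma IsSparseSymmetric.exists_map_eq {Ω : Type*} [MeasurableSpace Ω] {μ : Measure Ω}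
    [IsProbabilityMeasure μ] {ν : Measure ℝ} [IsProbabilityMeasure ν] {p : unitInterval} {n : ℕ}
    {A : Ω → Matrix (Fin n) (Fin n) ℝ} (h : IsSparseSymmetric μ ν p A) :
    AEMeasurable (fun ω (e : UpperIndex n) => A ω e.1.1 e.1.2) μ ∧
      μ.map (fun ω (e : UpperIndex n) => A ω e.1.1 e.1.2) =
        Measure.pi fun _ : UpperIndex n => sparseLaw ν p := by
  obtain ⟨δ, ξ, hδ, hξ, hind, hA⟩ := h.exists_factors
  set β := bernoulliMeasure (1 : ℝ) 0 p with hβ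
  have hf : ∀ i, AEMeasurable (Sum.elim δ ξ i) μ := by
    rintro (e | e)
    · exact (hδ e).aemeasurable
    · exact (hξ e).aemeasurable
  have hmap := (iIndepFun_iff_map_fun_eq_pi_map hf).1 hind
  have hlaw : ∀ i, μ.map (Sum.elim δ ξ i) =
      Sum.elim (fun _ : UpperIndex n => β) (fun _ : UpperIndex n => ν) i := by
    rintro (e | e)
    · exact (hδ e).map_eq
    · exact (hξ e).map_eq
  have hprob : ∀ i, IsProbabilityMeasure
      (Sum.elim (fun _ : UpperIndex n => β) (fun _ : UpperIndex n => ν) i) := by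
    rintro (e | e) <;> simp only [Sum.elim_inl, Sum.elim_inr] <;> infer_instance
  simp_rw [hlaw] at hmap
  have h1 := measurePreserving_sumPiEquivProdPi
    (Sum.elim (fun _ : UpperIndex n => β) (fun _ : UpperIndex n => ν))
  have h2 := (measurePreserving_arrowProdEquivProdArrow ℝ ℝ (UpperIndex n) (fun _ => β)
    (fun _ => ν)).symm
  have h3 := h2.comp h1
  have hmul : Measurable fun z : ℝ × ℝ => z.1 * z.2 := by fun_prop
  have h4 : MeasurePreserving (fun (z : UpperIndex n → ℝ × ℝ) e => (z e).1 * (z e).2)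
      (Measure.pi fun _ => β.prod ν) (Measure.pi fun _ => sparseLaw ν p) := by
    refine ⟨by fun_prop, ?_⟩
    have hs : IsProbabilityMeasure ((β.prod ν).map fun z => z.1 * z.2) :=
      inferInstanceAs (IsProbabilityMeasure (sparseLaw ν p))
    exact Measure.pi_map_pi (fun _ => hmul.aemeasurable)
  have h5 := h4.comp h3
  have h6 : AEMeasurable (fun ω i => Sum.elim δ ξ i ω) μ := aemeasurable_pi_lambda _ hf
  have h7 : (fun ω (e : UpperIndex n) => A ω e.1.1 e.1.2) =
      ((fun (z : UpperIndex n → ℝ × ℝ) e => (z e).1 * (z e).2) ∘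
        (MeasurableEquiv.arrowProdEquivProdArrow ℝ ℝ (UpperIndex n)).symm ∘
        (MeasurableEquiv.sumPiEquivProdPi fun _ : UpperIndex n ⊕ UpperIndex n => ℝ)) ∘
        (fun ω i => Sum.elim δ ξ i ω) := by
    ext ω e
    exact hA ω e
  rw [h7]
  refine ⟨h5.measurable.comp_aemeasurable h6, ?_⟩
  rw [← AEMeasurable.map_map_of_aemeasurable h5.measurable.aemeasurable h6, hmap]
  exact h5.map_eq

end SparseSpectrum

/-! ### Bounded dimensions and transfer to the random matrix -/

namespace SparseSpectrum

lemma exists_pos_forall_lt_le {f : ℕ → ℝ} (hf : ∀ n, 0 < f n) (N : ℕ) :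
    ∃ c : ℝ, 0 < c ∧ ∀ n < N, c ≤ f n := by
  induction N with
  | zero => exact ⟨1, one_pos, by simp⟩
  | succ N ih =>
    obtain ⟨c, hc, h⟩ := ih
    refine ⟨min c (f N), lt_min hc (hf N), fun n hn => ?_⟩
    rcases Nat.lt_succ_iff_lt_or_eq.1 hn with h1 | rfl
    · exact (min_le_left _ _).trans (h n h1)
    · exact min_le_right _ _

/-- Uniform invertibility over all dimensions below a given one. -/
lemma exists_measure_exists_small_le_of_lt {δ B δ₀ r : ℝ} (h : IsLCDConstant B δ₀ r)
    (hB : 0 < B) (K : ℝ) (N : ℕ) :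
    ∃ τ : ℝ, 0 < τ ∧ ∃ c : ℝ, 0 < c ∧ ∀ (n : ℕ) (p : unitInterval), n < N → 1 ≤ n →
      (n : ℝ) ^ (-1 + δ) ≤ p → ∀ lam : ℝ, |lam| ≤ K * Real.sqrt (p * n) →
      ∀ ν : Measure ℝ, IsStandardSubgaussian ν B →
      (Measure.pi fun _ : UpperIndex n => sparseLaw ν p) {w | ∃ v : EuclideanSpace ℝ (Fin n),
        ‖v‖ = 1 ∧ ∑ i, rowForm lam (fun k => v k) i w ^ 2 ≤ τ ^ 2} ≤
        ENNReal.ofReal (Real.exp (-c * n)) := by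
  have hpos : ∀ n : ℕ, 0 < ((n : ℝ) + 1) ^ (-1 + δ) := fun n => by positivity
  -- The index is shifted by one because only `n ≥ 1` matters; then `n^(-1+δ)` is a positive lower
  -- bound for `p`.
  choose τ hτ η hη hη1 hmain using fun n : ℕ =>
    exists_measure_exists_small_le h hB (hpos n) (n + 1) (|K| * Real.sqrt ((n + 1 : ℕ) : ℝ))
  obtain ⟨τ₁, hτ₁, hτle⟩ := exists_pos_forall_lt_le hτ N
  obtain ⟨c, hc, hcle⟩ := exists_pos_forall_lt_le (f := fun n : ℕ => η n / (n + 1))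
    (fun n => div_pos (hη n) (by positivity)) N
  refine ⟨τ₁, hτ₁, c, hc, fun n p hn h1 hp lam hlam ν hν => ?_⟩
  obtain ⟨k, rfl⟩ : ∃ k, n = k + 1 := ⟨n - 1, by omega⟩
  have hlam' : |lam| ≤ |K| * Real.sqrt ((k + 1 : ℕ) : ℝ) := by
    refine hlam.trans ?_
    refine mul_le_mul (le_abs_self K) (Real.sqrt_le_sqrt ?_) (Real.sqrt_nonneg _) (abs_nonneg K)
    exact mul_le_of_le_one_left (by positivity) p.2.2
  have h2 := hmain k p (by exact_mod_cast hp) lam hlam' ν hν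
  have hkN : k < N := by omega
  refine (measure_mono ?_).trans (h2.trans (ENNReal.ofReal_le_ofReal ?_))
  · rintro w ⟨v, hv, hle⟩
    exact ⟨v, hv, hle.trans (by have := hτle k hkN; gcongr)⟩
  · have h3 : c * ((k + 1 : ℕ) : ℝ) ≤ η k := by
      have := hcle k hkN
      rw [le_div_iff₀ (by positivity)] at this
      exact_mod_cast this
    have := Real.add_one_le_exp (-c * ((k + 1 : ℕ) : ℝ))
    linarith

/-- The event need not be measurable, as the choices of `σ` and `τ'` are arbitrary. The inequality
between the measure of a preimage and the image measure that is used holds for every set. -/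
lemma measureReal_exists_norm_toEuclideanLin_le {Ω : Type*} [MeasurableSpace Ω] {μ : Measure Ω}
    [IsProbabilityMeasure μ] {ν : Measure ℝ} [IsProbabilityMeasure ν] {p : unitInterval} {n : ℕ}
    {A : Ω → Matrix (Fin n) (Fin n) ℝ} (h : IsSparseSymmetric μ ν p A) (lam : ℝ)
    (V : Set (EuclideanSpace ℝ (Fin n))) {T q : ℝ} (hT : 0 ≤ T) (hq : 0 ≤ q)
    (hle : (Measure.pi fun _ : UpperIndex n => sparseLaw ν p)
      {w | ∃ v ∈ V, ∑ i, rowForm lam (fun k => v k) i w ^ 2 ≤ T ^ 2} ≤ ENNReal.ofReal q) :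
    μ.real {ω | ∃ v ∈ V,
      ‖Matrix.toEuclideanLin (A ω - lam • (1 : Matrix (Fin n) (Fin n) ℝ)) v‖ ≤ T} ≤ q := by
  obtain ⟨hm, hmap⟩ := h.exists_map_eq
  refine ENNReal.toReal_le_of_le_ofReal hq (le_trans (le_of_eq ?_)
    ((Measure.le_map_apply hm _).trans (hmap ▸ hle)))
  congr 1
  ext ω
  simp only [Set.mem_ofPred_eq, Set.mem_preimage]
  refine exists_congr fun v => and_congr_right fun _ => ?_
  rw [← sq_le_sq₀ (norm_nonneg _) hT, EuclideanSpace.norm_sq_eq]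
  simp only [rowForm_eq_mulVec, symMat_eq (h.isSymm ω), Real.norm_eq_abs, sq_abs]
  rfl

end SparseSpectrum

/-! ### Assembly of the two regimes -/

theorem mainTheorem4 (δ B K C cbar : ℝ) (hδ : 0 < δ) (hB : 0 < B) (hK : 0 < K)
    (hCK : 1 < C * K) (hcbar : 0 < cbar) :
    (∃ δ₀ r : ℝ, SparseSpectrum.IsLCDConstant B δ₀ r) ∧
    ∀ δ₀ r : ℝ, SparseSpectrum.IsLCDConstant B δ₀ r →
      ∃ c c'' ctilde : ℝ, 0 < c ∧ 0 < c'' ∧ 0 < ctilde ∧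
        ∀ (n : ℕ) (p : unitInterval), 1 ≤ n → (n : ℝ) ^ (-1 + δ) ≤ (p : ℝ) →
        ∀ lam ∈ Set.Icc (-(K * Real.sqrt (p * n))) (K * Real.sqrt (p * n)),
        ∀ D : ℝ, 1 / cbar * ((n : ℝ) ^ (1 / 2 : ℝ) / ((p : ℝ) * n) ^ (1 / 32 : ℝ)) ≤ D →
          D ≤ Real.exp (((n : ℝ) * p) ^ (1 / 32 : ℝ)) →
        ∀ σ τ' : EuclideanSpace ℝ (Fin n) → Finset (Fin n),
          SparseSpectrum.IsSpreadChoice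
            (SparseSpectrum.bigM n p) (SparseSpectrum.rho C K n p) σ →
          SparseSpectrum.IsTopChoice
            (SparseSpectrum.bigM n p) (SparseSpectrum.rho C K n p) τ' →
        ∀ ν : Measure ℝ, SparseSpectrum.IsStandardSubgaussian ν B →
        ∀ (Ω : Type*) [MeasurableSpace Ω] (μ : Measure Ω) [IsProbabilityMeasure μ]
          (A : Ω → Matrix (Fin n) (Fin n) ℝ), SparseSpectrum.IsSparseSymmetric μ ν p A →
        ∀ ε₀ : ℝ, ε₀ = c * ((n : ℝ) ^ (1 / 2 : ℝ) / (((n : ℝ) * p) ^ (1 / 32 : ℝ) * D)) →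
          μ.real {ω | ∃ v ∈ SparseSpectrum.levelSet n p C K δ₀ D σ τ',
              ‖Matrix.toEuclideanLin (A ω - lam • (1 : Matrix (Fin n) (Fin n) ℝ)) v‖ ≤
                ctilde * ε₀ * ((p : ℝ) * n) ^ (7 / 16 : ℝ)}
            ≤ Real.exp (-c'' * n)
  := by
  refine ⟨SparseSpectrum.exists_isLCDConstant hB, fun δ₀ r h => ?_⟩
  obtain ⟨ct, hct, n₀, hlarge⟩ :=
    SparseSpectrum.exists_measure_levelSet_le hδ hB hCK hcbar h
  obtain ⟨τ, hτ, c₁, hc₁, hsmall⟩ :=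
    SparseSpectrum.exists_measure_exists_small_le_of_lt (δ := δ) h hB K n₀
  have hden : 0 < cbar * ((n₀ : ℝ) + 1) := by positivity
  -- `c = 1` is harmless, since only `ctilde * ε₀` enters. The second bound on `ctilde` brings the
  -- threshold below `τ` in all dimensions under `n₀`.
  refine ⟨1, min 1 c₁, min ct (τ / (cbar * (n₀ + 1))), one_pos, lt_min one_pos hc₁,
    lt_min hct (div_pos hτ hden), ?_⟩
  intro n p hn hp lam hlam D hD1 hD2 σ τ' hσ hτ' ν hν Ω _ μ _ A hA ε₀ hε₀
  have := hν.isProbabilityMeasure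
  rw [one_mul, ← Real.sqrt_eq_rpow] at hε₀
  rw [← Real.sqrt_eq_rpow, mul_comm (p : ℝ) n] at hD1
  have hn1 : (1 : ℝ) ≤ n := by exact_mod_cast hn
  have hn0 : (0 : ℝ) < n := by linarith
  have hp0 : (0 : ℝ) < p := (Real.rpow_pos_of_pos hn0 _).trans_le hp
  have hN0 : 0 < (n : ℝ) * p := by positivity
  have hx0 : 0 < ((n : ℝ) * p) ^ (1 / 32 : ℝ) := Real.rpow_pos_of_pos hN0 _
  have hsn : 0 < Real.sqrt n := Real.sqrt_pos.2 hn0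
  have hD0 : 0 < D := lt_of_lt_of_le (by positivity) hD1
  have hε0 : 0 < ε₀ := by rw [hε₀]; positivity
  -- The lower bound on `D` makes the threshold bounded in bounded dimension, where mere
  -- invertibility is available.
  have hε1 : ε₀ ≤ cbar := by
    rw [hε₀, ← div_div, div_le_iff₀ hD0]
    rwa [one_div, inv_mul_le_iff₀ hcbar] at hD1
  have hlam' : |lam| ≤ K * Real.sqrt (p * n) := abs_le.2 hlam
  have hmt : 0 < min ct (τ / (cbar * ((n₀ : ℝ) + 1))) := lt_min hct (div_pos hτ hden)
  have h7 : 0 < ((n : ℝ) * p) ^ (7 / 16 : ℝ) := Real.rpow_pos_of_pos hN0 _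
  rw [mul_comm (p : ℝ) n]
  refine SparseSpectrum.measureReal_exists_norm_toEuclideanLin_le hA lam _
    (by positivity) (Real.exp_nonneg _) ?_
  rcases le_or_gt n₀ n with hnn | hnn
  · refine (measure_mono ?_).trans ((hlarge n p hnn hp lam hlam' D hD1 hD2 σ τ' hσ hτ' ν hν).trans
      (ENNReal.ofReal_le_ofReal (Real.exp_le_exp.2 ?_)))
    · rintro w ⟨v, hv, hle⟩
      refine ⟨v, hv, hle.trans ?_⟩
      rw [← hε₀]
      gcongr
      exact min_le_left _ _
    · have := mul_le_mul_of_nonneg_right (min_le_left 1 c₁) hn0.le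
      linarith
  · refine (measure_mono ?_).trans ((hsmall n p hnn hn hp lam hlam' ν hν).trans
      (ENNReal.ofReal_le_ofReal (Real.exp_le_exp.2 ?_)))
    · rintro w ⟨v, hv, hle⟩
      refine ⟨v, hv.1.1, hle.trans ?_⟩
      have h8 : ((n : ℝ) * p) ^ (7 / 16 : ℝ) ≤ n₀ + 1 := by
        have hnn' : (n : ℝ) ≤ n₀ + 1 := by exact_mod_cast (hnn.le.trans (Nat.le_succ _))
        calc ((n : ℝ) * p) ^ (7 / 16 : ℝ) ≤ (n : ℝ) ^ (7 / 16 : ℝ) := by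
              gcongr
              exact mul_le_of_le_one_right hn0.le p.2.2
          _ ≤ (n : ℝ) ^ (1 : ℝ) := Real.rpow_le_rpow_of_exponent_le hn1 (by norm_num)
          _ ≤ n₀ + 1 := by rwa [Real.rpow_one]
      gcongr
      calc _ ≤ τ / (cbar * (n₀ + 1)) * cbar * (n₀ + 1) := by
            gcongr
            exact min_le_right _ _
        _ = τ := by field_simp
    · have := mul_le_mul_of_nonneg_right (min_le_right 1 c₁) hn0.le
      linarith
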